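/- **Setting.** A *(generalized oriented) sphere* is an oriented sphere, an oriented plane, or a point of $\widehat{\mathbb R}^3=\mathbb R^3\cup\{\infty\}$; these correspond to the points of the Lie quadric $\{\langle v,v\rangle=0\}$ in $P(\mathbb R^{4,2})$, and oriented contact is $\langle v,w\rangle=0$. A *contact element* $(x,n)$ (a point with a unit normal) is a projective line contained in the Lie quadric. A *Dupin cyclide* is given by two mutually polar projective planes $P_1,P_2$ of signature $(++-)$, i.e. by two 1-parameter families (conics) of spheres such that every sphere of one family touches every sphere of the other; circles (one of the families consists only of points) are excluded. If $s^{(i)}(t)$ are quadratic parametrizations of the two conics, then $(t_1,t_2)\mapsto \operatorname{span}(s^{(1)}(t_1),s^{(2)}(t_2))$ is a curvature line parametrization of the cyclide by contact elements. A *proper cyclidic patch* is the restriction of such a parametrization to a closed rectangle, normalized to $[0,1]^2$. A *spherical patch* is the restriction to a closed rectangle of an orthogonal parametrization of an oriented sphere or plane by two orthogonal pencils of circles; up to Möbius transformations, this is the parametrization of the Riemann sphere by Cartesian coordinates $u+iv$ ($u,v\in\mathbb R\cup\{\infty\}$) or by polar coordinates $\rho e^{i\varphi}$ (signed radius $\rho\in\mathbb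 R\cup\{\infty\}$, $\varphi\in\mathbb R/2\pi$), with either coordinate first. *Cyclidic patches* are the proper and the spherical ones, considered up to increasing changes of each of the two parameters; they may contain singular points and the point $\infty$. The vertices of a patch $f$ are $x=f(0,0)$, $x_1=f(1,0)$, $x_{12}=f(1,1)$, $x_2=f(0,1)$. Its *vertex frame* at $x$ is $(t^{(1)},t^{(2)},n)$, where $t^{(i)}$ is the unit tangent vector at $x$ of the boundary arc from $x$ to $x_i$, directed from $x$ to $x_i$, and $n$ is the unit normal of the patch at $x$. **Theorem.** Let $x,x_1,x_{12},x_2\in\mathbb R^3$ be four distinct points lying on a circle or on a straight line. 1. Every cyclidic patch with vertices $(x,x_1,x_{12},x_2)$ has a unique vertex frame at $x$, which is orthonormal, and for every orthonormal 3-frame $B=(t^{(1)},t^{(2)},n)$ of $\mathbb R^3$ (of either orientation) there is exactly one cyclidic patch with vertices $(x,x_1,x_{12},x_2)$ and vertex frame $B$ at $x$. So the cyclidic patches with these vertices are in bijection with the orthonormal 3-frames at $x$. 2. The space of orthonormal 3-frames is a three-dimensional topological manifold (locally homeomorphic to $\mathbb R^3$); hence this is a 3-parameter family of patches. 3. The spherical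 patches in this family are limits of proper ones: for each spherical patch with vertices $(x,x_1,x_{12},x_2)$ (given by a parametrization as above) there is a sequence of parametrized proper cyclidic patches with the same vertices whose points converge to the points of the spherical patch locally uniformly on $[0,1]^2$ (in $\mathbb R^3\cup\{\infty\}$), and whose contact elements converge locally uniformly outside at most one parameter pair. -/

import Mathlib

open Filter Topology
open scoped unitInterval

noncomputable section

namespace LieGeometry

/-! ## Lie geometry of oriented spheres in `ℝ³ ∪ {∞}` -/

/-- Euclidean three-space. -/
abbrev E3 : Type := EuclideanSpace ℝ (Fin 3)

/-- Homogeneous coordinates `ℝ^{4,2}`: the tuple `(c, α, β, ρ)` stands for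
`c + α e₀ + β e_∞ + ρ e_r` with `c ∈ ℝ³`. -/
abbrev LieVec : Type := E3 × ℝ × ℝ × ℝ

/-- The `e_r`-component (which vanishes exactly on point spheres). -/
def rCoord (v : LieVec) : ℝ := v.2.2.2

/-- The inner product of signature `(4,2)`: Euclidean on `ℝ³`, with `e₀`, `e_∞` isotropic,
`⟨e₀, e_∞⟩ = -1/2`, `⟨e_r, e_r⟩ = -1`, and all other products of basis vectors zero. -/
def lieForm : LinearMap.BilinForm ℝ LieVec :=
  LinearMap.mk₂ ℝ
    (fun v w => inner ℝ v.1 w.1 - (v.2.1 * w.2.2.1 + v.2.2.1 * w.2.1) / 2 - v.2.2.2 * w.2.2.2)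
    (by intro a b c; simp only [Prod.fst_add, Prod.snd_add, inner_add_left]; ring)
    (by intro k a b
        simp only [Prod.smul_fst, Prod.smul_snd, real_inner_smul_left, smul_eq_mul]; ring)
    (by intro a b c; simp only [Prod.fst_add, Prod.snd_add, inner_add_right]; ring)
    (by intro k a b
        simp only [Prod.smul_fst, Prod.smul_snd, real_inner_smul_right, smul_eq_mul]; ring)

/-- Homogeneous coordinates of a (generalized, oriented) sphere: a nonzero isotropic vector.
Proper spheres with centre `c` and oriented radius `r` are `(c, 1, ‖c‖² - r², r)`. -/
def IsSphere (s : LieVec) : Prop := s ≠ 0 ∧ lieForm s s = 0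

/-- Coordinates of the point spheres: `x + e₀ + ‖x‖² e_∞` for `x ∈ ℝ³`, and `e_∞` for `∞`. -/
def pointSphere : OnePoint E3 → LieVec
  | none => (0, 0, 1, 0)
  | some x => (x, 1, ‖x‖ ^ 2, 0)

/-- Coordinates `n + 2 d e_∞ + e_r` of the oriented plane with unit normal `n` and offset `d`. -/
def orientedPlane (n : E3) (d : ℝ) : LieVec := (n, 0, 2 * d, 1)

/-- The contact element `(x, n)` as an isotropic line of the projective space, that is, as a
two-dimensional subspace: all spheres through `x` with unit normal `n` at `x`. -/
def contactElement (x n : E3) : Submodule ℝ LieVec :=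
  Submodule.span ℝ {pointSphere (x : OnePoint E3), orientedPlane n (inner ℝ x n)}

/-- `p` is the point of the contact element `L`, i.e. `p ∈ L` as a point sphere. -/
def IsPointOf (p : OnePoint E3) (L : Submodule ℝ LieVec) : Prop := pointSphere p ∈ L

/-! ## Dupin cyclides -/

/-- Projective planes of signature `(++-)`. -/
def IsCyclidicPlane (P : Submodule ℝ LieVec) : Prop :=
  ∃ a b c : LieVec, Submodule.span ℝ {a, b, c} = P ∧
    lieForm a a = 1 ∧ lieForm b b = 1 ∧ lieForm c c = -1 ∧
    lieForm a b = 0 ∧ lieForm a c = 0 ∧ lieForm b c = 0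

/-- A Dupin cyclide: two one-parameter families of spheres (the conics of isotropic points in
`P₁` and `P₂`) such that each sphere of one family is in oriented contact with each sphere of the
other family. Circles (one of the families consists of points) are excluded. -/
structure DupinCyclide where
  P₁ : Submodule ℝ LieVec
  P₂ : Submodule ℝ LieVec
  cyclidic₁ : IsCyclidicPlane P₁
  cyclidic₂ : IsCyclidicPlane P₂
  polar : lieForm.orthogonal P₁ = P₂
  not_points₁ : ∃ v ∈ P₁, rCoord v ≠ 0
  not_points₂ : ∃ v ∈ P₂, rCoord v ≠ 0

/-- `a`, `b`, `c` represent three distinct spheres of the family given by the plane `P`. -/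
def IsSphereTriple (P : Submodule ℝ LieVec) (a b c : LieVec) : Prop :=
  (a ∈ P ∧ IsSphere a) ∧ (b ∈ P ∧ IsSphere b) ∧ (c ∈ P ∧ IsSphere c) ∧
    LinearIndependent ℝ ![a, b] ∧ LinearIndependent ℝ ![a, c] ∧ LinearIndependent ℝ ![b, c]

/-- The quadratic (projective) parametrization of the conic through three of its points
`a`, `b`, `c`, attained at `t = 0, 1/2, 1`. -/
def conicParam (a b c : LieVec) (t : ℝ) : LieVec :=
  (lieForm b c * (2 * t ^ 2 - 3 * t + 1)) • a + (lieForm a c * (t - t ^ 2)) • b +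
    (lieForm a b * (2 * t ^ 2 - t)) • c

/-! ## Cyclidic patches

A parametrized patch is a map from `[0,1] × [0,1]` to contact elements, given as subspaces
of `ℝ^{4,2}`. -/

/-- A (proper) parametrized cyclidic patch: the restriction to a closed rectangle (normalized
to `[0,1] × [0,1]` by the choice of the three spheres in each family) of a curvature line
parametrization `(t₁, t₂) ↦ inc[s⁽¹⁾(t₁), s⁽²⁾(t₂)]` of a Dupin cyclide. -/
def IsProperPatch (L : I → I → Submodule ℝ LieVec) : Prop :=
  ∃ (C : DupinCyclide) (a b c a' b' c' : LieVec),
    IsSphereTriple C.P₁ a b c ∧ IsSphereTriple C.P₂ a' b' c' ∧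
    ∀ t₁ t₂ : I, L t₁ t₂ = Submodule.span ℝ {conicParam a b c t₁, conicParam a' b' c' t₂}

/-- `s` is an oriented sphere or plane (not a point), and `q₀, q₁, q₂, q_∞` are vectors in the
space of points of `s` with the Gram matrix of `e₀, e₁, e₂, e_∞`. Then
`z = a + b i ↦ q₀ + a q₁ + b q₂ + |z|² q_∞`, `∞ ↦ q_∞` is a Möbius transformation of the
Riemann sphere `ℂ ∪ {∞}` onto (the points of) `s`, and all of them arise in this way. -/
def IsMoebiusChart (s q₀ q₁ q₂ qinf : LieVec) : Prop :=
  IsSphere s ∧ rCoord s ≠ 0 ∧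
    (∀ q ∈ ({q₀, q₁, q₂, qinf} : Set LieVec), rCoord q = 0 ∧ lieForm s q = 0) ∧
    lieForm q₀ q₀ = 0 ∧ lieForm qinf qinf = 0 ∧ lieForm q₀ qinf = -1 / 2 ∧
    lieForm q₁ q₁ = 1 ∧ lieForm q₂ q₂ = 1 ∧ lieForm q₁ q₂ = 0 ∧
    lieForm q₀ q₁ = 0 ∧ lieForm q₀ q₂ = 0 ∧ lieForm qinf q₁ = 0 ∧ lieForm qinf q₂ = 0

/-- Image under the Möbius chart of the Cartesian coordinates `u₁/u₀ + (v₁/v₀) i`, where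
`u = [u₀ : u₁]` and `v = [v₀ : v₁]` are in `ℝ ∪ {∞}`, and `z = ∞` if `u` or `v` is `∞`.
The coordinate lines are two orthogonal families of parallel lines. -/
def cartesianPoint (q₀ q₁ q₂ qinf : LieVec) (u v : ℝ × ℝ) : LieVec :=
  if u.1 * v.1 = 0 then qinf
  else q₀ + (u.2 / u.1) • q₁ + (v.2 / v.1) • q₂ + ((u.2 / u.1) ^ 2 + (v.2 / v.1) ^ 2) • qinf

/-- Image under the Möbius chart of the polar coordinates `z = ρ e^{iφ}`, where the signed radius
is `ρ = u₁/u₀ ∈ ℝ ∪ {∞}`, and `e^{iφ} = (v₀ + v₁ i)² / (v₀² + v₁²)` (so `tan (φ/2) = v₁/v₀`). In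
homogeneous form. The coordinate lines are all lines through the origin and all circles
about the origin. -/
def polarPoint (q₀ q₁ q₂ qinf : LieVec) (u v : ℝ × ℝ) : LieVec :=
  (v.1 ^ 2 + v.2 ^ 2) • (u.1 ^ 2 • q₀ + u.2 ^ 2 • qinf) +
    (u.1 * u.2) • ((v.1 ^ 2 - v.2 ^ 2) • q₁ + (2 * v.1 * v.2) • q₂)

/-- For linearly independent `α`, `β` this parametrizes over `[0,1]` a closed interval of the
projective line `ℝ ∪ {∞}` from `[α]` to `[β]` (the two choices are given by `β` and `-β`). -/
def lineParam (α β : ℝ × ℝ) (t : ℝ) : ℝ × ℝ := (1 - t) • α + t • β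

/-- A parametrized spherical patch: an oriented sphere or plane `s`, together with the
restriction to a closed rectangle of an orthogonal parametrization of `s` whose coordinate lines
are the circles of two orthogonal pencils. Up to Möbius transformations the two pencils are given
by Cartesian or by polar coordinates in the plane. -/
def IsSphericalPatch (L : I → I → Submodule ℝ LieVec) : Prop :=
  ∃ (s q₀ q₁ q₂ qinf : LieVec) (α β γ δ : ℝ × ℝ), IsMoebiusChart s q₀ q₁ q₂ qinf ∧
    LinearIndependent ℝ ![α, β] ∧ LinearIndependent ℝ ![γ, δ] ∧
    ((∀ t₁ t₂ : I, L t₁ t₂ = Submodule.span ℝ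
        {s, cartesianPoint q₀ q₁ q₂ qinf (lineParam α β t₁) (lineParam γ δ t₂)}) ∨
     (∀ t₁ t₂ : I, L t₁ t₂ = Submodule.span ℝ
        {s, polarPoint q₀ q₁ q₂ qinf (lineParam α β t₁) (lineParam γ δ t₂)}) ∨
     (∀ t₁ t₂ : I, L t₁ t₂ = Submodule.span ℝ
        {s, polarPoint q₀ q₁ q₂ qinf (lineParam γ δ t₂) (lineParam α β t₁)}))

/-- Parametrized cyclidic patches, including the degenerate spherical ones. -/
def IsCyclidicPatch (L : I → I → Submodule ℝ LieVec) : Prop :=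
  IsProperPatch L ∨ IsSphericalPatch L

/-- The vertices of a parametrized patch are `x = f(0,0)`, `x₁ = f(1,0)`, `x₁₂ = f(1,1)`,
`x₂ = f(0,1)`. -/
def HasVertices (L : I → I → Submodule ℝ LieVec) (x x₁ x₁₂ x₂ : E3) : Prop :=
  IsPointOf (x : OnePoint E3) (L 0 0) ∧ IsPointOf (x₁ : OnePoint E3) (L 1 0) ∧
    IsPointOf (x₁₂ : OnePoint E3) (L 1 1) ∧ IsPointOf (x₂ : OnePoint E3) (L 0 1)

/-- `t` is the unit tangent vector at its initial point `x` of the curve of points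
of a family `c` of contact elements: the limit of the directions of the secants from `x`. -/
def HasInitialTangent (c : I → Submodule ℝ LieVec) (x t : E3) : Prop :=
  ∃ p : I → E3, (∀ᶠ u in 𝓝[>] (0 : I), IsPointOf (p u : OnePoint E3) (c u)) ∧
    Tendsto (fun u => ‖p u - x‖⁻¹ • (p u - x)) (𝓝[>] (0 : I)) (𝓝 t)

/-- Orthonormal 3-frames `(t⁽¹⁾, t⁽²⁾, n)` of `ℝ³`, of both orientations, with the subspace
topology. -/
abbrev OrthonormalFrame : Type := {B : Fin 3 → E3 // Orthonormal ℝ B}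

/-- `B = (t⁽¹⁾, t⁽²⁾, n)` is the vertex frame of the patch `L` at `x = f(0,0)`: `t⁽ⁱ⁾` is tangent
at `x` to the boundary arc from `x` to `xᵢ` (directed from `x` to `xᵢ`), and `n` is the normal. -/
def HasVertexFrame (L : I → I → Submodule ℝ LieVec) (x : E3) (B : OrthonormalFrame) : Prop :=
  HasInitialTangent (fun t => L t 0) x (B.1 0) ∧ HasInitialTangent (fun t => L 0 t) x (B.1 1) ∧
    L 0 0 = contactElement x (B.1 2)

/-- Parametrized cyclidic patches with prescribed vertices. -/
abbrev ParamPatch (x x₁ x₁₂ x₂ : E3) : Type :=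
  {L : I → I → Submodule ℝ LieVec // IsCyclidicPatch L ∧ HasVertices L x x₁ x₁₂ x₂}

/-- Two parametrized patches are the same patch if they differ by increasing changes of the
two parameters. -/
instance patchSetoid (x x₁ x₁₂ x₂ : E3) : Setoid (ParamPatch x x₁ x₁₂ x₂) where
  r L L' := ∃ φ ψ : I ≃o I, ∀ t₁ t₂ : I, L'.1 t₁ t₂ = L.1 (φ t₁) (ψ t₂)
  iseqv :=
    { refl := fun _ => ⟨OrderIso.refl I, OrderIso.refl I, fun _ _ => rfl⟩
      symm := by
        rintro L L' ⟨φ, ψ, h⟩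
        exact ⟨φ.symm, ψ.symm, fun t₁ t₂ => by rw [h]; simp⟩
      trans := by
        rintro L L' L'' ⟨φ, ψ, h⟩ ⟨φ', ψ', h'⟩
        exact ⟨φ'.trans φ, ψ'.trans ψ, fun t₁ t₂ => by rw [h', h]; rfl⟩ }

/-- Cyclidic patches (proper or spherical) with vertices `(x, x₁, x₁₂, x₂)`. -/
def CyclidicPatch (x x₁ x₁₂ x₂ : E3) : Type := Quotient (patchSetoid x x₁ x₁₂ x₂)

/-- Four points of `ℝ³` are concircular if they lie on a circle or on a straight line. -/
def Concircular (x x₁ x₁₂ x₂ : E3) : Prop :=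
  EuclideanGeometry.Concyclic ({x, x₁, x₁₂, x₂} : Set E3) ∨
    Collinear ℝ ({x, x₁, x₁₂, x₂} : Set E3)

/-- The patches `Lk k` converge to the patch `L`: the points converge locally uniformly on
`[0,1] × [0,1]` in `ℝ³ ∪ {∞}`, and the contact elements converge locally uniformly
outside at most one parameter pair. (For subspaces of the same dimension, convergence means that
each vector of the limit is a limit of vectors of the approximating subspaces.) -/
def PatchesTendsTo (Lk : ℕ → I → I → Submodule ℝ LieVec) (L : I → I → Submodule ℝ LieVec) : Prop :=
  (∃ (fk : ℕ → I → I → OnePoint E3) (f : I → I → OnePoint E3),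
    (∀ k t₁ t₂, IsPointOf (fk k t₁ t₂) (Lk k t₁ t₂)) ∧ (∀ t₁ t₂, IsPointOf (f t₁ t₂) (L t₁ t₂)) ∧
    ∀ p : I × I, Tendsto (fun q : ℕ × (I × I) => fk q.1 q.2.1 q.2.2) (atTop ×ˢ 𝓝 p)
      (𝓝 (f p.1 p.2))) ∧
  ∃ p₀ : I × I, ∀ p : I × I, p ≠ p₀ → ∀ w ∈ L p.1 p.2, ∃ W : ℕ × (I × I) → LieVec,
    (∀ q, W q ∈ Lk q.1 q.2.1 q.2.2) ∧ Tendsto W (atTop ×ˢ 𝓝 p) (𝓝 w)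

end LieGeometry

end

open LieGeometry

noncomputable section

namespace LieGeometry

/-! ## The Lie form and points -/

/-! Concircularity is linear in Lie coordinates: four distinct points lie on a circle or line
exactly when their coordinates are dependent, and the relation can be scaled to c x₁₂ = e₂ x₁ + e₁
x₂ − e₁e₂ x (`CircularQuad`).

A frame (t₁, t₂, n) at x determines circular arcs E₁, E₂ from x to x₁, x₂ and two spheres with
normal n at x: b contains the first arc, a the second. They differ by a multiple of the point x, a =
b + k x, where k = −2⟨n, y⟩ and y is tangent at x to the circle of the vertices. Take quadratic
weights Q₁, Q₂ running from 1 to e₁, e₂ and set s₁ = Q₁ b + k E₁, s₂ = Q₂ a − k E₂. Mutual polarity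
of the two families forces the middle coefficients of the weights, and what remains is the relation
of the vertices (`CircularQuad.polar`). The point in the span of s₁, s₂ is P = Q₂E₁ + Q₁E₂ − Q₁Q₂x,
which equals c x₁₂ at (1,1). For k ≠ 0 this is a Dupin cyclide.

For k = 0 the spheres a and b coincide, and P still parametrizes points of b. In a Möbius chart
whose axes are the boundary circles, the sign of one discriminant decides whether P is Cartesian or
polar (`CircularQuad.isSphericalPatch_patch`).

Conversely, any patch is written through Bernstein coefficients. The vertices fix the outer
coefficients up to scale, isotropy and orthogonality turn the rest into an orthonormal frame
(`CircularQuad.exists_frame`), and the only remaining freedom is two positive factors, which are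
projective changes of the parameters. The frame can be read off from the patch, so patches
correspond to frames. Cayley transforms give charts on the space of frames.

For the limits, the vectors a, b, E₁, E₂, P are continuous in the frame, also at k = 0, and a small
rotation makes k nonzero. Convergence is immediate where P ≠ 0. P vanishes at no more than one
parameter pair, and only for Cartesian patches, where both coordinates are infinite. There the
rotation is about t₁ or t₂, so one weight keeps discriminant zero, and `CircularQuad.disc_add_disc`
makes the other discriminant negative. Both weights are then nonnegative, and the rescaled P is, up
to a small term, a convex combination of two points with the same limit. -/

theorem lieForm_apply (v w : LieVec) : lieForm v w =
    inner ℝ v.1 w.1 - (v.2.1 * w.2.2.1 + v.2.2.1 * w.2.1) / 2 - v.2.2.2 * w.2.2.2 := rfl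

theorem lieForm_comm (v w : LieVec) : lieForm v w = lieForm w v := by
  simp only [lieForm_apply, real_inner_comm]; ring

@[simp] theorem rCoord_add (v w : LieVec) : rCoord (v + w) = rCoord v + rCoord w := rfl
@[simp] theorem rCoord_sub (v w : LieVec) : rCoord (v - w) = rCoord v - rCoord w := rfl
@[simp] theorem rCoord_smul (c : ℝ) (v : LieVec) : rCoord (c • v) = c * rCoord v := rfl
@[simp] theorem rCoord_zero : rCoord 0 = 0 := rfl

/-- Homogeneous coordinates of a point of `ℝ³`. -/
def pt (x : E3) : LieVec := (x, 1, ‖x‖ ^ 2, 0)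

theorem pointSphere_coe (x : E3) : pointSphere (x : OnePoint E3) = pt x := rfl

@[simp] theorem rCoord_pt (x : E3) : rCoord (pt x) = 0 := rfl

theorem lieForm_pt_pt (x z : E3) : lieForm (pt x) (pt z) = -(‖z - x‖ ^ 2) / 2 := by
  rw [norm_sub_sq_real, real_inner_comm, lieForm_apply]; simp only [pt]; ring

@[simp] theorem lieForm_pt_self (x : E3) : lieForm (pt x) (pt x) = 0 := by
  simp [lieForm_pt_pt]

theorem lieForm_pt_pt_neg {x z : E3} (h : x ≠ z) : lieForm (pt x) (pt z) < 0 := by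
  rw [lieForm_pt_pt]
  have : 0 < ‖z - x‖ := norm_pos_iff.2 (sub_ne_zero.2 h.symm)
  have := pow_pos this 2
  linarith

/-- The vector `t + 2⟨x, t⟩ e_∞`, orthogonal to the point `x`. -/
def tangentVec (x t : E3) : LieVec := (t, 0, 2 * inner ℝ x t, 0)

@[simp] theorem rCoord_tangentVec (x t : E3) : rCoord (tangentVec x t) = 0 := rfl

theorem lieForm_tangentVec_tangentVec (x t t' : E3) :
    lieForm (tangentVec x t) (tangentVec x t') = inner ℝ t t' := by
  simp [tangentVec, lieForm_apply]

theorem lieForm_tangentVec_pt (x t z : E3) :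
    lieForm (tangentVec x t) (pt z) = inner ℝ t (z - x) := by
  simp only [tangentVec, lieForm_apply, pt, inner_sub_right, real_inner_comm]; ring

theorem lieForm_pt_tangentVec (x t z : E3) :
    lieForm (pt z) (tangentVec x t) = inner ℝ t (z - x) := by
  rw [lieForm_comm, lieForm_tangentVec_pt]

/-- The oriented plane through `x` with normal `n`. -/
def tangentPlane (x n : E3) : LieVec := orientedPlane n (inner ℝ x n)

@[simp] theorem rCoord_tangentPlane (x n : E3) : rCoord (tangentPlane x n) = 1 := rfl

theorem lieForm_tangentPlane_pt (x n z : E3) :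
    lieForm (tangentPlane x n) (pt z) = inner ℝ n (z - x) := by
  simp only [tangentPlane, orientedPlane, lieForm_apply, pt, inner_sub_right, real_inner_comm]; ring

theorem lieForm_pt_tangentPlane (x n z : E3) :
    lieForm (pt z) (tangentPlane x n) = inner ℝ n (z - x) := by
  rw [lieForm_comm, lieForm_tangentPlane_pt]

theorem lieForm_tangentPlane_tangentVec (x n t : E3) :
    lieForm (tangentPlane x n) (tangentVec x t) = inner ℝ n t := by
  simp [tangentPlane, orientedPlane, tangentVec, lieForm_apply]

theorem lieForm_tangentPlane_self (x n : E3) :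
    lieForm (tangentPlane x n) (tangentPlane x n) = ‖n‖ ^ 2 - 1 := by
  simp [tangentPlane, orientedPlane, lieForm_apply]

theorem contactElement_eq (x n : E3) :
    contactElement x n = Submodule.span ℝ {pt x, tangentPlane x n} := rfl

/-- A vector orthogonal to `x` without `e_r`-component is tangential at `x`. -/
theorem exists_eq_tangentVec {x : E3} {p : LieVec} (hr : rCoord p = 0)
    (hp : lieForm p (pt x) = 0) : p = tangentVec x (p.1 - p.2.1 • x) + p.2.1 • pt x := by
  obtain ⟨u, α, β, ρ⟩ := p
  simp only [rCoord] at hr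
  subst hr
  simp only [lieForm_apply, pt] at hp
  simp only [tangentVec, pt, Prod.smul_mk, Prod.mk_add_mk, Prod.mk.injEq, inner_sub_right,
    real_inner_smul_right, real_inner_self_eq_norm_sq, smul_eq_mul, real_inner_comm] at hp ⊢
  refine ⟨by simp, by ring, ?_, by ring⟩
  have := real_inner_comm x u
  linarith

/-- An oriented sphere through `x` in terms of its normal at `x`. -/
theorem exists_eq_tangentPlane {x : E3} {p : LieVec} (hr : rCoord p = 1)
    (hp : lieForm p (pt x) = 0) : p = tangentPlane x (p.1 - p.2.1 • x) + p.2.1 • pt x := by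
  have h := exists_eq_tangentVec (x := x) (p := p - (0, 0, 0, 1)) (by simp [hr]; simp [rCoord])
    (by rw [map_sub, LinearMap.sub_apply, hp]; simp [lieForm_apply, pt])
  have h2 : tangentPlane x (p.1 - p.2.1 • x) = tangentVec x (p.1 - p.2.1 • x) + (0, 0, 0, 1) := by
    simp [tangentPlane, orientedPlane, tangentVec]
  rw [h2, add_right_comm, ← sub_eq_iff_eq_add]
  simpa using h

/-- The form is positive semidefinite on vectors orthogonal to a point, without
`e_r`-component. -/
theorem eq_smul_pt_of_isotropic {x : E3} {p : LieVec} (hr : rCoord p = 0)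
    (hp : lieForm p (pt x) = 0) (hpp : lieForm p p = 0) : p = p.2.1 • pt x := by
  have h := exists_eq_tangentVec hr hp
  have h0 : p.1 - p.2.1 • x = 0 := by
    set t := p.1 - p.2.1 • x
    set α := p.2.1
    rw [h] at hpp
    simp [lieForm_tangentVec_tangentVec, lieForm_tangentVec_pt, lieForm_pt_tangentVec] at hpp
    exact hpp
  rw [h0] at h
  rw [h]; simp [tangentVec, pt]

/-! ## Quadratic Bézier curves -/

/-- The quadratic curve with Bernstein coefficients `a`, `b / 2`, `c`. -/
def quad {V : Type*} [AddCommGroup V] [Module ℝ V] (a b c : V) (t : ℝ) : V :=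
  (1 - t) ^ 2 • a + (t * (1 - t)) • b + t ^ 2 • c

theorem quad_real (a b c t : ℝ) : quad a b c t = (1 - t) ^ 2 * a + (t * (1 - t)) * b + t ^ 2 * c :=
  rfl

section
variable {V : Type*} [AddCommGroup V] [Module ℝ V]

@[simp] theorem quad_at_zero (a b c : V) : quad a b c 0 = a := by simp [quad]
@[simp] theorem quad_at_one (a b c : V) : quad a b c 1 = c := by simp [quad]

theorem quad_smul (r : ℝ) (a b c : V) (t : ℝ) :
    quad (r • a) (r • b) (r • c) t = r • quad a b c t := by
  simp only [quad]; module

/-- The denominator of the projective change of parameter `t ↦ λt / ((1 - t) + λt)`. -/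
def repDen (l t : ℝ) : ℝ := (1 - t) + l * t

/-- The projective change of parameter of `[0,1]` fixing `0` and `1`. -/
def rep (l t : ℝ) : ℝ := l * t / repDen l t

theorem repDen_pos {l : ℝ} (hl : 0 < l) (t : I) : 0 < repDen l t := by
  obtain ⟨t, h0, h1⟩ := t
  simp only [repDen]
  rcases h1.lt_or_eq with h | h
  · nlinarith [mul_nonneg hl.le h0]
  · simp [h, hl]

/-- Uses repDen · rep = l t and repDen · (1 − rep) = 1 − t. Scaling the Bernstein coefficients by 1,
l, l² is the freedom left once the vertices are fixed, and this identity turns it into a change of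
parameter. -/
theorem quad_rep {l t : ℝ} (h : repDen l t ≠ 0) (a b c : V) :
    quad a (l • b) (l ^ 2 • c) t = repDen l t ^ 2 • quad a b c (rep l t) := by
  have h1 : repDen l t * rep l t = l * t := by rw [rep]; field_simp
  have h2 : repDen l t * (1 - rep l t) = 1 - t := by rw [mul_sub, h1, repDen]; ring
  simp only [quad, smul_add, smul_smul]
  congr 1
  · congr 1
    · congr 1; rw [← mul_pow, h2]
    · congr 1
      linear_combination (-repDen l t * (1 - rep l t)) * h1 - (l * t) * h2
  · congr 1; linear_combination (-repDen l t * rep l t - l * t) * h1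

theorem rep_inv_rep {l t : ℝ} (hl : l ≠ 0) (h : repDen l t ≠ 0) : rep l⁻¹ (rep l t) = t := by
  simp only [rep, repDen] at h ⊢
  have : 1 - l * t / (1 - t + l * t) + l⁻¹ * (l * t / (1 - t + l * t)) =
    1 / (1 - t + l * t) := by field_simp; ring
  rw [this]; field_simp

/-- `rep l` as an increasing change of parameter. -/
def repIso (l : ℝ) (hl : 0 < l) : I ≃o I where
  toFun t := ⟨rep l t, div_nonneg (mul_nonneg hl.le t.2.1) (repDen_pos hl t).le,
    (div_le_one (repDen_pos hl t)).2 (by simp only [repDen]; linarith [t.2.2])⟩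
  invFun t := ⟨rep l⁻¹ t, div_nonneg (mul_nonneg (inv_pos.2 hl).le t.2.1)
    (repDen_pos (inv_pos.2 hl) t).le,
    (div_le_one (repDen_pos (inv_pos.2 hl) t)).2 (by simp only [repDen]; linarith [t.2.2])⟩
  left_inv t := Subtype.ext (rep_inv_rep hl.ne' (repDen_pos hl t).ne')
  right_inv t := Subtype.ext (by
    simpa using rep_inv_rep (inv_pos.2 hl).ne' (repDen_pos (inv_pos.2 hl) t).ne')
  map_rel_iff' := by
    intro s t
    have hs := repDen_pos hl s
    have ht := repDen_pos hl t
    simp only [Equiv.coe_fn_mk, Subtype.mk_le_mk, rep]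
    rw [div_le_div_iff₀ hs ht, ← Subtype.coe_le_coe]
    simp only [repDen]
    constructor
    · intro h; nlinarith
    · intro h; nlinarith

@[simp] theorem coe_repIso (l : ℝ) (hl : 0 < l) (t : I) : (repIso l hl t : ℝ) = rep l t := rfl

end

theorem span_pair_smul {c d : ℝ} (hc : c ≠ 0) (hd : d ≠ 0) (v w : LieVec) :
    Submodule.span ℝ {c • v, d • w} = Submodule.span ℝ {v, w} := by
  rw [Submodule.span_insert, Submodule.span_insert,
    Submodule.span_singleton_smul_eq hc.isUnit, Submodule.span_singleton_smul_eq hd.isUnit]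

/-! ## Boundary arcs -/

/-- Image of `z` under the inversion in the unit sphere about `x`, as a vector from `x`. -/
def invVec (x z : E3) : E3 := (‖z - x‖ ^ 2)⁻¹ • (z - x)

/-- Middle coefficient of the circular arc from `x` to `z` with initial tangent `t`. -/
def arcMid (x z t : E3) : LieVec :=
  ‖z - x‖ • (tangentVec x t + (2 * inner ℝ t (invVec x z)) • pt x)

/-- The circular arc from `x` to `z` with initial tangent `t`. -/
def arc (x z t : E3) (s : ℝ) : LieVec := quad (pt x) (arcMid x z t) (pt z) s

@[simp] theorem rCoord_arcMid (x z t : E3) : rCoord (arcMid x z t) = 0 := by simp [arcMid]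

@[simp] theorem rCoord_arc (x z t : E3) (s : ℝ) : rCoord (arc x z t s) = 0 := by
  simp [arc, quad]

theorem inner_invVec {x z : E3} (h : x ≠ z) (t : E3) :
    inner ℝ t (invVec x z) * ‖z - x‖ ^ 2 = inner ℝ t (z - x) := by
  have : ‖z - x‖ ≠ 0 := norm_ne_zero_iff.2 (sub_ne_zero.2 h.symm)
  rw [invVec, real_inner_smul_right]; field_simp

@[simp] theorem lieForm_arcMid_left (x z t : E3) : lieForm (arcMid x z t) (pt x) = 0 := by
  simp [arcMid, lieForm_tangentVec_pt]

/-- Inversion about x turns circles through x into lines, so only the t-component of the difference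
of inverted points enters. With w the opposite neighbour of x, this is the source of the weights
`m₁` and `m₂`. -/
theorem lieForm_arcMid_pt {x z w t : E3} (h : x ≠ w) :
    lieForm (arcMid x z t) (pt w) =
      2 * ‖z - x‖ * inner ℝ t (invVec x z - invVec x w) * lieForm (pt x) (pt w) := by
  simp only [arcMid, map_add, map_smul, LinearMap.add_apply, LinearMap.smul_apply, smul_eq_mul,
    lieForm_tangentVec_pt, lieForm_pt_pt, inner_sub_right]
  have := inner_invVec h t
  rw [inner_sub_right] at this
  linear_combination (-‖z - x‖) * this

theorem lieForm_arcMid_right {x z t : E3} (h : x ≠ z) : lieForm (arcMid x z t) (pt z) = 0 := by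
  rw [lieForm_arcMid_pt h]; simp

theorem lieForm_arcMid_arcMid (x z z' t t' : E3) :
    lieForm (arcMid x z t) (arcMid x z' t') = ‖z - x‖ * ‖z' - x‖ * inner ℝ t t' := by
  simp [arcMid, lieForm_tangentVec_tangentVec, lieForm_tangentVec_pt, lieForm_pt_tangentVec]
  ring

/-- The factor ‖z − x‖ in `arcMid` is chosen for this: it is the normalization under which the
quadratic curve `arc` stays isotropic. -/
theorem lieForm_arcMid_self {x z t : E3} (ht : ‖t‖ = 1) :
    lieForm (arcMid x z t) (arcMid x z t) = -2 * lieForm (pt x) (pt z) := by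
  rw [lieForm_arcMid_arcMid, real_inner_self_eq_norm_sq, ht, lieForm_pt_pt]; ring

theorem lieForm_tangentPlane_arcMid (x z t n : E3) :
    lieForm (tangentPlane x n) (arcMid x z t) = ‖z - x‖ * inner ℝ n t := by
  simp [arcMid, lieForm_tangentPlane_tangentVec, lieForm_tangentPlane_pt]

theorem lieForm_pt_arcMid (x z t w : E3) :
    lieForm (pt w) (arcMid x z t) = lieForm (arcMid x z t) (pt w) := lieForm_comm _ _

/-- Isotropic curves of points through `x` and `z` are circular arcs. -/
theorem exists_eq_arcMid {x z : E3} (hxz : x ≠ z) {k c : ℝ} (hk : k ≠ 0) (hc : c ≠ 0) {p : LieVec}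
    (hr : rCoord p = 0) (hx : lieForm p (pt x) = 0) (hz : lieForm p (pt z) = 0)
    (hp : lieForm p p = -2 * (k * c) * lieForm (pt x) (pt z)) :
    ∃ (l : ℝ) (t : E3), 0 < l ∧ ‖t‖ = 1 ∧ c = k * l ^ 2 ∧ p = (k * l) • arcMid x z t := by
  have hpx := exists_eq_tangentVec hr hx
  set u := p.1 - p.2.1 • x
  set α := p.2.1
  have hn : 0 < ‖z - x‖ := norm_pos_iff.2 (sub_ne_zero.2 hxz.symm)
  rw [hpx] at hp hz
  simp only [map_add, map_smul, LinearMap.add_apply, LinearMap.smul_apply, smul_eq_mul,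
    lieForm_tangentVec_pt, lieForm_pt_tangentVec, lieForm_tangentVec_tangentVec, lieForm_pt_pt,
    real_inner_self_eq_norm_sq, sub_self, inner_zero_right, norm_zero] at hp hz
  have h1 : ‖u‖ ^ 2 = k * c * ‖z - x‖ ^ 2 := by linarith
  have hkc : 0 < k * c := by
    have : 0 ≤ k * c := by
      by_contra h
      have := mul_neg_of_neg_of_pos (not_le.1 h) (pow_pos hn 2)
      nlinarith [sq_nonneg ‖u‖]
    exact lt_of_le_of_ne this (mul_ne_zero hk hc).symm
  have hck : 0 < c / k := by
    have : c / k = k * c / k ^ 2 := by field_simp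
    rw [this]; positivity
  -- The norm of u shows that k and c have the same sign. The end coefficient is then k l², which
  -- matches the scaling by 1, l, l² in `quad_rep`.
  set l := √(c / k)
  have hl : 0 < l := Real.sqrt_pos.2 hck
  have hl2 : c = k * l ^ 2 := by rw [Real.sq_sqrt hck.le]; field_simp
  have hkl : k * l * ‖z - x‖ ≠ 0 := by positivity
  refine ⟨l, (k * l * ‖z - x‖)⁻¹ • u, hl, ?_, hl2, ?_⟩
  · rw [norm_smul, ← sq_eq_sq₀ (by positivity) (by positivity), mul_pow, h1, Real.norm_eq_abs,
      sq_abs, hl2]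
    field_simp
  · rw [hpx, arcMid]
    have hT : tangentVec x ((k * l * ‖z - x‖)⁻¹ • u) = (k * l * ‖z - x‖)⁻¹ • tangentVec x u := by
      simp [tangentVec, real_inner_smul_right]; ring
    have hα : α * ‖z - x‖ ^ 2 = 2 * inner ℝ u (z - x) := by linarith
    have hα' : α = 2 * inner ℝ u (invVec x z) := by
      have := inner_invVec hxz u
      have h3 : ‖z - x‖ ^ 2 ≠ 0 := by positivity
      apply mul_right_cancel₀ h3
      rw [hα, mul_assoc, this]
    rw [hT, real_inner_smul_left, smul_add, smul_add, smul_smul, smul_smul, smul_smul, smul_smul,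
      mul_inv_cancel₀ hkl, one_smul]
    congr 2
    rw [hα']; field_simp

/-! ## Circular quadrilaterals -/

/-- Four points on a circle or line, through a linear relation between their coordinates. -/
structure CircularQuad where
  x : E3
  x₁ : E3
  x₁₂ : E3
  x₂ : E3
  e₁ : ℝ
  e₂ : ℝ
  c : ℝ
  ne₁ : x ≠ x₁
  ne₂ : x ≠ x₂
  ne₃ : x₁ ≠ x₂
  e₁_ne : e₁ ≠ 0
  e₂_ne : e₂ ≠ 0
  c_ne : c ≠ 0
  rel : c • pt x₁₂ = e₂ • pt x₁ + e₁ • pt x₂ - (e₁ * e₂) • pt x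

/-- Three distinct points have linearly independent coordinates. -/
theorem pt_independent {x y z : E3} (hxy : x ≠ y) (hxz : x ≠ z) (hyz : y ≠ z) {a b c : ℝ}
    (h : a • pt x + b • pt y + c • pt z = 0) : a = 0 ∧ b = 0 ∧ c = 0 := by
  have p := (lieForm_pt_pt_neg hxy).ne
  have q := (lieForm_pt_pt_neg hxz).ne
  have r := (lieForm_pt_pt_neg hyz).ne
  have hx := congrArg (lieForm (pt x)) h
  have hy := congrArg (lieForm (pt y)) h
  have hz := congrArg (lieForm (pt z)) h
  simp only [map_add, map_smul, smul_eq_mul, lieForm_pt_self, map_zero] at hx hy hz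
  rw [lieForm_comm (pt y) (pt x)] at hy
  rw [lieForm_comm (pt z) (pt x), lieForm_comm (pt z) (pt y)] at hz
  set P := lieForm (pt x) (pt y)
  set Q := lieForm (pt x) (pt z)
  set R := lieForm (pt y) (pt z)
  have ha : a * (2 * P * Q) = 0 := by linear_combination Q * hy + P * hz - R * hx
  have hb : b * (2 * P * R) = 0 := by linear_combination R * hx + P * hz - Q * hy
  have hc : c * (2 * Q * R) = 0 := by linear_combination R * hx + Q * hy - P * hz
  exact ⟨by simpa [p, q] using ha, by simpa [p, r] using hb, by simpa [q, r] using hc⟩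

/-- Linearly dependent coordinates give a circular quadrilateral. -/
theorem exists_circularQuad {x x₁ x₁₂ x₂ : E3} (h01 : x ≠ x₁) (h02 : x ≠ x₂) (h03 : x ≠ x₁₂)
    (h12 : x₁ ≠ x₂) (h13 : x₁ ≠ x₁₂) (h23 : x₂ ≠ x₁₂) {a b c d : ℝ}
    (h : a • pt x + b • pt x₁ + c • pt x₂ + d • pt x₁₂ = 0)
    (h0 : ¬(a = 0 ∧ b = 0 ∧ c = 0 ∧ d = 0)) :
    ∃ V : CircularQuad, V.x = x ∧ V.x₁ = x₁ ∧ V.x₁₂ = x₁₂ ∧ V.x₂ = x₂ := by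
  have hd : d ≠ 0 := by
    rintro rfl
    rw [zero_smul, add_zero] at h
    exact h0 (by simpa [and_assoc] using pt_independent h01 h02 h12 h)
  have ha : a ≠ 0 := by
    rintro rfl
    rw [zero_smul, zero_add] at h
    exact hd (pt_independent h12 h13 h23 h).2.2
  have hb : b ≠ 0 := by
    rintro rfl
    rw [zero_smul, add_zero] at h
    exact hd (pt_independent h02 h03 h23 h).2.2
  have hc : c ≠ 0 := by
    rintro rfl
    rw [zero_smul, add_zero] at h
    exact hd (pt_independent h01 h03 h13 h).2.2
  -- The relation is multiplied by the factor that makes the coefficient of x minus the product of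
  -- those of x₁ and x₂.
  refine ⟨⟨x, x₁, x₁₂, x₂, -a / b, -a / c, a * d / (b * c), h01, h02, h12, ?_, ?_, ?_, ?_⟩,
    rfl, rfl, rfl, rfl⟩
  · exact div_ne_zero (neg_ne_zero.2 ha) hb
  · exact div_ne_zero (neg_ne_zero.2 ha) hc
  · positivity
  · have : pt x₁₂ = (-(a / d)) • pt x + (-(b / d)) • pt x₁ + (-(c / d)) • pt x₂ := by
      have : pt x₁₂ = d⁻¹ • (d • pt x₁₂) := by rw [smul_smul, inv_mul_cancel₀ hd, one_smul]
      rw [this, eq_neg_of_add_eq_zero_right h]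
      module
    rw [this]
    simp only [smul_add, smul_smul, sub_eq_add_neg, ← neg_smul]
    have h1 : a * d / (b * c) * -(a / d) = -(-a / b * (-a / c)) := by field_simp
    have h2 : a * d / (b * c) * -(b / d) = -a / c := by field_simp
    have h3 : a * d / (b * c) * -(c / d) = -a / b := by field_simp
    rw [h1, h2, h3]
    abel

/-- On a circle, coplanarity gives an affine dependence, and the same coefficients annihilate the
squared norms because ‖·‖² is affine on a sphere. On a line, the coordinates are quadratic
polynomials in one parameter, so any four of them are dependent. -/
theorem exists_circularQuad_of_concircular {x x₁ x₁₂ x₂ : E3} (hdist : [x, x₁, x₁₂, x₂].Nodup)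
    (hcirc : Concircular x x₁ x₁₂ x₂) :
    ∃ V : CircularQuad, V.x = x ∧ V.x₁ = x₁ ∧ V.x₁₂ = x₁₂ ∧ V.x₂ = x₂ := by
  simp only [List.nodup_cons, List.mem_cons, not_or, List.not_mem_nil, not_false_eq_true,
    List.nodup_nil, and_true] at hdist
  obtain ⟨⟨h01, h03, h02⟩, ⟨h13, h12⟩, h32⟩ := hdist
  rcases hcirc with ⟨⟨z, R, hz⟩, hcop⟩ | hcol
  · have hna : ¬ AffineIndependent ℝ ![x, x₁, x₂, x₁₂] := by
      intro hai
      have h4 := hai.finrank_vectorSpan (n := 3) (by simp)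
      have hr : Set.range ![x, x₁, x₂, x₁₂] = {x, x₁, x₁₂, x₂} := by
        ext y; simp [Matrix.range_cons]; tauto
      rw [hr] at h4
      have := Module.finrank_le_of_rank_le (n := 2) hcop
      omega
    rw [affineIndependent_iff] at hna
    push Not at hna
    obtain ⟨s, w, hw0, hw, i, his, hi⟩ := hna
    set v : Fin 4 → ℝ := fun j => if j ∈ s then w j else 0
    have hv0 : ∑ j, v j = 0 := by simpa [v, Finset.sum_ite_mem] using hw0
    have hv : ∑ j, v j • ![x, x₁, x₂, x₁₂] j = 0 := by
      simpa [v, Finset.sum_ite_mem, ite_smul] using hw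
    have hvi : v i ≠ 0 := by simpa [v, his] using hi
    simp only [Fin.sum_univ_four] at hv0 hv
    simp at hv
    have hq : ∀ y ∈ ({x, x₁, x₁₂, x₂} : Set E3), ‖y‖ ^ 2 = 2 * inner ℝ z y + (R ^ 2 - ‖z‖ ^ 2) := by
      intro y hy
      have := hz y hy
      rw [dist_eq_norm] at this
      have h2 := norm_sub_sq_real y z
      rw [this, real_inner_comm] at h2
      linarith
    refine exists_circularQuad h01 h02 h03 h12 h13 (Ne.symm h32)
      (a := v 0) (b := v 1) (c := v 2) (d := v 3) ?_ ?_
    · simp only [pt, Prod.smul_mk, Prod.mk_add_mk, Prod.mk_eq_zero, smul_eq_mul, mul_one, mul_zero,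
        add_zero]
      refine ⟨hv, hv0, ?_, trivial⟩
      rw [hq x (by simp), hq x₁ (by simp), hq x₂ (by simp), hq x₁₂ (by simp)]
      have := congrArg (inner ℝ z) hv
      simp only [inner_add_right, real_inner_smul_right, inner_zero_right] at this
      linear_combination 2 * this + (R ^ 2 - ‖z‖ ^ 2) * hv0
    · rintro ⟨h0, h1, h2, h3⟩
      apply hvi
      fin_cases i <;> assumption
  · rw [collinear_iff_of_mem (p₀ := x) (by simp)] at hcol
    obtain ⟨v, hv⟩ := hcol
    obtain ⟨a, ha⟩ := hv x₁ (by simp)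
    obtain ⟨b, hb⟩ := hv x₂ (by simp)
    obtain ⟨c, hc⟩ := hv x₁₂ (by simp)
    rw [vadd_eq_add] at ha hb hc
    have hab : a - b ≠ 0 := by
      intro h; apply h12; rw [ha, hb, sub_eq_zero.1 h]
    have ha0 : a ≠ 0 := by rintro rfl; simp at ha; exact h01 ha.symm
    have hb0 : b ≠ 0 := by rintro rfl; simp at hb; exact h02 hb.symm
    have hP : ∀ s : ℝ, pt (s • v + x) = pt x + s • tangentVec x v + s ^ 2 • (0, 0, ‖v‖ ^ 2, 0) := by
      intro s
      have h1 : ‖s • v + x‖ ^ 2 = ‖x‖ ^ 2 + s * (2 * inner ℝ x v) + s ^ 2 * ‖v‖ ^ 2 := by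
        rw [norm_add_sq_real, norm_smul, real_inner_smul_left, mul_pow, Real.norm_eq_abs, sq_abs,
          real_inner_comm]
        ring
      simp [pt, tangentVec, h1]
      exact add_comm _ _
    -- The coefficients are those of the third divided difference at the nodes 0, a, b, c, cleared
    -- of denominators. It annihilates polynomials of degree two.
    refine exists_circularQuad h01 h02 h03 h12 h13 (Ne.symm h32)
      (a := (c - a) * (c - b) * (a - b)) (b := b * c * (c - b)) (c := -(a * c * (c - a)))
      (d := -(a * b * (a - b))) ?_ ?_
    · rw [ha, hb, hc, hP, hP, hP]
      module
    · rintro ⟨-, -, -, h⟩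
      simp [ha0, hb0, hab] at h

/-! ## Frames -/

namespace OrthonormalFrame

theorem norm_eq (B : OrthonormalFrame) (i : Fin 3) : ‖B.1 i‖ = 1 := B.2.1 i

theorem inner_self (B : OrthonormalFrame) (i : Fin 3) : inner ℝ (B.1 i) (B.1 i) = 1 := by
  rw [real_inner_self_eq_norm_sq, B.norm_eq]; norm_num

theorem inner_eq (B : OrthonormalFrame) {i j : Fin 3} (h : i ≠ j) : inner ℝ (B.1 i) (B.1 j) = 0 :=
  B.2.2 h

/-- Expansion of inner products in an orthonormal frame. -/
theorem sum_inner_mul_inner (B : OrthonormalFrame) (v w : E3) :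
    inner ℝ (B.1 0) v * inner ℝ (B.1 0) w + inner ℝ (B.1 1) v * inner ℝ (B.1 1) w +
      inner ℝ (B.1 2) v * inner ℝ (B.1 2) w = inner ℝ v w := by
  have hs : ⊤ ≤ Submodule.span ℝ (Set.range B.1) := by
    rw [B.2.linearIndependent.span_eq_top_of_card_eq_finrank (by simp)]
  have := (OrthonormalBasis.mk B.2 hs).sum_inner_mul_inner v w
  rw [← this]
  simp [Fin.sum_univ_three, real_inner_comm]

end OrthonormalFrame

/-! ### The patch constructed from a frame -/

namespace CircularQuad

variable (V : CircularQuad) (B : OrthonormalFrame)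

theorem neg₁ : lieForm (pt V.x) (pt V.x₁) < 0 := lieForm_pt_pt_neg V.ne₁
theorem neg₂ : lieForm (pt V.x) (pt V.x₂) < 0 := lieForm_pt_pt_neg V.ne₂

/-- Side lengths at the vertex `x`. -/
def l₁ : ℝ := ‖V.x₁ - V.x‖
def l₂ : ℝ := ‖V.x₂ - V.x‖

theorem l₁_pos : 0 < V.l₁ := norm_pos_iff.2 (sub_ne_zero.2 V.ne₁.symm)
theorem l₂_pos : 0 < V.l₂ := norm_pos_iff.2 (sub_ne_zero.2 V.ne₂.symm)

theorem lieForm₁ : lieForm (pt V.x) (pt V.x₁) = -V.l₁ ^ 2 / 2 := lieForm_pt_pt _ _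
theorem lieForm₂ : lieForm (pt V.x) (pt V.x₂) = -V.l₂ ^ 2 / 2 := lieForm_pt_pt _ _

/-- Difference of the images of `x₁`, `x₂` under the inversion about `x`. It is tangent to the
circle of the vertices. -/
def y : E3 := invVec V.x V.x₁ - invVec V.x V.x₂

/-- Relation expressing that `x₁₂` is a point. -/
theorem lieForm_rel : lieForm (pt V.x₁) (pt V.x₂) =
    V.e₂ * lieForm (pt V.x) (pt V.x₁) + V.e₁ * lieForm (pt V.x) (pt V.x₂) := by
  have h : lieForm (V.c • pt V.x₁₂) (V.c • pt V.x₁₂) = 0 := by simp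
  rw [V.rel] at h
  simp only [map_sub, map_add, map_smul, LinearMap.sub_apply, LinearMap.add_apply,
    LinearMap.smul_apply, smul_eq_mul, lieForm_pt_self] at h
  rw [lieForm_comm (pt V.x₂) (pt V.x₁), lieForm_comm (pt V.x₁) (pt V.x),
    lieForm_comm (pt V.x₂) (pt V.x)] at h
  have := mul_ne_zero V.e₁_ne V.e₂_ne
  apply mul_left_cancel₀ (mul_ne_zero two_ne_zero this)
  linear_combination h

/-- Law of cosines for the inverted points, at distances 1/l₁ and 1/l₂ from x. The length of the
side x₁x₂ is supplied by `lieForm_rel`. -/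
theorem norm_y_sq : ‖V.y‖ ^ 2 = V.e₁ / V.l₁ ^ 2 + V.e₂ / V.l₂ ^ 2 := by
  have h := V.lieForm_rel
  have h1 := V.l₁_pos
  have h2 := V.l₂_pos
  rw [V.lieForm₁, V.lieForm₂, lieForm_pt_pt] at h
  have h3 : V.x₂ - V.x₁ = (V.x₂ - V.x) - (V.x₁ - V.x) := by abel
  rw [h3, norm_sub_sq_real, ← l₁, ← l₂] at h
  rw [y, norm_sub_sq_real, invVec, invVec, norm_smul, norm_smul, real_inner_smul_left,
    real_inner_smul_right, ← l₁, ← l₂, real_inner_comm]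
  simp only [norm_inv, norm_pow, Real.norm_eq_abs, abs_of_pos h1, abs_of_pos h2]
  field_simp
  linear_combination (-2) * h

theorem y_ne : V.y ≠ 0 := by
  have h := V.norm_y_sq
  have h4 := V.lieForm_rel
  have h1 := V.l₁_pos
  have h2 := V.l₂_pos
  have h3 := lieForm_pt_pt_neg V.ne₃
  rw [V.lieForm₁, V.lieForm₂] at h4
  rintro h0
  rw [h0, norm_zero] at h
  field_simp at h
  nlinarith

/-- The middle coefficients of the weights of the two families. -/
def m₁ : ℝ := 2 * V.l₁ * inner ℝ (B.1 0) V.y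
def m₂ : ℝ := -2 * V.l₂ * inner ℝ (B.1 1) V.y

/-- The deviation from a spherical patch. -/
def k : ℝ := -2 * inner ℝ (B.1 2) V.y

/-- The curvature sphere of the frame along the second boundary arc. -/
def a : LieVec := tangentPlane V.x (B.1 2) + (2 * inner ℝ (B.1 2) (invVec V.x V.x₂)) • pt V.x

/-- The curvature sphere of the frame along the first boundary arc. -/
def b : LieVec := tangentPlane V.x (B.1 2) + (2 * inner ℝ (B.1 2) (invVec V.x V.x₁)) • pt V.x

/-- Middle coefficients of the boundary arcs. -/
def mid₁ : LieVec := arcMid V.x V.x₁ (B.1 0)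
def mid₂ : LieVec := arcMid V.x V.x₂ (B.1 1)

/-- The boundary arcs. -/
def E₁ (t : ℝ) : LieVec := quad (pt V.x) (V.mid₁ B) (pt V.x₁) t
def E₂ (t : ℝ) : LieVec := quad (pt V.x) (V.mid₂ B) (pt V.x₂) t

/-- The weights. -/
def Q₁ (t : ℝ) : ℝ := quad 1 (V.m₁ B) V.e₁ t
def Q₂ (t : ℝ) : ℝ := quad 1 (V.m₂ B) V.e₂ t

/-- The two families of spheres. -/
def s₁ (t : ℝ) : LieVec := V.Q₁ B t • V.b B + V.k B • V.E₁ B t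
def s₂ (t : ℝ) : LieVec := V.Q₂ B t • V.a B - V.k B • V.E₂ B t

/-- The points of the patch. -/
def P (t₁ t₂ : ℝ) : LieVec :=
  V.Q₂ B t₂ • V.E₁ B t₁ + V.Q₁ B t₁ • V.E₂ B t₂ - (V.Q₁ B t₁ * V.Q₂ B t₂) • pt V.x

open Classical in
/-- The cyclidic patch with a given vertex frame. -/
def patch (t₁ t₂ : ℝ) : Submodule ℝ LieVec :=
  if V.k B = 0 then
    -- For k = 0, P vanishes only where both Cartesian coordinates are infinite. There the first
    -- boundary arc also passes through the point ∞ of the chart, so E₁ supplies the correct value.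
    Submodule.span ℝ {V.b B, if V.P B t₁ t₂ = 0 then V.E₁ B t₁ else V.P B t₁ t₂}
  else Submodule.span ℝ {V.s₁ B t₁, V.s₂ B t₂}

theorem sum_sq : (V.m₁ B / V.l₁) ^ 2 + (V.m₂ B / V.l₂) ^ 2 + V.k B ^ 2 = 4 * ‖V.y‖ ^ 2 := by
  have h1 := V.l₁_pos
  have h2 := V.l₂_pos
  have := B.sum_inner_mul_inner V.y V.y
  rw [real_inner_self_eq_norm_sq] at this
  simp only [m₁, m₂, k]
  field_simp
  linear_combination 4 * this

/-- The discriminants of the weights. -/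
theorem disc_add_disc : (V.m₁ B ^ 2 - 4 * V.e₁) / V.l₁ ^ 2 + (V.m₂ B ^ 2 - 4 * V.e₂) / V.l₂ ^ 2 =
    -V.k B ^ 2 := by
  have := V.sum_sq B
  rw [V.norm_y_sq] at this
  have h1 := V.l₁_pos
  have h2 := V.l₂_pos
  field_simp at this ⊢
  linear_combination this

/-- Spheres with the same normal at x differ by a multiple of the point x. Thus k = 0 means that one
sphere contains both boundary arcs. -/
theorem a_eq : V.a B = V.b B + V.k B • pt V.x := by
  simp only [a, b, k, y, inner_sub_right]; module

theorem b_eq : V.b B = V.a B - V.k B • pt V.x := by rw [a_eq]; simp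

@[simp] theorem rCoord_a : rCoord (V.a B) = 1 := by simp [a]
@[simp] theorem rCoord_b : rCoord (V.b B) = 1 := by simp [b]
@[simp] theorem rCoord_E₁ (t : ℝ) : rCoord (V.E₁ B t) = 0 := by simp [E₁, mid₁, quad]
@[simp] theorem rCoord_E₂ (t : ℝ) : rCoord (V.E₂ B t) = 0 := by simp [E₂, mid₂, quad]
@[simp] theorem rCoord_s₁ (t : ℝ) : rCoord (V.s₁ B t) = V.Q₁ B t := by simp [s₁]
@[simp] theorem rCoord_s₂ (t : ℝ) : rCoord (V.s₂ B t) = V.Q₂ B t := by simp [s₂]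
@[simp] theorem rCoord_P (t₁ t₂ : ℝ) : rCoord (V.P B t₁ t₂) = 0 := by simp [P]

theorem lieForm_a_x : lieForm (V.a B) (pt V.x) = 0 := by simp [a, lieForm_tangentPlane_pt]
theorem lieForm_b_x : lieForm (V.b B) (pt V.x) = 0 := by simp [b, lieForm_tangentPlane_pt]

theorem lieForm_a_x₂ : lieForm (V.a B) (pt V.x₂) = 0 := by
  have := inner_invVec V.ne₂ (B.1 2)
  simp [a, lieForm_tangentPlane_pt, lieForm_pt_pt]; linarith

theorem lieForm_b_x₁ : lieForm (V.b B) (pt V.x₁) = 0 := by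
  have := inner_invVec V.ne₁ (B.1 2)
  simp [b, lieForm_tangentPlane_pt, lieForm_pt_pt]; linarith

theorem lieForm_a_x₁ : lieForm (V.a B) (pt V.x₁) = V.k B * lieForm (pt V.x) (pt V.x₁) := by
  rw [a_eq]; simp [lieForm_b_x₁]

theorem lieForm_b_x₂ : lieForm (V.b B) (pt V.x₂) = -V.k B * lieForm (pt V.x) (pt V.x₂) := by
  rw [b_eq]; simp [lieForm_a_x₂]

theorem lieForm_a_a : lieForm (V.a B) (V.a B) = 0 := by
  simp [a, lieForm_tangentPlane_pt, lieForm_pt_tangentPlane, lieForm_tangentPlane_self, B.norm_eq]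

theorem lieForm_b_b : lieForm (V.b B) (V.b B) = 0 := by
  simp [b, lieForm_tangentPlane_pt, lieForm_pt_tangentPlane, lieForm_tangentPlane_self, B.norm_eq]

theorem lieForm_a_b : lieForm (V.a B) (V.b B) = 0 := by
  rw [b_eq]; simp [lieForm_a_a, lieForm_a_x]

theorem lieForm_a_mid₁ : lieForm (V.a B) (V.mid₁ B) = 0 := by
  simp [a, mid₁, lieForm_tangentPlane_arcMid, lieForm_pt_arcMid, B.inner_eq]

theorem lieForm_a_mid₂ : lieForm (V.a B) (V.mid₂ B) = 0 := by
  simp [a, mid₂, lieForm_tangentPlane_arcMid, lieForm_pt_arcMid, B.inner_eq]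

theorem lieForm_b_mid₁ : lieForm (V.b B) (V.mid₁ B) = 0 := by
  simp [b, mid₁, lieForm_tangentPlane_arcMid, lieForm_pt_arcMid, B.inner_eq]

theorem lieForm_b_mid₂ : lieForm (V.b B) (V.mid₂ B) = 0 := by
  simp [b, mid₂, lieForm_tangentPlane_arcMid, lieForm_pt_arcMid, B.inner_eq]

theorem lieForm_mid₁_mid₂ : lieForm (V.mid₁ B) (V.mid₂ B) = 0 := by
  simp [mid₁, mid₂, lieForm_arcMid_arcMid, B.inner_eq]

theorem lieForm_mid₁_mid₁ : lieForm (V.mid₁ B) (V.mid₁ B) = -2 * lieForm (pt V.x) (pt V.x₁) :=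
  lieForm_arcMid_self (B.norm_eq 0)

theorem lieForm_mid₂_mid₂ : lieForm (V.mid₂ B) (V.mid₂ B) = -2 * lieForm (pt V.x) (pt V.x₂) :=
  lieForm_arcMid_self (B.norm_eq 1)

theorem lieForm_mid₁_x : lieForm (V.mid₁ B) (pt V.x) = 0 := lieForm_arcMid_left _ _ _
theorem lieForm_mid₂_x : lieForm (V.mid₂ B) (pt V.x) = 0 := lieForm_arcMid_left _ _ _
theorem lieForm_mid₁_x₁ : lieForm (V.mid₁ B) (pt V.x₁) = 0 := lieForm_arcMid_right V.ne₁
theorem lieForm_mid₂_x₂ : lieForm (V.mid₂ B) (pt V.x₂) = 0 := lieForm_arcMid_right V.ne₂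

theorem lieForm_mid₁_x₂ : lieForm (V.mid₁ B) (pt V.x₂) = V.m₁ B * lieForm (pt V.x) (pt V.x₂) :=
  lieForm_arcMid_pt V.ne₂

theorem lieForm_mid₂_x₁ : lieForm (V.mid₂ B) (pt V.x₁) = V.m₂ B * lieForm (pt V.x) (pt V.x₁) := by
  rw [mid₂, lieForm_arcMid_pt V.ne₁, m₂, y, ← l₂, inner_sub_right, inner_sub_right]; ring

/-- The points of the patch lie on both spheres. -/
theorem k_smul_P (t₁ t₂ : ℝ) :
    V.k B • V.P B t₁ t₂ = V.Q₂ B t₂ • V.s₁ B t₁ - V.Q₁ B t₁ • V.s₂ B t₂ := by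
  simp only [P, s₁, s₂, a_eq]; module

@[simp] theorem Q₁_zero : V.Q₁ B 0 = 1 := by simp [Q₁]
@[simp] theorem Q₂_zero : V.Q₂ B 0 = 1 := by simp [Q₂]
@[simp] theorem E₁_zero : V.E₁ B 0 = pt V.x := by simp [E₁]
@[simp] theorem E₂_zero : V.E₂ B 0 = pt V.x := by simp [E₂]
@[simp] theorem Q₁_one : V.Q₁ B 1 = V.e₁ := by simp [Q₁]
@[simp] theorem Q₂_one : V.Q₂ B 1 = V.e₂ := by simp [Q₂]
@[simp] theorem E₁_one : V.E₁ B 1 = pt V.x₁ := by simp [E₁]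
@[simp] theorem E₂_one : V.E₂ B 1 = pt V.x₂ := by simp [E₂]
@[simp] theorem P_left (t : ℝ) : V.P B t 0 = V.E₁ B t := by simp [P]
@[simp] theorem P_bot (t : ℝ) : V.P B 0 t = V.E₂ B t := by simp [P]
theorem P_one_one : V.P B 1 1 = V.c • pt V.x₁₂ := by simp [P, V.rel]

/-- Boundary data with the incidences of a cyclidic patch come from an orthonormal frame. -/
theorem exists_frame {A p₁₀ p₀₁ : LieVec} {k c₁ c₂ r₁₁ r₁₂ r₂₁ r₂₂ d : ℝ} (hk : k ≠ 0)
    (hc₁ : c₁ ≠ 0) (hc₂ : c₂ ≠ 0) (hd : d ≠ 0)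
    (hA : rCoord A = 1) (hAA : lieForm A A = 0) (hAx : lieForm A (pt V.x) = 0)
    (h1r : rCoord p₁₀ = 0) (h1x : lieForm p₁₀ (pt V.x) = 0) (h1x₁ : lieForm p₁₀ (pt V.x₁) = 0)
    (h11 : lieForm p₁₀ p₁₀ = -2 * (k * c₁) * lieForm (pt V.x) (pt V.x₁))
    (h2r : rCoord p₀₁ = 0) (h2x : lieForm p₀₁ (pt V.x) = 0) (h2x₂ : lieForm p₀₁ (pt V.x₂) = 0)
    (h22 : lieForm p₀₁ p₀₁ = -2 * (k * c₂) * lieForm (pt V.x) (pt V.x₂))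
    (hA1 : lieForm A p₁₀ = 0) (hA2 : lieForm A p₀₁ = 0) (h12 : lieForm p₁₀ p₀₁ = 0)
    (h1x₂ : lieForm p₁₀ (pt V.x₂) = k * r₁₁ * lieForm (pt V.x) (pt V.x₂))
    (h2x₁ : lieForm p₀₁ (pt V.x₁) = k * r₂₁ * lieForm (pt V.x) (pt V.x₁))
    (hx₁₂ : (r₂₂ * c₁) • pt V.x₁ + (r₁₂ * c₂) • pt V.x₂ - (r₁₂ * r₂₂ * k) • pt V.x =
      d • pt V.x₁₂) :
    ∃ (B : OrthonormalFrame) (l m : ℝ), 0 < l ∧ 0 < m ∧ c₁ = k * l ^ 2 ∧ c₂ = k * m ^ 2 ∧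
      p₁₀ = (k * l) • V.mid₁ B ∧ p₀₁ = (k * m) • V.mid₂ B ∧
      r₁₁ = l * V.m₁ B ∧ r₁₂ = l ^ 2 * V.e₁ ∧ r₂₁ = m * V.m₂ B ∧ r₂₂ = m ^ 2 * V.e₂ ∧
      A = tangentPlane V.x (B.1 2) + A.2.1 • pt V.x := by
  obtain ⟨l, t₁, hl, ht₁, hc₁', hp₁⟩ := exists_eq_arcMid V.ne₁ hk hc₁ h1r h1x h1x₁ h11
  obtain ⟨m, t₂, hm, ht₂, hc₂', hp₂⟩ := exists_eq_arcMid V.ne₂ hk hc₂ h2r h2x h2x₂ h22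
  have hAn := exists_eq_tangentPlane hA hAx
  set n := A.1 - A.2.1 • V.x
  set α := A.2.1
  have hn : ‖n‖ = 1 := by
    rw [hAn] at hAA
    simp [lieForm_tangentPlane_self, lieForm_tangentPlane_pt, lieForm_pt_tangentPlane] at hAA
    have : ‖n‖ ^ 2 = 1 := by linarith
    nlinarith [norm_nonneg n]
  have i1 : inner ℝ n t₁ = 0 := by
    rw [hAn, hp₁] at hA1
    simpa [lieForm_tangentPlane_arcMid, lieForm_pt_arcMid, hk, hl.ne', sub_ne_zero.2 V.ne₁.symm] using hA1
  have i2 : inner ℝ n t₂ = 0 := by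
    rw [hAn, hp₂] at hA2
    simpa [lieForm_tangentPlane_arcMid, lieForm_pt_arcMid, hk, hm.ne', sub_ne_zero.2 V.ne₂.symm] using hA2
  have i3 : inner ℝ t₁ t₂ = 0 := by
    rw [hp₁, hp₂] at h12
    simpa [lieForm_arcMid_arcMid, hk, hl.ne', hm.ne', sub_ne_zero.2 V.ne₁.symm,
      sub_ne_zero.2 V.ne₂.symm] using h12
  have hB : Orthonormal ℝ ![t₁, t₂, n] := by
    constructor
    · intro i; fin_cases i <;> simpa
    · intro i j hij
      fin_cases i <;> fin_cases j <;> simp_all [real_inner_comm]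
  -- Eliminating x₁₂ between `hx₁₂` and `rel` leaves a relation among three distinct points, so each
  -- coefficient vanishes.
  have hind : (d * V.e₁ * V.e₂ - V.c * (r₁₂ * r₂₂ * k)) • pt V.x +
      (V.c * (r₂₂ * c₁) - d * V.e₂) • pt V.x₁ + (V.c * (r₁₂ * c₂) - d * V.e₁) • pt V.x₂ = 0 := by
    have h3 := congrArg (V.c • ·) hx₁₂
    rw [smul_comm, V.rel, ← sub_eq_zero] at h3
    rw [← h3]; module
  obtain ⟨g0, g1, g2⟩ := pt_independent V.ne₁ V.ne₂ V.ne₃ hind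
  -- Multiply the relations from x₁ and x₂ and divide by the one from x. Knowing d then determines
  -- r₁₂ and r₂₂.
  have hdk : d = V.c * k * l ^ 2 * m ^ 2 := by
    rw [hc₁'] at g1
    rw [hc₂'] at g2
    apply mul_left_cancel₀ (mul_ne_zero hd (mul_ne_zero V.e₁_ne V.e₂_ne))
    linear_combination (-d * V.e₁) * g1 - (V.c * (r₂₂ * (k * l ^ 2))) * g2 -
      V.c * k * l ^ 2 * m ^ 2 * g0
  refine ⟨⟨![t₁, t₂, n], hB⟩, l, m, hl, hm, hc₁', hc₂', hp₁, hp₂, ?_, ?_, ?_, ?_, hAn⟩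
  · rw [hp₁] at h1x₂
    rw [map_smul, LinearMap.smul_apply, lieForm_arcMid_pt V.ne₂, ← l₁, smul_eq_mul] at h1x₂
    apply mul_left_cancel₀ (mul_ne_zero hk V.neg₂.ne)
    rw [m₁, y]; simp only [Matrix.cons_val_zero]
    linear_combination -h1x₂
  · apply mul_left_cancel₀ (mul_ne_zero V.c_ne hc₂)
    rw [hc₂'] at g2 ⊢
    linear_combination g2 + V.e₁ * hdk
  · rw [hp₂] at h2x₁
    rw [map_smul, LinearMap.smul_apply, lieForm_arcMid_pt V.ne₁, ← l₂, smul_eq_mul] at h2x₁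
    apply mul_left_cancel₀ (mul_ne_zero hk V.neg₁.ne)
    rw [m₂, y, inner_sub_right]; simp only [Matrix.cons_val_one, Matrix.cons_val_zero]
    rw [inner_sub_right] at h2x₁
    linear_combination -h2x₁
  · apply mul_left_cancel₀ (mul_ne_zero V.c_ne hc₁)
    rw [hc₁'] at g1 ⊢
    linear_combination g1 + V.e₂ * hdk

end CircularQuad

/-! ## Proper patches -/

/-- The conditions for `quad A w C` to be a curve of isotropic vectors. -/
structure IsConic (A w C : LieVec) : Prop where
  AA : lieForm A A = 0
  CC : lieForm C C = 0
  Aw : lieForm A w = 0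
  Cw : lieForm C w = 0
  ww : lieForm w w = -2 * lieForm A C

/-- All mutual products of two triples vanish. -/
structure Polar (A w C A' w' C' : LieVec) : Prop where
  AA : lieForm A A' = 0
  Aw : lieForm A w' = 0
  AC : lieForm A C' = 0
  wA : lieForm w A' = 0
  ww : lieForm w w' = 0
  wC : lieForm w C' = 0
  CA : lieForm C A' = 0
  Cw : lieForm C w' = 0
  CC : lieForm C C' = 0

theorem conicParam_eq_quad (a b c : LieVec) (t : ℝ) : conicParam a b c t =
    quad (lieForm b c • a) (lieForm a c • b - lieForm b c • a - lieForm a b • c)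
      (lieForm a b • c) t := by
  simp only [conicParam, quad]; module

theorem isConic_of_isotropic {a b c : LieVec} (ha : lieForm a a = 0) (hb : lieForm b b = 0)
    (hc : lieForm c c = 0) :
    IsConic (lieForm b c • a) (lieForm a c • b - lieForm b c • a - lieForm a b • c)
      (lieForm a b • c) := by
  have h1 := lieForm_comm b a
  have h2 := lieForm_comm c a
  have h3 := lieForm_comm c b
  constructor <;>
  · simp only [map_sub, map_smul, LinearMap.sub_apply, LinearMap.smul_apply, smul_eq_mul, h1, h2,
      h3, ha, hb, hc]
    ring

/-- All Bernstein coefficients of the first conic lie in P₁ and those of the second in P₂, so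
polarity of the planes gives all nine products at once. Only these products are used afterwards. -/
theorem IsProperPatch.exists_quad {L : I → I → Submodule ℝ LieVec} (h : IsProperPatch L) :
    ∃ A w C A' w' C' : LieVec, IsConic A w C ∧ IsConic A' w' C' ∧ Polar A w C A' w' C' ∧
      ∀ t₁ t₂ : I, L t₁ t₂ = Submodule.span ℝ {quad A w C t₁, quad A' w' C' t₂} := by
  obtain ⟨D, a, b, c, a', b', c', ⟨⟨ha, ha0⟩, ⟨hb, hb0⟩, ⟨hc, hc0⟩, -⟩,
    ⟨⟨ha', ha0'⟩, ⟨hb', hb0'⟩, ⟨hc', hc0'⟩, -⟩, hL⟩ := h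
  simp only [conicParam_eq_quad] at hL
  have hpol : ∀ p ∈ D.P₁, ∀ q ∈ D.P₂, lieForm p q = 0 := by
    intro p hp q hq
    rw [← D.polar] at hq
    exact hq p hp
  refine ⟨_, _, _, _, _, _, isConic_of_isotropic ha0.2 hb0.2 hc0.2,
    isConic_of_isotropic ha0'.2 hb0'.2 hc0'.2, ?_, hL⟩
  have hA : ∀ r : ℝ, r • a ∈ D.P₁ := fun r => D.P₁.smul_mem r ha
  have hB : ∀ r : ℝ, r • b ∈ D.P₁ := fun r => D.P₁.smul_mem r hb
  have hC : ∀ r : ℝ, r • c ∈ D.P₁ := fun r => D.P₁.smul_mem r hc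
  have hA' : ∀ r : ℝ, r • a' ∈ D.P₂ := fun r => D.P₂.smul_mem r ha'
  have hB' : ∀ r : ℝ, r • b' ∈ D.P₂ := fun r => D.P₂.smul_mem r hb'
  have hC' : ∀ r : ℝ, r • c' ∈ D.P₂ := fun r => D.P₂.smul_mem r hc'
  have hw := fun r s t => D.P₁.sub_mem (D.P₁.sub_mem (hB r) (hA s)) (hC t)
  have hw' := fun r s t => D.P₂.sub_mem (D.P₂.sub_mem (hB' r) (hA' s)) (hC' t)
  exact ⟨hpol _ (hA _) _ (hA' _), hpol _ (hA _) _ (hw' _ _ _), hpol _ (hA _) _ (hC' _),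
    hpol _ (hw _ _ _) _ (hA' _), hpol _ (hw _ _ _) _ (hw' _ _ _), hpol _ (hw _ _ _) _ (hC' _),
    hpol _ (hC _) _ (hA' _), hpol _ (hC _) _ (hw' _ _ _), hpol _ (hC _) _ (hC' _)⟩

theorem lieForm_nondegenerate : lieForm.Nondegenerate := by
  have hl : ∀ v : LieVec, (∀ w, lieForm v w = 0) → v = 0 := by
    rintro ⟨u, α, β, ρ⟩ h
    have h1 := h (u, 0, 0, 0)
    have h2 := h (0, 1, 0, 0)
    have h3 := h (0, 0, 1, 0)
    have h4 := h (0, 0, 0, 1)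
    simp [lieForm_apply] at h1 h2 h3 h4
    simp [h1, h2, h3, h4]
  exact ⟨hl, fun v h => hl v fun w => by rw [lieForm_comm, h]⟩

/-- The only nonzero entries of the Gram matrix are ⟨A, C⟩ and ⟨w, w⟩ = −2⟨A, C⟩, so pairing with C,
w, A isolates the coefficients. -/
theorem IsConic.linearIndependent {A w C : LieVec} (h : IsConic A w C) (h0 : lieForm A C ≠ 0) :
    LinearIndependent ℝ ![A, w, C] := by
  rw [Fintype.linearIndependent_iff]
  intro g hg
  simp only [Fin.sum_univ_three, Matrix.cons_val_zero, Matrix.cons_val_one, Matrix.cons_val] at hg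
  have h1 := congrArg (lieForm A) hg
  have h2 := congrArg (lieForm w) hg
  have h3 := congrArg (lieForm C) hg
  simp only [map_add, map_smul, smul_eq_mul, map_zero, h.AA, h.Aw, h.CC, h.Cw, h.ww,
    lieForm_comm w A, lieForm_comm w C, lieForm_comm C A] at h1 h2 h3
  intro i
  fin_cases i
  · simpa [h0] using h3
  · simpa [h0] using h2
  · simpa [h0] using h1

theorem IsConic.finrank_span {A w C : LieVec} (h : IsConic A w C) (h0 : lieForm A C ≠ 0) :
    Module.finrank ℝ (Submodule.span ℝ {A, w, C}) = 3 := by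
  have := finrank_span_eq_card (h.linearIndependent h0)
  have hr : Set.range ![A, w, C] = {A, w, C} := by
    ext y; simp [Matrix.range_cons]; tauto
  rw [hr] at this
  simpa using this

/-- The vectors A − C, w, A + C are orthogonal with squares −2⟨A, C⟩, −2⟨A, C⟩, 2⟨A, C⟩. Negativity
of ⟨A, C⟩ gives the signature, and r normalizes. -/
theorem IsConic.isCyclidicPlane {A w C : LieVec} (h : IsConic A w C) (h0 : lieForm A C < 0) :
    IsCyclidicPlane (Submodule.span ℝ {A, w, C}) := by
  set r := (√(-2 * lieForm A C))⁻¹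
  have hpos : 0 < -2 * lieForm A C := by linarith
  have hr0 : 0 < r := inv_pos.2 (Real.sqrt_pos.2 hpos)
  have hr : r * r * (-2 * lieForm A C) = 1 := by
    rw [← mul_inv, Real.mul_self_sqrt hpos.le, inv_mul_cancel₀ hpos.ne']
  have hCA := lieForm_comm C A
  have hwA := lieForm_comm w A
  have hwC := lieForm_comm w C
  refine ⟨r • (A - C), r • w, r • (A + C), ?_, ?_, ?_, ?_, ?_, ?_, ?_⟩
  · apply le_antisymm
    · rw [Submodule.span_le]
      have mA : A ∈ Submodule.span ℝ {A, w, C} := Submodule.subset_span (by simp)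
      have mw : w ∈ Submodule.span ℝ {A, w, C} := Submodule.subset_span (by simp)
      have mC : C ∈ Submodule.span ℝ {A, w, C} := Submodule.subset_span (by simp)
      rintro v (rfl | rfl | rfl)
      · exact Submodule.smul_mem _ _ (Submodule.sub_mem _ mA mC)
      · exact Submodule.smul_mem _ _ mw
      · exact Submodule.smul_mem _ _ (Submodule.add_mem _ mA mC)
    · rw [Submodule.span_le]
      set S := Submodule.span ℝ {r • (A - C), r • w, r • (A + C)}
      have m1 : r • (A - C) ∈ S := Submodule.subset_span (by simp)
      have m2 : r • w ∈ S := Submodule.subset_span (by simp)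
      have m3 : r • (A + C) ∈ S := Submodule.subset_span (by simp)
      rintro v (rfl | rfl | rfl) <;> rw [SetLike.mem_coe]
      · have := S.smul_mem (r⁻¹ / 2) (S.add_mem m1 m3)
        rw [← smul_add, smul_smul, div_mul_eq_mul_div, inv_mul_cancel₀ hr0.ne'] at this
        convert this; module
      · have := S.smul_mem r⁻¹ m2
        rwa [smul_smul, inv_mul_cancel₀ hr0.ne', one_smul] at this
      · have := S.smul_mem (r⁻¹ / 2) (S.sub_mem m3 m1)
        rw [← smul_sub, smul_smul, div_mul_eq_mul_div, inv_mul_cancel₀ hr0.ne'] at this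
        convert this; module
  all_goals
    simp only [map_sub, map_add, map_smul, LinearMap.sub_apply, LinearMap.add_apply,
      LinearMap.smul_apply, smul_eq_mul, h.AA, h.CC, h.Aw, h.Cw, h.ww, hCA, hwA, hwC]
  · linear_combination hr
  · linear_combination hr
  · linear_combination -hr
  all_goals ring

/-- The middle sphere A + w + C is four times the value of the quadratic curve at 1/2, the parameter
that `conicParam` assigns to its second sphere. -/
theorem IsConic.isSphereTriple {A w C : LieVec} (h : IsConic A w C) (h0 : lieForm A C ≠ 0) :
    IsSphereTriple (Submodule.span ℝ {A, w, C}) A (A + w + C) C := by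
  have mA : A ∈ Submodule.span ℝ {A, w, C} := Submodule.subset_span (by simp)
  have mw : w ∈ Submodule.span ℝ {A, w, C} := Submodule.subset_span (by simp)
  have mC : C ∈ Submodule.span ℝ {A, w, C} := Submodule.subset_span (by simp)
  have hli := h.linearIndependent h0
  rw [Fintype.linearIndependent_iff] at hli
  have key : ∀ a b c : ℝ, a • A + b • w + c • C = 0 → a = 0 ∧ b = 0 ∧ c = 0 := by
    intro a b c habc
    have := hli ![a, b, c] (by simpa [Fin.sum_univ_three] using habc)
    exact ⟨this 0, this 1, this 2⟩
  refine ⟨⟨mA, ?_, h.AA⟩, ⟨Submodule.add_mem _ (Submodule.add_mem _ mA mw) mC, ?_, ?_⟩,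
    ⟨mC, ?_, h.CC⟩, ?_, ?_, ?_⟩
  · rintro rfl; simp at h0
  · intro h1
    have := key 1 1 1 (by simpa using h1)
    simp at this
  · simp only [map_add, LinearMap.add_apply, h.AA, h.CC, h.Aw, h.Cw, h.ww, lieForm_comm w A,
      lieForm_comm w C, lieForm_comm C A]
    ring
  · rintro rfl; simp at h0
  · rw [LinearIndependent.pair_iff]
    intro s t hst
    have := key (s + t) t t (by rw [← hst]; module)
    exact ⟨by linarith [this.1, this.2.1], this.2.1⟩
  · rw [LinearIndependent.pair_iff]
    intro s t hst
    have := key s 0 t (by rw [← hst]; module)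
    exact ⟨this.1, this.2.2⟩
  · rw [LinearIndependent.pair_iff]
    intro s t hst
    have := key s s (s + t) (by rw [← hst]; module)
    exact ⟨this.1, by linarith [this.1, this.2.2]⟩

theorem IsConic.conicParam_eq {A w C : LieVec} (h : IsConic A w C) (t : ℝ) :
    conicParam A (A + w + C) C t = lieForm A C • quad A w C t := by
  simp only [conicParam_eq_quad, map_add, LinearMap.add_apply, h.AA, h.CC, h.Aw,
    lieForm_comm w C, h.Cw, quad]
  module

theorem isProperPatch_of_isConic {A w C A' w' C' : LieVec} (h : IsConic A w C)
    (h' : IsConic A' w' C') (hp : Polar A w C A' w' C') (h0 : lieForm A C < 0)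
    (h0' : lieForm A' C' < 0) (hr : rCoord A ≠ 0) (hr' : rCoord A' ≠ 0) :
    IsProperPatch fun t₁ t₂ => Submodule.span ℝ {quad A w C t₁, quad A' w' C' t₂} := by
  have hpol : lieForm.orthogonal (Submodule.span ℝ {A, w, C}) =
      Submodule.span ℝ {A', w', C'} := by
    symm
    -- The vanishing products give an inclusion, and it is an equality because both sides have
    -- dimension 3 = 6 − 3.
    apply Submodule.eq_of_le_of_finrank_eq
    · rw [Submodule.span_le]
      intro v hv u hu
      have hker : Submodule.span ℝ {A, w, C} ≤ LinearMap.ker (lieForm.flip v) := by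
        rw [Submodule.span_le]
        rintro u (rfl | rfl | rfl) <;> rcases hv with rfl | rfl | rfl
        exacts [hp.AA, hp.Aw, hp.AC, hp.wA, hp.ww, hp.wC, hp.CA, hp.Cw, hp.CC]
      exact hker hu
    · rw [LinearMap.BilinForm.finrank_orthogonal lieForm_nondegenerate, h.finrank_span h0.ne, h'.finrank_span h0'.ne]
      simp
  refine ⟨⟨_, _, h.isCyclidicPlane h0, h'.isCyclidicPlane h0', hpol,
    ⟨A, Submodule.subset_span (by simp), hr⟩, ⟨A', Submodule.subset_span (by simp), hr'⟩⟩,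
    A, A + w + C, C, A', A' + w' + C', C', h.isSphereTriple h0.ne, h'.isSphereTriple h0'.ne, ?_⟩
  intro t₁ t₂
  rw [h.conicParam_eq, h'.conicParam_eq, span_pair_smul h0.ne h0'.ne]

/-! ### Frames with k ≠ 0 give proper patches -/

namespace CircularQuad
variable (V : CircularQuad) (B : OrthonormalFrame)

theorem s₁_eq_quad (t : ℝ) : V.s₁ B t = quad (V.a B) (V.m₁ B • V.b B + V.k B • V.mid₁ B)
    (V.e₁ • V.b B + V.k B • pt V.x₁) t := by
  simp only [s₁, Q₁, E₁, quad, a_eq, smul_eq_mul]; module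

theorem s₂_eq_quad (t : ℝ) : V.s₂ B t = quad (V.b B) (V.m₂ B • V.a B - V.k B • V.mid₂ B)
    (V.e₂ • V.a B - V.k B • pt V.x₂) t := by
  simp only [s₂, Q₂, E₂, quad, a_eq, smul_eq_mul]; module

theorem isConic₁ : IsConic (V.a B) (V.m₁ B • V.b B + V.k B • V.mid₁ B)
    (V.e₁ • V.b B + V.k B • pt V.x₁) := by
  constructor <;>
  · simp only [map_add, map_smul, LinearMap.add_apply, LinearMap.smul_apply, smul_eq_mul,
      lieForm_a_a, lieForm_b_b, lieForm_a_b, lieForm_a_mid₁, lieForm_b_mid₁, lieForm_b_x₁,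
      lieForm_a_x₁, lieForm_mid₁_x₁, lieForm_mid₁_mid₁, lieForm_pt_self,
      lieForm_comm (pt V.x₁) (V.b B), lieForm_comm (pt V.x₁) (V.mid₁ B),
      lieForm_comm (V.mid₁ B) (V.b B)]
    try ring

theorem isConic₂ : IsConic (V.b B) (V.m₂ B • V.a B - V.k B • V.mid₂ B)
    (V.e₂ • V.a B - V.k B • pt V.x₂) := by
  constructor <;>
  · simp only [map_sub, map_smul, LinearMap.sub_apply, LinearMap.smul_apply, smul_eq_mul,
      lieForm_a_a, lieForm_b_b, lieForm_comm (V.b B) (V.a B), lieForm_a_b, lieForm_a_mid₂,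
      lieForm_b_mid₂, lieForm_b_x₂,
      lieForm_a_x₂, lieForm_mid₂_x₂, lieForm_mid₂_mid₂, lieForm_pt_self,
      lieForm_comm (pt V.x₂) (V.a B), lieForm_comm (pt V.x₂) (V.mid₂ B),
      lieForm_comm (V.mid₂ B) (V.a B)]
    try ring

/-- The values of `m₁` and `m₂` make the products of a middle with an end coefficient cancel. The
product of the two end coefficients is k² times `lieForm_rel`, which is where concircularity enters.
-/
theorem polar : Polar (V.a B) (V.m₁ B • V.b B + V.k B • V.mid₁ B)
    (V.e₁ • V.b B + V.k B • pt V.x₁) (V.b B) (V.m₂ B • V.a B - V.k B • V.mid₂ B)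
    (V.e₂ • V.a B - V.k B • pt V.x₂) := by
  have hrel := V.lieForm_rel
  constructor <;>
  · simp only [map_add, map_sub, map_smul, LinearMap.add_apply, LinearMap.smul_apply, smul_eq_mul,
      lieForm_a_a, lieForm_b_b, lieForm_a_b, lieForm_comm (V.b B) (V.a B),
      lieForm_a_mid₁, lieForm_b_mid₁, lieForm_b_x₁, lieForm_a_x₁,
      lieForm_a_mid₂, lieForm_b_mid₂, lieForm_b_x₂, lieForm_a_x₂,
      lieForm_mid₁_mid₂, lieForm_mid₁_x₂, lieForm_mid₂_x₁,
      lieForm_comm (pt V.x₁) (V.b B), lieForm_comm (pt V.x₁) (V.a B),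
      lieForm_comm (pt V.x₁) (V.mid₂ B),
      lieForm_comm (V.mid₁ B) (V.b B), lieForm_comm (V.mid₁ B) (V.a B), hrel]
    try ring

/-- The factors l, m are kept so that proper patches approximating a spherical one can be given its
parametrization. -/
theorem isProperPatch_rep (hk : V.k B ≠ 0) {l m : ℝ} (hl : 0 < l) (hm : 0 < m) :
    IsProperPatch fun t₁ t₂ => V.patch B (repIso l hl t₁) (repIso m hm t₂) := by
  have h1 := V.isConic₁ B
  have h2 := V.isConic₂ B
  have h := V.polar B
  -- This product is k²⟨x, x₁⟩, so k ≠ 0 makes it strictly negative.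
  have hAC : lieForm (V.a B) (V.e₁ • V.b B + V.k B • pt V.x₁) < 0 := by
    simp only [map_add, map_smul, smul_eq_mul, lieForm_a_b, lieForm_a_x₁]
    linear_combination mul_neg_of_pos_of_neg (sq_pos_of_ne_zero hk) V.neg₁
  have hAC' : lieForm (V.b B) (V.e₂ • V.a B - V.k B • pt V.x₂) < 0 := by
    simp only [map_sub, map_smul, smul_eq_mul, lieForm_comm (V.b B) (V.a B), lieForm_a_b,
      lieForm_b_x₂]
    linear_combination mul_neg_of_pos_of_neg (sq_pos_of_ne_zero hk) V.neg₂
  set w := V.m₁ B • V.b B + V.k B • V.mid₁ B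
  set C := V.e₁ • V.b B + V.k B • pt V.x₁
  set w' := V.m₂ B • V.a B - V.k B • V.mid₂ B
  set C' := V.e₂ • V.a B - V.k B • pt V.x₂
  have g1 : IsConic (V.a B) (l • w) (l ^ 2 • C) := by
    constructor <;> simp only [map_smul, LinearMap.smul_apply, smul_eq_mul, h1.AA, h1.CC, h1.Aw,
      h1.Cw, h1.ww] <;> ring
  have g2 : IsConic (V.b B) (m • w') (m ^ 2 • C') := by
    constructor <;> simp only [map_smul, LinearMap.smul_apply, smul_eq_mul, h2.AA, h2.CC, h2.Aw,
      h2.Cw, h2.ww] <;> ring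
  have g : Polar (V.a B) (l • w) (l ^ 2 • C) (V.b B) (m • w') (m ^ 2 • C') := by
    constructor <;> simp only [map_smul, LinearMap.smul_apply, smul_eq_mul, h.AA, h.Aw, h.AC, h.wA,
      h.ww, h.wC, h.CA, h.Cw, h.CC] <;> ring
  have := isProperPatch_of_isConic g1 g2 g
    (by rw [map_smul, smul_eq_mul]; exact mul_neg_of_pos_of_neg (pow_pos hl 2) hAC)
    (by rw [map_smul, smul_eq_mul]; exact mul_neg_of_pos_of_neg (pow_pos hm 2) hAC')
    (by simp) (by simp)
  convert this using 3 with t₁ t₂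
  have d1 := (repDen_pos hl t₁).ne'
  have d2 := (repDen_pos hm t₂).ne'
  rw [quad_rep d1, quad_rep d2, span_pair_smul (pow_ne_zero 2 d1) (pow_ne_zero 2 d2), patch,
    if_neg hk, s₁_eq_quad, s₂_eq_quad]
  rfl

end CircularQuad

theorem IsConic.smul {A w C : LieVec} (h : IsConic A w C) (r : ℝ) :
    IsConic (r • A) (r • w) (r • C) := by
  constructor <;> simp only [map_smul, LinearMap.smul_apply, smul_eq_mul, h.AA, h.CC, h.Aw,
    h.Cw, h.ww] <;> ring

theorem Polar.smul {A w C A' w' C' : LieVec} (h : Polar A w C A' w' C') (r s : ℝ) :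
    Polar (r • A) (r • w) (r • C) (s • A') (s • w') (s • C') := by
  constructor <;> simp only [map_smul, LinearMap.smul_apply, smul_eq_mul, h.AA, h.Aw, h.AC, h.wA,
    h.ww, h.wC, h.CA, h.Cw, h.CC] <;> ring

theorem pt_ne_zero (x : E3) : pt x ≠ 0 := by
  intro h
  have := congrArg (fun v : LieVec => v.2.1) h
  simp [pt] at this

/-! ### Proper patches come from frames -/

namespace CircularQuad
variable (V : CircularQuad)

/-- Pairing `rel` with x₁ gives c⟨x₁, x₁₂⟩ = e₁²⟨x, x₂⟩. -/
theorem lieForm_x₁_x₁₂_ne : lieForm (pt V.x₁) (pt V.x₁₂) ≠ 0 := by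
  intro h
  have h1 := congrArg (lieForm (pt V.x₁)) V.rel
  simp only [map_sub, map_add, map_smul, smul_eq_mul, lieForm_pt_self, h, V.lieForm_rel,
    lieForm_comm (pt V.x₁) (pt V.x)] at h1
  have : V.e₁ * V.e₁ * lieForm (pt V.x) (pt V.x₂) = 0 := by linear_combination -h1
  simp [V.e₁_ne, V.neg₂.ne] at this

/-- The points of two conics of spheres determine the patch. -/
theorem exists_patch_of_isConic {A w C A' w' C' : LieVec} (h : IsConic A w C)
    (h' : IsConic A' w' C') (hp : Polar A w C A' w' C') (hA : rCoord A = 1) (hA' : rCoord A' = 1)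
    {k c₁ c₂ d : ℝ} (hk : k ≠ 0) (hc₁ : c₁ ≠ 0) (hc₂ : c₂ ≠ 0) (hd : d ≠ 0)
    (hx : A - A' = k • pt V.x) (hx₁ : C - rCoord C • A' = c₁ • pt V.x₁)
    (hx₂ : rCoord C' • A - C' = c₂ • pt V.x₂)
    (hx₁₂ : rCoord C' • C - rCoord C • C' = d • pt V.x₁₂) :
    ∃ (B : OrthonormalFrame) (l m : ℝ) (hl : 0 < l) (hm : 0 < m), ∀ t₁ t₂ : I,
      Submodule.span ℝ {quad A w C t₁, quad A' w' C' t₂} =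
        V.patch B (repIso l hl t₁) (repIso m hm t₂) := by
  have hA'A := (lieForm_comm A' A).trans hp.AA
  have hA'w := (lieForm_comm A' w).trans hp.wA
  have hA'C := (lieForm_comm A' C).trans hp.CA
  have hw'A := (lieForm_comm w' A).trans hp.Aw
  have hC'A := (lieForm_comm C' A).trans hp.AC
  have hwA := (lieForm_comm w A).trans h.Aw
  have hwC := (lieForm_comm w C).trans h.Cw
  have hwA' := (lieForm_comm w' A').trans h'.Aw
  have hwC' := (lieForm_comm w' C').trans h'.Cw
  have hw'C := (lieForm_comm w' C).trans hp.Cw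
  have ex : pt V.x = k⁻¹ • (A - A') := by rw [hx, smul_smul, inv_mul_cancel₀ hk, one_smul]
  have ex₁ : pt V.x₁ = c₁⁻¹ • (C - rCoord C • A') := by
    rw [hx₁, smul_smul, inv_mul_cancel₀ hc₁, one_smul]
  have ex₂ : pt V.x₂ = c₂⁻¹ • (rCoord C' • A - C') := by
    rw [hx₂, smul_smul, inv_mul_cancel₀ hc₂, one_smul]
  have i1 : k * c₁ * lieForm (pt V.x) (pt V.x₁) = lieForm A C := by
    rw [ex, ex₁]
    simp only [map_sub, map_smul, LinearMap.smul_apply, LinearMap.sub_apply, smul_eq_mul, hp.AA,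
      hA'C, h'.AA]
    field_simp; ring
  have i2 : k * c₂ * lieForm (pt V.x) (pt V.x₂) = lieForm A' C' := by
    rw [ex, ex₂]
    simp only [map_sub, map_smul, LinearMap.smul_apply, LinearMap.sub_apply, smul_eq_mul, hp.AC,
      hA'A, h.AA]
    field_simp; ring
  -- Cancelling e_r-components against A' or A turns each conic of spheres into a boundary curve of
  -- points. The vectors p₁₀ and p₀₁ are the middle coefficients of these curves.
  obtain ⟨B, l, m, hl, hm, hc₁', hc₂', hp₁₀, hp₀₁, hr₁₁, hr₁₂, hr₂₁, hr₂₂, hAn⟩ :=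
    V.exists_frame (A := A) (p₁₀ := w - rCoord w • A') (p₀₁ := rCoord w' • A - w')
      (k := k) (c₁ := c₁) (c₂ := c₂) (r₁₁ := rCoord w) (r₁₂ := rCoord C) (r₂₁ := rCoord w')
      (r₂₂ := rCoord C') (d := d) hk hc₁ hc₂ hd hA h.AA
      (by rw [ex]; simp [h.AA, hp.AA])
      (by simp [hA']) (by rw [ex]; simp [hwA, hp.wA, hA'A, h'.AA])
      (by rw [ex₁]; simp [hwC, hp.wA, hA'C, h'.AA])
      (by
        rw [mul_assoc, i1]
        simp [hp.wA, hA'w, h'.AA, h.ww])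
      (by simp [hA]) (by rw [ex]; simp [hw'A, hp.AA, h.AA, hwA'])
      (by rw [ex₂]; simp [hw'A, hp.AC, h.AA, hwC'])
      (by
        rw [mul_assoc, i2]
        simp [hp.Aw, hw'A, h.AA, h'.ww])
      (by simp [h.Aw, hp.AA]) (by simp [h.AA, hp.Aw])
      (by simp [hwA, hp.ww, hA'A, h'.Aw])
      (by
        apply mul_left_cancel₀ hc₂
        have : c₂ * (k * rCoord w * lieForm (pt V.x) (pt V.x₂)) = rCoord w * lieForm A' C' := by
          rw [← i2]; ring
        rw [this, ← smul_eq_mul c₂, ← map_smul, ← hx₂]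
        simp [hwA, hp.wC, hA'A])
      (by
        apply mul_left_cancel₀ hc₁
        have : c₁ * (k * rCoord w' * lieForm (pt V.x) (pt V.x₁)) = rCoord w' * lieForm A C := by
          rw [← i1]; ring
        rw [this, ← smul_eq_mul c₁, ← map_smul, ← hx₁]
        simp [hw'C, hp.AA, hwA'])
      (by
        rw [mul_smul, ← hx₁, mul_smul, ← hx₂, mul_smul, ← hx, ← hx₁₂]
        module)
  -- Both spheres have the same normal at x, so they differ by a multiple of x, and both contain x₂,
  -- so the multiple is zero. The same argument with x₁ identifies A' and k.
  have ea : A = V.a B := by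
    have h1 : A - V.a B = (A.2.1 - 2 * inner ℝ (B.1 2) (invVec V.x V.x₂)) • pt V.x := by
      rw [a, sub_smul]; nth_rewrite 1 [hAn]; abel
    have h2 : lieForm (A - V.a B) (pt V.x₂) = 0 := by
      rw [map_sub, LinearMap.sub_apply, lieForm_a_x₂, ex₂]; simp [h.AA, hp.AC]
    rw [h1, map_smul, LinearMap.smul_apply, smul_eq_mul] at h2
    rw [(mul_eq_zero.1 h2).resolve_right V.neg₂.ne, zero_smul] at h1
    exact sub_eq_zero.1 h1
  have eb' : A' - V.b B = (V.k B - k) • pt V.x := by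
    have : A' = A - k • pt V.x := by rw [← hx]; abel
    rw [this, ea, a_eq]; module
  have ek : V.k B - k = 0 := by
    have h2 : lieForm (A' - V.b B) (pt V.x₁) = 0 := by
      rw [map_sub, LinearMap.sub_apply, lieForm_b_x₁, ex₁]; simp [hA'C, h'.AA]
    rw [eb', map_smul, LinearMap.smul_apply, smul_eq_mul] at h2
    exact (mul_eq_zero.1 h2).resolve_right V.neg₁.ne
  have eb : A' = V.b B := by
    rw [ek, zero_smul] at eb'; exact sub_eq_zero.1 eb'
  have ek' : V.k B = k := sub_eq_zero.1 ek
  refine ⟨B, l, m, hl, hm, fun t₁ t₂ => ?_⟩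
  have ew : w = l • (V.m₁ B • V.b B + V.k B • V.mid₁ B) := by
    rw [ek', ← eb, sub_eq_iff_eq_add.1 hp₁₀, hr₁₁]; module
  have ew' : w' = m • (V.m₂ B • V.a B - V.k B • V.mid₂ B) := by
    rw [ek', ← ea, ← sub_sub_cancel (rCoord w' • A) w', hp₀₁, hr₂₁]; module
  have eC : C = l ^ 2 • (V.e₁ • V.b B + V.k B • pt V.x₁) := by
    rw [ek', ← eb, sub_eq_iff_eq_add.1 hx₁, hr₁₂, hc₁']; module
  have eC' : C' = m ^ 2 • (V.e₂ • V.a B - V.k B • pt V.x₂) := by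
    rw [ek', ← ea, ← sub_sub_cancel (rCoord C' • A) C', hx₂, hr₂₂, hc₂']; module
  have d1 := (repDen_pos hl t₁).ne'
  have d2 := (repDen_pos hm t₂).ne'
  rw [ew, ew', eC, eC', quad_rep d1, quad_rep d2,
    span_pair_smul (pow_ne_zero 2 d1) (pow_ne_zero 2 d2), ea, eb, ← s₁_eq_quad, ← s₂_eq_quad,
    patch, if_neg (by rw [ek']; exact hk)]
  rfl

/-- Every proper patch is determined by a frame, up to projective changes of the parameters. -/
theorem exists_patch_of_isProperPatch {L : I → I → Submodule ℝ LieVec} (hL : IsProperPatch L)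
    (hV : HasVertices L V.x V.x₁ V.x₁₂ V.x₂) :
    ∃ (B : OrthonormalFrame) (l m : ℝ) (hl : 0 < l) (hm : 0 < m), ∀ t₁ t₂ : I,
      L t₁ t₂ = V.patch B (repIso l hl t₁) (repIso m hm t₂) := by
  obtain ⟨A, w, C, A', w', C', h, h', hp, hL⟩ := hL.exists_quad
  obtain ⟨v1, v2, v3, v4⟩ := hV
  simp only [IsPointOf, pointSphere_coe, hL, Set.Icc.coe_zero, Set.Icc.coe_one,
    quad_at_zero, quad_at_one, Submodule.mem_span_pair] at v1 v2 v3 v4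
  obtain ⟨α, β, v1⟩ := v1
  obtain ⟨γ, δ, v2⟩ := v2
  obtain ⟨γ₂, δ₂, v3⟩ := v3
  obtain ⟨α₂, β₂, v4⟩ := v4
  have hA'A := (lieForm_comm A' A).trans hp.AA
  have hA'C := (lieForm_comm A' C).trans hp.CA
  have n1 : α * γ * lieForm A C ≠ 0 := by
    have := V.neg₁.ne
    rw [← v1, ← v2] at this
    simpa [hp.AA, hA'C, h'.AA, and_assoc] using this
  have n2 : β * β₂ * lieForm A' C' ≠ 0 := by
    have := V.neg₂.ne
    rw [← v1, ← v4] at this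
    simpa [hp.AC, hA'A, h.AA, and_assoc] using this
  simp only [ne_eq, mul_eq_zero, not_or] at n1 n2
  obtain ⟨⟨hα, hγ⟩, hAC⟩ := n1
  obtain ⟨⟨hβ, hβ₂⟩, hAC'⟩ := n2
  have w1 := congrArg rCoord v1
  have w2 := congrArg rCoord v2
  have w3 := congrArg rCoord v3
  have w4 := congrArg rCoord v4
  simp only [rCoord_add, rCoord_smul, rCoord_pt] at w1 w2 w3 w4
  -- Otherwise A and A' are both point spheres orthogonal to x, hence multiples of x. Then ⟨A, C⟩ ≠
  -- 0 and ⟨A', C⟩ = 0 force A' = 0, contradicting ⟨A', C'⟩ ≠ 0.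
  have hρ : rCoord A ≠ 0 := by
    intro h0
    have h0' : rCoord A' = 0 := by simpa [h0, hβ] using w1
    have e1 := eq_smul_pt_of_isotropic (x := V.x) h0 (by rw [← v1]; simp [h.AA, hp.AA]) h.AA
    have e2 := eq_smul_pt_of_isotropic (x := V.x) h0' (by rw [← v1]; simp [h'.AA, hA'A]) h'.AA
    rw [e1, map_smul, LinearMap.smul_apply, smul_eq_mul] at hAC
    rw [e2, map_smul, LinearMap.smul_apply, smul_eq_mul] at hA'C
    rw [(mul_eq_zero.1 hA'C).resolve_right (right_ne_zero_of_mul hAC), zero_smul] at e2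
    rw [e2] at hAC'
    simp at hAC'
  have hρ' : rCoord A' ≠ 0 := by
    intro h0; simp [h0, hα, hρ] at w1
  set ρ := rCoord A with hρd
  set ρ' := rCoord A' with hρd'
  -- If C were a point sphere it would be a multiple of x₁. Being orthogonal to C', it would then be
  -- orthogonal to x₁₂ as well.
  have hC : rCoord C ≠ 0 := by
    intro h0
    have hδ : δ = 0 := (mul_eq_zero.1 (by simpa only [h0, mul_zero, zero_add] using w2)).resolve_right hρ'
    apply V.lieForm_x₁_x₁₂_ne
    rw [← v2, ← v3, hδ]
    simp [h.CC, hp.CC]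
  have hδ₂ : δ₂ ≠ 0 := by
    rintro rfl
    have : γ₂ = 0 := by simpa [hC] using w3
    rw [this] at v3
    exact pt_ne_zero V.x₁₂ (by rw [← v3]; simp)
  simp only [hL]
  -- Each vertex is the combination of its two spheres without e_r-component. The constants record
  -- the scale factors after A and A' are normalized to e_r-component 1.
  obtain ⟨B, l, m, hl, hm, H⟩ := V.exists_patch_of_isConic (h.smul ρ⁻¹) (h'.smul ρ'⁻¹)
    (hp.smul ρ⁻¹ ρ'⁻¹) (by simp [← hρd, hρ]) (by simp [← hρd', hρ'])
    (k := (α * ρ)⁻¹) (c₁ := (γ * ρ)⁻¹) (c₂ := -(β₂ * ρ')⁻¹)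
    (d := -rCoord C * (ρ * ρ' * δ₂)⁻¹)
    (by positivity) (by positivity) (neg_ne_zero.2 (by positivity))
    (mul_ne_zero (neg_ne_zero.2 hC) (by positivity))
    (by
      rw [← v1]
      have : β = -(α * ρ / ρ') := by field_simp; linear_combination w1
      rw [this]
      simp only [smul_add, smul_smul, sub_eq_add_neg, ← neg_smul]
      congr 1 <;> congr 1 <;> field_simp)
    (by
      rw [← v2]
      have : δ = -(γ * rCoord C / ρ') := by field_simp; linear_combination w2
      rw [this]
      simp only [smul_add, smul_smul, sub_eq_add_neg, ← neg_smul, rCoord_smul]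
      congr 1 <;> congr 1 <;> field_simp)
    (by
      rw [← v4]
      have : α₂ = -(β₂ * rCoord C' / ρ) := by field_simp; linear_combination w4
      rw [this]
      simp only [smul_add, smul_smul, sub_eq_add_neg, ← neg_smul, rCoord_smul]
      congr 1 <;> congr 1 <;> field_simp)
    (by
      rw [← v3]
      have : γ₂ = -(δ₂ * rCoord C' / rCoord C) := by field_simp; linear_combination w3
      rw [this]
      simp only [smul_add, smul_smul, sub_eq_add_neg, ← neg_smul, rCoord_smul]
      congr 1 <;> congr 1 <;> field_simp)
  refine ⟨B, l, m, hl, hm, fun t₁ t₂ => ?_⟩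
  rw [← H, quad_smul, quad_smul, span_pair_smul (inv_ne_zero hρ) (inv_ne_zero hρ')]

end CircularQuad

/-! ## Spherical patches -/

/-- A biquadratic parametrization `q₂(t₂) F(t₁) + q₁(t₁) G(t₂)` of points of the sphere `s` whose
boundary curves are orthogonal circles, in terms of Bernstein coefficients. -/
structure SphericalData (s : LieVec) (a b : Fin 3 → ℝ) (F G : Fin 3 → LieVec) : Prop where
  ss : lieForm s s = 0
  rF : ∀ i, rCoord (F i) = 0
  rG : ∀ i, rCoord (G i) = 0
  sF : ∀ i, lieForm s (F i) = 0
  sG : ∀ i, lieForm s (G i) = 0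
  conic₁ : IsConic (b 0 • F 0 + a 0 • G 0) (b 0 • F 1 + a 1 • G 0) (b 0 • F 2 + a 2 • G 0)
  conic₂ : IsConic (b 0 • F 0 + a 0 • G 0) (b 1 • F 0 + a 0 • G 1) (b 2 • F 0 + a 0 • G 2)
  ortho : lieForm (b 0 • F 1 + a 1 • G 0) (b 1 • F 0 + a 0 • G 1) = 0
  weight₁ : a 0 * lieForm (b 0 • F 1 + a 1 • G 0) (b 2 • F 0 + a 0 • G 2) =
    a 1 * lieForm (b 0 • F 0 + a 0 • G 0) (b 2 • F 0 + a 0 • G 2)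
  weight₂ : b 0 * lieForm (b 1 • F 0 + a 0 • G 1) (b 0 • F 2 + a 2 • G 0) =
    b 1 * lieForm (b 0 • F 0 + a 0 • G 0) (b 0 • F 2 + a 2 • G 0)

/-- The parametrization of `SphericalData`. -/
def sphericalPoint (a b : Fin 3 → ℝ) (F G : Fin 3 → LieVec) (t₁ t₂ : ℝ) : LieVec :=
  quad (b 0) (b 1) (b 2) t₂ • quad (F 0) (F 1) (F 2) t₁ +
    quad (a 0) (a 1) (a 2) t₁ • quad (G 0) (G 1) (G 2) t₂

/-- Comparing e_r-components removes s from the combination, so a contact element of an honest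
sphere contains a single point. -/
theorem exists_smul_of_mem_span {s p : LieVec} {z : E3} (hs : rCoord s ≠ 0) (hp : rCoord p = 0)
    (h : pt z ∈ Submodule.span ℝ {s, p}) : ∃ c : ℝ, c ≠ 0 ∧ p = c • pt z := by
  obtain ⟨α, β, h⟩ := Submodule.mem_span_pair.1 h
  have h1 := congrArg rCoord h
  simp only [rCoord_add, rCoord_smul, rCoord_pt, hp, mul_zero, add_zero, mul_eq_zero, hs,
    or_false] at h1
  rw [h1, zero_smul, zero_add] at h
  have hβ : β ≠ 0 := by
    rintro rfl; rw [zero_smul] at h; exact pt_ne_zero z h.symm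
  exact ⟨β⁻¹, inv_ne_zero hβ, by rw [← h, smul_smul, inv_mul_cancel₀ hβ, one_smul]⟩

namespace CircularQuad
variable (V : CircularQuad)

/-- Orthogonal biquadratic parametrizations of spheres are given by frames. -/
theorem exists_patch_of_sphericalData {s : LieVec} {a b : Fin 3 → ℝ} {F G : Fin 3 → LieVec}
    (h : SphericalData s a b F G) (hs : rCoord s ≠ 0)
    (hx : pt V.x ∈ Submodule.span ℝ {s, sphericalPoint a b F G 0 0})
    (hx₁ : pt V.x₁ ∈ Submodule.span ℝ {s, sphericalPoint a b F G 1 0})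
    (hx₁₂ : pt V.x₁₂ ∈ Submodule.span ℝ {s, sphericalPoint a b F G 1 1})
    (hx₂ : pt V.x₂ ∈ Submodule.span ℝ {s, sphericalPoint a b F G 0 1}) :
    ∃ (B : OrthonormalFrame) (l m : ℝ) (hl : 0 < l) (hm : 0 < m), V.k B = 0 ∧
      s = rCoord s • V.b B ∧ ∀ t₁ t₂ : I,
      (∃ κ : ℝ, κ ≠ 0 ∧
        sphericalPoint a b F G t₁ t₂ = κ • V.P B (repIso l hl t₁) (repIso m hm t₂)) ∧
      (∃ κ : ℝ, κ ≠ 0 ∧ sphericalPoint a b F G t₁ 0 = κ • V.E₁ B (repIso l hl t₁)) := by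
  obtain ⟨k, hk, hx⟩ := exists_smul_of_mem_span hs
    (by simp [sphericalPoint, h.rF, h.rG]) hx
  obtain ⟨c₁, hc₁, hx₁⟩ := exists_smul_of_mem_span hs
    (by simp [sphericalPoint, h.rF, h.rG]) hx₁
  obtain ⟨d, hd, hx₁₂⟩ := exists_smul_of_mem_span hs
    (by simp [sphericalPoint, h.rF, h.rG]) hx₁₂
  obtain ⟨c₂, hc₂, hx₂⟩ := exists_smul_of_mem_span hs
    (by simp [sphericalPoint, h.rF, h.rG]) hx₂
  simp only [sphericalPoint, quad_at_zero, quad_at_one] at hx hx₁ hx₂ hx₁₂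
  have g1 := h.conic₁
  have g2 := h.conic₂
  have go := h.ortho
  have w1 := h.weight₁
  have w2 := h.weight₂
  -- If a 0 = 0, then x and x₂ are both multiples of F 0, which is isotropic, contradicting ⟨x, x₂⟩
  -- ≠ 0.
  have ha : a 0 ≠ 0 := by
    intro h0
    have := g2.AA
    have hx' := hx
    have hx₂' := hx₂
    rw [h0, zero_smul, add_zero] at this hx' hx₂'
    have hb : b 0 ≠ 0 := by
      intro hb; rw [hb, zero_smul] at hx'
      exact (smul_ne_zero hk (pt_ne_zero _)) hx'.symm
    have hF : lieForm (F 0) (F 0) = 0 := by simpa [hb] using this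
    have h3 : lieForm (k • pt V.x) (c₂ • pt V.x₂) = 0 := by
      rw [← hx', ← hx₂']; simp [hF]
    simp [hk, hc₂, V.neg₂.ne] at h3
  have hb : b 0 ≠ 0 := by
    intro h0
    have := g1.AA
    have hx' := hx
    have hx₁' := hx₁
    rw [h0, zero_smul, zero_add] at this hx' hx₁'
    have hF : lieForm (G 0) (G 0) = 0 := by simpa [ha] using this
    have h3 : lieForm (k • pt V.x) (c₁ • pt V.x₁) = 0 := by
      rw [← hx', ← hx₁']; simp [hF]
    simp [hk, hc₁, V.neg₁.ne] at h3
  rw [hx, hx₁] at g1 w2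
  rw [hx, hx₂] at g2 w1
  set p₁₀ := b 0 • F 1 + a 1 • G 0 with hp₁₀
  set p₀₁ := b 1 • F 0 + a 0 • G 1 with hp₀₁
  have sx : lieForm s (pt V.x) = 0 := by
    have : lieForm s (k • pt V.x) = 0 := by rw [← hx]; simp [h.sF, h.sG]
    simpa [hk] using this
  have sx₁ : lieForm s (pt V.x₁) = 0 := by
    have : lieForm s (c₁ • pt V.x₁) = 0 := by rw [← hx₁]; simp [h.sF, h.sG]
    simpa [hc₁] using this
  have sx₂ : lieForm s (pt V.x₂) = 0 := by
    have : lieForm s (c₂ • pt V.x₂) = 0 := by rw [← hx₂]; simp [h.sF, h.sG]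
    simpa [hc₂] using this
  obtain ⟨B, l, m, hl, hm, hc₁', hc₂', hp₁₀', hp₀₁', hr₁₁, hr₁₂, hr₂₁, hr₂₂, hAn⟩ :=
    V.exists_frame (A := (rCoord s)⁻¹ • s) (p₁₀ := p₁₀) (p₀₁ := p₀₁)
      (k := k) (c₁ := c₁) (c₂ := c₂) (r₁₁ := a 1 / a 0) (r₁₂ := a 2 / a 0) (r₂₁ := b 1 / b 0)
      (r₂₂ := b 2 / b 0) (d := d) hk hc₁ hc₂ hd (by simp [hs]) (by simp [h.ss]) (by simp [sx])
      (by simp [hp₁₀, h.rF, h.rG])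
      (by have := g1.Aw; rw [lieForm_comm]; simpa [hk] using this)
      (by have := g1.Cw; rw [lieForm_comm]; simpa [hc₁] using this)
      (by rw [g1.ww]; simp; ring)
      (by simp [hp₀₁, h.rF, h.rG])
      (by have := g2.Aw; rw [lieForm_comm]; simpa [hk] using this)
      (by have := g2.Cw; rw [lieForm_comm]; simpa [hc₂] using this)
      (by rw [g2.ww]; simp; ring)
      (by simp [hp₁₀, h.sF, h.sG]) (by simp [hp₀₁, h.sF, h.sG]) go
      (by
        simp only [map_smul, LinearMap.smul_apply, smul_eq_mul] at w1
        field_simp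
        apply mul_left_cancel₀ hc₂
        linear_combination w1)
      (by
        simp only [map_smul, LinearMap.smul_apply, smul_eq_mul] at w2
        field_simp
        apply mul_left_cancel₀ hc₁
        linear_combination w2)
      (by
        rw [mul_smul, ← hx₁, mul_smul, ← hx₂, mul_smul, ← hx, ← hx₁₂]
        simp only [smul_add, smul_smul]
        have e1 : b 2 / b 0 * b 0 = b 2 := by field_simp
        have e2 : a 2 / a 0 * a 0 = a 2 := by field_simp
        have e3 : a 2 / a 0 * (b 2 / b 0) * b 0 = a 2 / a 0 * b 2 := by field_simp
        have e4 : a 2 / a 0 * (b 2 / b 0) * a 0 = b 2 / b 0 * a 2 := by field_simp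
        rw [e3, e4, e1, e2]
        abel)
  set A := (rCoord s)⁻¹ • s with hAd
  have ea : A = V.a B := by
    have h1 : A - V.a B = (A.2.1 - 2 * inner ℝ (B.1 2) (invVec V.x V.x₂)) • pt V.x := by
      rw [CircularQuad.a, sub_smul]; nth_rewrite 1 [hAn]; abel
    have h2 : lieForm (A - V.a B) (pt V.x₂) = 0 := by
      rw [map_sub, LinearMap.sub_apply, lieForm_a_x₂, hAd]; simp [sx₂]
    rw [h1, map_smul, LinearMap.smul_apply, smul_eq_mul] at h2
    rw [(mul_eq_zero.1 h2).resolve_right V.neg₂.ne, zero_smul] at h1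
    exact sub_eq_zero.1 h1
  -- The sphere s contains x₁ too, while the pairing of a with x₁ is k⟨x, x₁⟩.
  have hkB : V.k B = 0 := by
    have := V.lieForm_a_x₁ B
    rw [← ea, hAd, map_smul, LinearMap.smul_apply, sx₁, smul_zero] at this
    exact (mul_eq_zero.1 this.symm).resolve_right V.neg₁.ne
  have eb : s = rCoord s • V.b B := by
    rw [b_eq, hkB, zero_smul, sub_zero, ← ea, hAd, smul_smul, mul_inv_cancel₀ hs, one_smul]
  have hE₁ : ∀ t : I, quad (b 0 • F 0 + a 0 • G 0) p₁₀ (b 0 • F 2 + a 2 • G 0) (t : ℝ) =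
      (k * repDen l t ^ 2) • V.E₁ B (rep l t) := by
    intro t
    rw [hx, hx₁, hp₁₀', hc₁', mul_smul k, mul_smul k, quad_smul,
      quad_rep (repDen_pos hl t).ne', ← E₁, smul_smul]
  have hE₂ : ∀ t : I, quad (b 0 • F 0 + a 0 • G 0) p₀₁ (b 2 • F 0 + a 0 • G 2) (t : ℝ) =
      (k * repDen m t ^ 2) • V.E₂ B (rep m t) := by
    intro t
    rw [hx, hx₂, hp₀₁', hc₂', mul_smul k, mul_smul k, quad_smul,
      quad_rep (repDen_pos hm t).ne', ← E₂, smul_smul]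
  have hQ₁ : ∀ t : I, quad (a 0) (a 1) (a 2) (t : ℝ) =
      a 0 * (repDen l t ^ 2 * V.Q₁ B (rep l t)) := by
    intro t
    have := quad_rep (repDen_pos hl t).ne' 1 (V.m₁ B) V.e₁
    rw [smul_eq_mul, smul_eq_mul, smul_eq_mul, ← hr₁₁, ← hr₁₂] at this
    rw [Q₁, ← this]
    simp only [quad_real]
    field_simp
  have hQ₂ : ∀ t : I, quad (b 0) (b 1) (b 2) (t : ℝ) =
      b 0 * (repDen m t ^ 2 * V.Q₂ B (rep m t)) := by
    intro t
    have := quad_rep (repDen_pos hm t).ne' 1 (V.m₂ B) V.e₂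
    rw [smul_eq_mul, smul_eq_mul, smul_eq_mul, ← hr₂₁, ← hr₂₂] at this
    rw [Q₂, ← this]
    simp only [quad_real]
    field_simp
  refine ⟨B, l, m, hl, hm, hkB, eb, fun t₁ t₂ => ⟨⟨k * repDen l t₁ ^ 2 * repDen m t₂ ^ 2, ?_, ?_⟩,
    ⟨k * repDen l t₁ ^ 2, ?_, ?_⟩⟩⟩
  · have d1 := repDen_pos hl t₁
    have d2 := repDen_pos hm t₂
    positivity
  · have f1 : b 0 • quad (F 0) (F 1) (F 2) (t₁ : ℝ) =
        (k * repDen l t₁ ^ 2) • V.E₁ B (rep l t₁) -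
          quad (a 0) (a 1) (a 2) (t₁ : ℝ) • G 0 := by
      rw [← hE₁, hp₁₀]; simp only [quad, smul_eq_mul]; module
    have f2 : a 0 • quad (G 0) (G 1) (G 2) (t₂ : ℝ) =
        (k * repDen m t₂ ^ 2) • V.E₂ B (rep m t₂) -
          quad (b 0) (b 1) (b 2) (t₂ : ℝ) • F 0 := by
      rw [← hE₂, hp₀₁]; simp only [quad, smul_eq_mul]; module
    rw [sphericalPoint, hQ₂, hQ₁, mul_comm (b 0), mul_smul _ (b 0), f1, mul_comm (a 0),
      mul_smul _ (a 0), f2, hQ₁, hQ₂, P, coe_repIso, coe_repIso]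
    have e : (k * repDen l t₁ ^ 2 * repDen m t₂ ^ 2) •
        (V.Q₂ B (rep m t₂) • V.E₁ B (rep l t₁) + V.Q₁ B (rep l t₁) • V.E₂ B (rep m t₂) -
          (V.Q₁ B (rep l t₁) * V.Q₂ B (rep m t₂)) • pt V.x) =
        (k * repDen l t₁ ^ 2 * repDen m t₂ ^ 2) •
          (V.Q₂ B (rep m t₂) • V.E₁ B (rep l t₁) + V.Q₁ B (rep l t₁) • V.E₂ B (rep m t₂)) -
        (repDen l t₁ ^ 2 * repDen m t₂ ^ 2 * (V.Q₁ B (rep l t₁) * V.Q₂ B (rep m t₂))) •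
          (k • pt V.x) := by module
    rw [e, ← hx]
    module
  · have d1 := repDen_pos hl t₁
    positivity
  · rw [coe_repIso, ← hE₁, sphericalPoint, hp₁₀]
    simp only [quad, smul_eq_mul]; module

end CircularQuad

/-- Linear combinations of the vectors of a Möbius chart. -/
def comb (q₀ q₁ q₂ qinf : LieVec) (a b c d : ℝ) : LieVec := a • q₀ + b • q₁ + c • q₂ + d • qinf

theorem smul_comb_add (q₀ q₁ q₂ qinf : LieVec) (r r' a b c d a' b' c' d' : ℝ) :
    r • comb q₀ q₁ q₂ qinf a b c d + r' • comb q₀ q₁ q₂ qinf a' b' c' d' =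
      comb q₀ q₁ q₂ qinf (r * a + r' * a') (r * b + r' * b') (r * c + r' * c')
        (r * d + r' * d') := by
  simp only [comb]; module

/-! ### Cartesian and polar coordinates as biquadratic parametrizations -/

namespace IsMoebiusChart

variable {s q₀ q₁ q₂ qinf : LieVec}

theorem lieForm_comb (h : IsMoebiusChart s q₀ q₁ q₂ qinf)
    (a b c d a' b' c' d' : ℝ) :
    lieForm (comb q₀ q₁ q₂ qinf a b c d) (comb q₀ q₁ q₂ qinf a' b' c' d') =
      b * b' + c * c' - (a * d' + d * a') / 2 := by
  obtain ⟨-, -, -, h00, hii, h0i, h11, h22, h12, h01, h02, hi1, hi2⟩ := h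
  simp only [comb, map_add, map_smul, LinearMap.add_apply, LinearMap.smul_apply, smul_eq_mul,
    h00, hii, h0i, h11, h22, h12, h01, h02, hi1, hi2, lieForm_comm qinf q₀, lieForm_comm q₁ q₀,
    lieForm_comm q₂ q₀, lieForm_comm q₁ qinf, lieForm_comm q₂ qinf, lieForm_comm q₂ q₁]
  ring

theorem rCoord_comb (h : IsMoebiusChart s q₀ q₁ q₂ qinf)
    (a b c d : ℝ) : rCoord (comb q₀ q₁ q₂ qinf a b c d) = 0 := by
  have h := h.2.2.1
  simp only [Set.mem_insert_iff, Set.mem_singleton_iff, forall_eq_or_imp, forall_eq] at h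
  simp [comb, h]

theorem lieForm_s_comb (h : IsMoebiusChart s q₀ q₁ q₂ qinf)
    (a b c d : ℝ) : lieForm s (comb q₀ q₁ q₂ qinf a b c d) = 0 := by
  have h := h.2.2.1
  simp only [Set.mem_insert_iff, Set.mem_singleton_iff, forall_eq_or_imp, forall_eq] at h
  simp [comb, h]

theorem comb_ne_zero (h : IsMoebiusChart s q₀ q₁ q₂ qinf)
    {a b c d : ℝ} (hd : ¬ (a = 0 ∧ d = 0)) :
    comb q₀ q₁ q₂ qinf a b c d ≠ 0 := by
  intro h0
  have h1 := h.lieForm_comb a b c d 1 0 0 0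
  have h2 := h.lieForm_comb a b c d 0 0 0 1
  rw [h0, map_zero, LinearMap.zero_apply] at h1 h2
  exact hd ⟨by linarith, by linarith⟩

/-- Polar coordinates with the radius first. -/
theorem sphericalData_polar (h : IsMoebiusChart s q₀ q₁ q₂ qinf)
    (α β γ δ : ℝ × ℝ) : SphericalData s
    ![α.1 * α.2, α.1 * β.2 + α.2 * β.1, β.1 * β.2]
    ![γ.1 ^ 2 + γ.2 ^ 2, 2 * (γ.1 * δ.1 + γ.2 * δ.2), δ.1 ^ 2 + δ.2 ^ 2]
    ![comb q₀ q₁ q₂ qinf (α.1 ^ 2) 0 0 (α.2 ^ 2),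
      comb q₀ q₁ q₂ qinf (2 * α.1 * β.1) 0 0 (2 * α.2 * β.2),
      comb q₀ q₁ q₂ qinf (β.1 ^ 2) 0 0 (β.2 ^ 2)]
    ![comb q₀ q₁ q₂ qinf 0 (γ.1 ^ 2 - γ.2 ^ 2) (2 * γ.1 * γ.2) 0,
      comb q₀ q₁ q₂ qinf 0 (2 * (γ.1 * δ.1 - γ.2 * δ.2)) (2 * (γ.1 * δ.2 + γ.2 * δ.1)) 0,
      comb q₀ q₁ q₂ qinf 0 (δ.1 ^ 2 - δ.2 ^ 2) (2 * δ.1 * δ.2) 0] where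
  ss := h.1.2
  rF i := by fin_cases i <;> exact h.rCoord_comb _ _ _ _
  rG i := by fin_cases i <;> exact h.rCoord_comb _ _ _ _
  sF i := by fin_cases i <;> exact h.lieForm_s_comb _ _ _ _
  sG i := by fin_cases i <;> exact h.lieForm_s_comb _ _ _ _
  conic₁ := by
    constructor <;>
    · simp only [Matrix.cons_val_zero, Matrix.cons_val_one, Matrix.cons_val, smul_comb_add,
        h.lieForm_comb]
      ring
  conic₂ := by
    constructor <;>
    · simp only [Matrix.cons_val_zero, Matrix.cons_val_one, Matrix.cons_val, smul_comb_add,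
        h.lieForm_comb]
      ring
  ortho := by
    simp only [Matrix.cons_val_zero, Matrix.cons_val_one, smul_comb_add,
      h.lieForm_comb]
    ring
  weight₁ := by
    simp only [Matrix.cons_val_zero, Matrix.cons_val_one, Matrix.cons_val, smul_comb_add,
      h.lieForm_comb]
    ring
  weight₂ := by
    simp only [Matrix.cons_val_zero, Matrix.cons_val_one, Matrix.cons_val, smul_comb_add,
      h.lieForm_comb]
    ring

theorem polarPoint_eq_comb (u v : ℝ × ℝ) : polarPoint q₀ q₁ q₂ qinf u v =
    comb q₀ q₁ q₂ qinf ((v.1 ^ 2 + v.2 ^ 2) * u.1 ^ 2) (u.1 * u.2 * (v.1 ^ 2 - v.2 ^ 2))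
      (u.1 * u.2 * (2 * v.1 * v.2)) ((v.1 ^ 2 + v.2 ^ 2) * u.2 ^ 2) := by
  simp only [polarPoint, comb]; module

/-- Cartesian coordinates. -/
theorem sphericalData_cartesian (h : IsMoebiusChart s q₀ q₁ q₂ qinf) (α β γ δ : ℝ × ℝ) :
    SphericalData s
    ![α.1 ^ 2, 2 * α.1 * β.1, β.1 ^ 2] ![γ.1 ^ 2, 2 * γ.1 * δ.1, δ.1 ^ 2]
    ![comb q₀ q₁ q₂ qinf (α.1 ^ 2) (α.1 * α.2) 0 (α.2 ^ 2),
      comb q₀ q₁ q₂ qinf (2 * α.1 * β.1) (α.1 * β.2 + α.2 * β.1) 0 (2 * α.2 * β.2),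
      comb q₀ q₁ q₂ qinf (β.1 ^ 2) (β.1 * β.2) 0 (β.2 ^ 2)]
    ![comb q₀ q₁ q₂ qinf 0 0 (γ.1 * γ.2) (γ.2 ^ 2),
      comb q₀ q₁ q₂ qinf 0 0 (γ.1 * δ.2 + γ.2 * δ.1) (2 * γ.2 * δ.2),
      comb q₀ q₁ q₂ qinf 0 0 (δ.1 * δ.2) (δ.2 ^ 2)] where
  ss := h.1.2
  rF i := by fin_cases i <;> exact h.rCoord_comb _ _ _ _
  rG i := by fin_cases i <;> exact h.rCoord_comb _ _ _ _
  sF i := by fin_cases i <;> exact h.lieForm_s_comb _ _ _ _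
  sG i := by fin_cases i <;> exact h.lieForm_s_comb _ _ _ _
  conic₁ := by
    constructor <;>
    · simp only [Matrix.cons_val_zero, Matrix.cons_val_one, Matrix.cons_val, smul_comb_add,
        h.lieForm_comb]
      ring
  conic₂ := by
    constructor <;>
    · simp only [Matrix.cons_val_zero, Matrix.cons_val_one, Matrix.cons_val, smul_comb_add,
        h.lieForm_comb]
      ring
  ortho := by
    simp only [Matrix.cons_val_zero, Matrix.cons_val_one, smul_comb_add,
      h.lieForm_comb]
    ring
  weight₁ := by
    simp only [Matrix.cons_val_zero, Matrix.cons_val_one, Matrix.cons_val, smul_comb_add,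
      h.lieForm_comb]
    ring
  weight₂ := by
    simp only [Matrix.cons_val_zero, Matrix.cons_val_one, Matrix.cons_val, smul_comb_add,
      h.lieForm_comb]
    ring

theorem qinf_ne_zero (h : IsMoebiusChart s q₀ q₁ q₂ qinf) : qinf ≠ 0 := by
  have := h.comb_ne_zero (a := 0) (b := 0) (c := 0) (d := 1) (by simp)
  simpa [comb] using this

theorem polarPoint_ne_zero (h : IsMoebiusChart s q₀ q₁ q₂ qinf) {u v : ℝ × ℝ} (hu : u ≠ 0)
    (hv : v ≠ 0) : polarPoint q₀ q₁ q₂ qinf u v ≠ 0 := by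
  have hv' : v.1 ^ 2 + v.2 ^ 2 ≠ 0 := by
    intro h0
    apply hv
    have h1 : v.1 = 0 := by nlinarith [sq_nonneg v.1, sq_nonneg v.2]
    have h2 : v.2 = 0 := by nlinarith [sq_nonneg v.1, sq_nonneg v.2]
    exact Prod.ext h1 h2
  rw [polarPoint_eq_comb]
  apply h.comb_ne_zero
  simp only [mul_eq_zero, hv', false_or, ne_eq, OfNat.ofNat_ne_zero, not_false_eq_true,
    pow_eq_zero_iff]
  rintro ⟨h1, h2⟩
  exact hu (Prod.ext h1 h2)

end IsMoebiusChart

/-- The conditions are symmetric in the two parameters, so polar coordinates with the angle first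
need no separate computation. -/
theorem SphericalData.swap {s : LieVec} {a b : Fin 3 → ℝ} {F G : Fin 3 → LieVec}
    (h : SphericalData s a b F G) : SphericalData s b a G F where
  ss := h.ss
  rF := h.rG
  rG := h.rF
  sF := h.sG
  sG := h.sF
  conic₁ := by convert h.conic₂ using 1 <;> exact add_comm _ _
  conic₂ := by convert h.conic₁ using 1 <;> exact add_comm _ _
  ortho := by
    rw [lieForm_comm, add_comm (a 1 • G 0), add_comm (a 0 • G 1)]; exact h.ortho
  weight₁ := by
    rw [add_comm (a 0 • G 1), add_comm (a 2 • G 0), add_comm (a 0 • G 0)]; exact h.weight₂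
  weight₂ := by
    rw [add_comm (a 1 • G 0), add_comm (a 0 • G 2), add_comm (a 0 • G 0)]; exact h.weight₁

theorem sphericalPoint_swap (a b : Fin 3 → ℝ) (F G : Fin 3 → LieVec) (t₁ t₂ : ℝ) :
    sphericalPoint b a G F t₁ t₂ = sphericalPoint a b F G t₂ t₁ := add_comm _ _

theorem polarPoint_lineParam (q₀ q₁ q₂ qinf : LieVec) (α β γ δ : ℝ × ℝ) (t₁ t₂ : ℝ) :
    polarPoint q₀ q₁ q₂ qinf (lineParam α β t₁) (lineParam γ δ t₂) = sphericalPoint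
      ![α.1 * α.2, α.1 * β.2 + α.2 * β.1, β.1 * β.2]
      ![γ.1 ^ 2 + γ.2 ^ 2, 2 * (γ.1 * δ.1 + γ.2 * δ.2), δ.1 ^ 2 + δ.2 ^ 2]
      ![comb q₀ q₁ q₂ qinf (α.1 ^ 2) 0 0 (α.2 ^ 2),
        comb q₀ q₁ q₂ qinf (2 * α.1 * β.1) 0 0 (2 * α.2 * β.2),
        comb q₀ q₁ q₂ qinf (β.1 ^ 2) 0 0 (β.2 ^ 2)]
      ![comb q₀ q₁ q₂ qinf 0 (γ.1 ^ 2 - γ.2 ^ 2) (2 * γ.1 * γ.2) 0,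
        comb q₀ q₁ q₂ qinf 0 (2 * (γ.1 * δ.1 - γ.2 * δ.2)) (2 * (γ.1 * δ.2 + γ.2 * δ.1)) 0,
        comb q₀ q₁ q₂ qinf 0 (δ.1 ^ 2 - δ.2 ^ 2) (2 * δ.1 * δ.2) 0] t₁ t₂ := by
  simp only [polarPoint, lineParam, sphericalPoint, quad, comb, Matrix.cons_val_zero,
    Matrix.cons_val_one, Matrix.cons_val, Prod.fst_add, Prod.snd_add, Prod.smul_fst,
    Prod.smul_snd, smul_eq_mul]
  module

/-- Homogeneous form of `cartesianPoint`. -/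
def cartesianHom (q₀ q₁ q₂ qinf : LieVec) (u v : ℝ × ℝ) : LieVec :=
  comb q₀ q₁ q₂ qinf (u.1 ^ 2 * v.1 ^ 2) (v.1 ^ 2 * (u.1 * u.2)) (u.1 ^ 2 * (v.1 * v.2))
    (v.1 ^ 2 * u.2 ^ 2 + u.1 ^ 2 * v.2 ^ 2)

theorem cartesianHom_lineParam (q₀ q₁ q₂ qinf : LieVec) (α β γ δ : ℝ × ℝ) (t₁ t₂ : ℝ) :
    cartesianHom q₀ q₁ q₂ qinf (lineParam α β t₁) (lineParam γ δ t₂) = sphericalPoint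
      ![α.1 ^ 2, 2 * α.1 * β.1, β.1 ^ 2] ![γ.1 ^ 2, 2 * γ.1 * δ.1, δ.1 ^ 2]
      ![comb q₀ q₁ q₂ qinf (α.1 ^ 2) (α.1 * α.2) 0 (α.2 ^ 2),
        comb q₀ q₁ q₂ qinf (2 * α.1 * β.1) (α.1 * β.2 + α.2 * β.1) 0 (2 * α.2 * β.2),
        comb q₀ q₁ q₂ qinf (β.1 ^ 2) (β.1 * β.2) 0 (β.2 ^ 2)]
      ![comb q₀ q₁ q₂ qinf 0 0 (γ.1 * γ.2) (γ.2 ^ 2),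
        comb q₀ q₁ q₂ qinf 0 0 (γ.1 * δ.2 + γ.2 * δ.1) (2 * γ.2 * δ.2),
        comb q₀ q₁ q₂ qinf 0 0 (δ.1 * δ.2) (δ.2 ^ 2)] t₁ t₂ := by
  simp only [cartesianHom, lineParam, sphericalPoint, quad, comb, Matrix.cons_val_zero,
    Matrix.cons_val_one, Matrix.cons_val, Prod.fst_add, Prod.snd_add, Prod.smul_fst,
    Prod.smul_snd, smul_eq_mul]
  module

/-- Finiteness of both coordinates matters. With one infinite coordinate the homogeneous form is
still a nonzero multiple of qinf, but with two it vanishes, and this is the exceptional pair of a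
Cartesian patch. -/
theorem cartesianHom_eq_smul (q₀ q₁ q₂ qinf : LieVec) {u v : ℝ × ℝ} (hu : u.1 ≠ 0)
    (hv : v.1 ≠ 0) : cartesianHom q₀ q₁ q₂ qinf u v =
      (u.1 ^ 2 * v.1 ^ 2) • cartesianPoint q₀ q₁ q₂ qinf u v := by
  rw [cartesianPoint, if_neg (mul_ne_zero hu hv), cartesianHom, comb]
  simp only [smul_add, smul_smul]
  congr 1; congr 1; congr 1
  all_goals congr 1; field_simp

theorem lineParam_ne_zero {α β : ℝ × ℝ} (h : LinearIndependent ℝ ![α, β]) (t : ℝ) :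
    lineParam α β t ≠ 0 := by
  intro h0
  obtain ⟨h1, h2⟩ := LinearIndependent.pair_iff.1 h _ _ h0
  rw [h2] at h1; norm_num at h1

/-! ### Spherical patches come from frames -/

namespace CircularQuad
variable (V : CircularQuad)

theorem lieForm_x₂_x₁₂_ne : lieForm (pt V.x₂) (pt V.x₁₂) ≠ 0 := by
  intro h
  have h1 := congrArg (lieForm (pt V.x₂)) V.rel
  simp only [map_sub, map_add, map_smul, smul_eq_mul, lieForm_pt_self, h,
    lieForm_comm (pt V.x₂) (pt V.x), lieForm_comm (pt V.x₂) (pt V.x₁), V.lieForm_rel] at h1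
  have : V.e₂ * V.e₂ * lieForm (pt V.x) (pt V.x₁) = 0 := by linear_combination -h1
  simp [V.e₂_ne, V.neg₁.ne] at this

/-- A point of a sphere cannot be a multiple of two different vertices. -/
theorem not_mem_span_of_lieForm_ne {s q : LieVec} (hs : rCoord s ≠ 0) (hr : rCoord q = 0)
    (hq : lieForm q q = 0) {z z' : E3} (hz : lieForm (pt z) (pt z') ≠ 0)
    (h : pt z ∈ Submodule.span ℝ {s, q}) : pt z' ∉ Submodule.span ℝ {s, q} := by
  intro h'
  obtain ⟨c, hc, h1⟩ := exists_smul_of_mem_span hs hr h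
  obtain ⟨c', hc', h2⟩ := exists_smul_of_mem_span hs hr h'
  have : lieForm (c • pt z) (c' • pt z') = 0 := by rw [← h1, ← h2, hq]
  simp [hc, hc', hz] at this

/-- Spherical parametrizations without zeros. -/
theorem span_eq_patch {B : OrthonormalFrame} (hk : V.k B = 0) {s p : LieVec} (hs : rCoord s ≠ 0)
    (hsb : s = rCoord s • V.b B) {t₁ t₂ κ : ℝ} (hκ : κ ≠ 0) (h : p = κ • V.P B t₁ t₂)
    (hp : p ≠ 0) : Submodule.span ℝ {s, p} = V.patch B t₁ t₂ := by
  have hP : V.P B t₁ t₂ ≠ 0 := by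
    intro h0; rw [h0, smul_zero] at h; exact hp h
  rw [hsb, h, span_pair_smul hs hκ, patch, if_pos hk, if_neg hP]

/-- Every spherical patch is determined by a frame, up to projective changes of the parameters. -/
theorem exists_patch_of_isSphericalPatch {L : I → I → Submodule ℝ LieVec}
    (hL : IsSphericalPatch L) (hV : HasVertices L V.x V.x₁ V.x₁₂ V.x₂) :
    ∃ (B : OrthonormalFrame) (l m : ℝ) (hl : 0 < l) (hm : 0 < m), V.k B = 0 ∧ ∀ t₁ t₂ : I,
      L t₁ t₂ = V.patch B (repIso l hl t₁) (repIso m hm t₂) := by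
  obtain ⟨s, q₀, q₁, q₂, qinf, α, β, γ, δ, hc, hαβ, hγδ, hL⟩ := hL
  obtain ⟨v1, v2, v3, v4⟩ := hV
  simp only [IsPointOf, pointSphere_coe] at v1 v2 v3 v4
  have hs := hc.2.1
  rcases hL with hL | hL | hL <;> rw [hL, Set.Icc.coe_zero] at v1 <;>
    rw [hL, Set.Icc.coe_zero, Set.Icc.coe_one] at v2 v4 <;> rw [hL, Set.Icc.coe_one] at v3
  · have hr : rCoord qinf = 0 := (hc.2.2.1 qinf (by simp)).1
    have hq : lieForm qinf qinf = 0 := hc.2.2.2.2.1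
    have l0 : ∀ a b : ℝ × ℝ, lineParam a b 0 = a := fun a b => by simp [lineParam]
    have l1 : ∀ a b : ℝ × ℝ, lineParam a b 1 = b := fun a b => by simp [lineParam]
    simp only [l0, l1] at v1 v2 v3 v4
    -- An infinite coordinate would send a whole edge of the rectangle to qinf, so two distinct
    -- vertices would coincide. Hence all vertices have finite coordinates.
    have hα : α.1 ≠ 0 := by
      intro h0
      rw [cartesianPoint, if_pos (by rw [h0, zero_mul])] at v1 v4
      exact not_mem_span_of_lieForm_ne hs hr hq V.neg₂.ne v1 v4
    have hβ : β.1 ≠ 0 := by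
      intro h0
      rw [cartesianPoint, if_pos (by rw [h0, zero_mul])] at v2 v3
      exact not_mem_span_of_lieForm_ne hs hr hq V.lieForm_x₁_x₁₂_ne v2 v3
    have hγ : γ.1 ≠ 0 := by
      intro h0
      rw [cartesianPoint, if_pos (by rw [h0, mul_zero])] at v1 v2
      exact not_mem_span_of_lieForm_ne hs hr hq V.neg₁.ne v1 v2
    have hδ : δ.1 ≠ 0 := by
      intro h0
      rw [cartesianPoint, if_pos (by rw [h0, mul_zero])] at v3 v4
      exact not_mem_span_of_lieForm_ne hs hr hq V.lieForm_x₂_x₁₂_ne v4 v3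
    have hspan : ∀ u v : ℝ × ℝ, u.1 ≠ 0 → v.1 ≠ 0 →
        Submodule.span ℝ {s, cartesianPoint q₀ q₁ q₂ qinf u v} =
          Submodule.span ℝ {s, cartesianHom q₀ q₁ q₂ qinf u v} := by
      intro u v hu hv
      rw [cartesianHom_eq_smul _ _ _ _ hu hv]
      nth_rewrite 2 [← one_smul ℝ s]
      rw [span_pair_smul one_ne_zero (mul_ne_zero (pow_ne_zero 2 hu) (pow_ne_zero 2 hv))]
    rw [hspan _ _ hα hγ, ← l0 α β, ← l0 γ δ, cartesianHom_lineParam] at v1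
    rw [hspan _ _ hβ hγ, ← l1 α β, ← l0 γ δ, cartesianHom_lineParam] at v2
    rw [hspan _ _ hβ hδ, ← l1 α β, ← l1 γ δ, cartesianHom_lineParam] at v3
    rw [hspan _ _ hα hδ, ← l0 α β, ← l1 γ δ, cartesianHom_lineParam] at v4
    obtain ⟨B, l, m, hl, hm, hk, hsb, H⟩ := V.exists_patch_of_sphericalData
      (hc.sphericalData_cartesian α β γ δ) hs v1 v2 v3 v4
    refine ⟨B, l, m, hl, hm, hk, fun t₁ t₂ => ?_⟩
    obtain ⟨⟨κ, hκ, h⟩, κ', hκ', h'⟩ := H t₁ t₂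
    rw [← cartesianHom_lineParam] at h h'
    rw [l0] at h'
    rw [hL]
    have hu := lineParam_ne_zero hαβ t₁
    have hv := lineParam_ne_zero hγδ t₂
    set u := lineParam α β t₁
    set v := lineParam γ δ t₂
    have hu2 : u.1 = 0 → u.2 ≠ 0 := fun h1 h2 => hu (Prod.ext h1 h2)
    have hv2 : v.1 = 0 → v.2 ≠ 0 := fun h1 h2 => hv (Prod.ext h1 h2)
    by_cases hu1 : u.1 = 0
    · have e1 : ∀ w : ℝ × ℝ, cartesianHom q₀ q₁ q₂ qinf u w = (w.1 ^ 2 * u.2 ^ 2) • qinf := by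
        intro w; simp [cartesianHom, comb, hu1]
      rw [cartesianPoint, if_pos (by rw [hu1, zero_mul])]
      by_cases hv1 : v.1 = 0
      -- Both coordinates are infinite and P vanishes. The point qinf is recovered from the first
      -- boundary arc, whose second coordinate γ is finite.
      · have hP : V.P B (repIso l hl t₁) (repIso m hm t₂) = 0 := by
          rw [e1, hv1] at h
          have : κ • V.P B (repIso l hl t₁) (repIso m hm t₂) = 0 := by rw [← h]; simp
          exact (smul_eq_zero.1 this).resolve_left hκ
        have hγ2 := pow_ne_zero 2 hγ
        have hu22 := pow_ne_zero 2 (hu2 hu1)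
        rw [e1] at h'
        have : qinf = ((γ.1 ^ 2 * u.2 ^ 2)⁻¹ * κ') • V.E₁ B (repIso l hl t₁) := by
          rw [mul_smul, ← h', smul_smul, inv_mul_cancel₀ (mul_ne_zero hγ2 hu22), one_smul]
        rw [hsb, this, span_pair_smul hs (mul_ne_zero (inv_ne_zero (mul_ne_zero hγ2 hu22)) hκ'),
          patch, if_pos hk, if_pos hP]
      · have hne : v.1 ^ 2 * u.2 ^ 2 ≠ 0 := mul_ne_zero (pow_ne_zero 2 hv1) (pow_ne_zero 2 (hu2 hu1))
        rw [e1] at h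
        apply V.span_eq_patch hk hs hsb (κ := (v.1 ^ 2 * u.2 ^ 2)⁻¹ * κ)
          (mul_ne_zero (inv_ne_zero hne) hκ) _ hc.qinf_ne_zero
        rw [mul_smul, ← h, smul_smul, inv_mul_cancel₀ hne, one_smul]
    · by_cases hv1 : v.1 = 0
      · have hne : u.1 ^ 2 * v.2 ^ 2 ≠ 0 := mul_ne_zero (pow_ne_zero 2 hu1) (pow_ne_zero 2 (hv2 hv1))
        have e1 : cartesianHom q₀ q₁ q₂ qinf u v = (u.1 ^ 2 * v.2 ^ 2) • qinf := by
          simp [cartesianHom, comb, hv1]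
        rw [cartesianPoint, if_pos (by rw [hv1, mul_zero])]
        rw [e1] at h
        apply V.span_eq_patch hk hs hsb (κ := (u.1 ^ 2 * v.2 ^ 2)⁻¹ * κ)
          (mul_ne_zero (inv_ne_zero hne) hκ) _ hc.qinf_ne_zero
        rw [mul_smul, ← h, smul_smul, inv_mul_cancel₀ hne, one_smul]
      · rw [hspan _ _ hu1 hv1]
        exact V.span_eq_patch hk hs hsb hκ h (hc.comb_ne_zero (by simp [hu1, hv1]))
  · simp only [polarPoint_lineParam] at v1 v2 v3 v4
    obtain ⟨B, l, m, hl, hm, hk, hsb, H⟩ := V.exists_patch_of_sphericalData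
      (hc.sphericalData_polar α β γ δ) hs v1 v2 v3 v4
    refine ⟨B, l, m, hl, hm, hk, fun t₁ t₂ => ?_⟩
    obtain ⟨⟨κ, hκ, h⟩, -⟩ := H t₁ t₂
    rw [← polarPoint_lineParam] at h
    rw [hL]
    exact V.span_eq_patch hk hs hsb hκ h
      (hc.polarPoint_ne_zero (lineParam_ne_zero hαβ _) (lineParam_ne_zero hγδ _))
  · simp only [polarPoint_lineParam] at v1 v2 v3 v4
    rw [← sphericalPoint_swap] at v1 v2 v3 v4
    obtain ⟨B, l, m, hl, hm, hk, hsb, H⟩ := V.exists_patch_of_sphericalData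
      (hc.sphericalData_polar γ δ α β).swap hs v1 v2 v3 v4
    refine ⟨B, l, m, hl, hm, hk, fun t₁ t₂ => ?_⟩
    obtain ⟨⟨κ, hκ, h⟩, -⟩ := H t₁ t₂
    rw [sphericalPoint_swap, ← polarPoint_lineParam] at h
    rw [hL]
    exact V.span_eq_patch hk hs hsb hκ h
      (hc.polarPoint_ne_zero (lineParam_ne_zero hγδ _) (lineParam_ne_zero hαβ _))

end CircularQuad

/-! ### A Möbius chart adapted to a frame -/

theorem tangentVec_add (x t t' : E3) : tangentVec x (t + t') = tangentVec x t + tangentVec x t' := by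
  simp [tangentVec, inner_add_right]; ring

theorem tangentVec_smul (x t : E3) (r : ℝ) : tangentVec x (r • t) = r • tangentVec x t := by
  simp [tangentVec, real_inner_smul_right]; ring

/-- Coordinates of `z` in terms of its image under the inversion about `x`. -/
theorem pt_eq_invVec {x z : E3} (h : x ≠ z) : (‖z - x‖ ^ 2)⁻¹ • pt z =
    tangentVec x (invVec x z) + ‖invVec x z‖ ^ 2 • pt x + (0, 0, 1, 0) := by
  have hn : ‖z - x‖ ≠ 0 := norm_ne_zero_iff.2 (sub_ne_zero.2 h.symm)
  have h1 : ‖invVec x z‖ ^ 2 = (‖z - x‖ ^ 2)⁻¹ := by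
    rw [invVec, norm_smul, norm_inv, norm_pow, norm_norm]; field_simp
  have h2 : pt z = tangentVec x (z - x) + pt x + ‖z - x‖ ^ 2 • (0, 0, 1, 0) := by
    simp only [pt, tangentVec, Prod.smul_mk, Prod.mk_add_mk, smul_zero, smul_eq_mul, mul_zero,
      mul_one, add_zero, zero_add, sub_add_cancel, Prod.mk.injEq, true_and, and_true]
    rw [norm_sub_sq_real, inner_sub_right, real_inner_self_eq_norm_sq, real_inner_comm]
    ring
  rw [h2, h1, invVec, tangentVec_smul, smul_add, smul_add, smul_smul,
    inv_mul_cancel₀ (pow_ne_zero 2 hn), one_smul]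

theorem OrthonormalFrame.sum_inner_smul (B : OrthonormalFrame) (v : E3) :
    inner ℝ (B.1 0) v • B.1 0 + inner ℝ (B.1 1) v • B.1 1 + inner ℝ (B.1 2) v • B.1 2 = v := by
  apply ext_inner_right ℝ
  intro w
  rw [← B.sum_inner_mul_inner v w]
  simp [inner_add_left, real_inner_smul_left]

namespace CircularQuad
variable (V : CircularQuad) (B : OrthonormalFrame)

/-- Components of `y`. -/
def y₁ : ℝ := inner ℝ (B.1 0) V.y
def y₂ : ℝ := inner ℝ (B.1 1) V.y

/-- A Möbius chart adapted to a frame, in which the boundary arcs are Cartesian coordinate axes. -/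
def T₁ : LieVec := tangentVec V.x (B.1 0) + (2 * inner ℝ (B.1 0) (invVec V.x V.x₂)) • pt V.x
def T₂ : LieVec := tangentVec V.x (B.1 1) + (2 * inner ℝ (B.1 1) (invVec V.x V.x₁)) • pt V.x
-- The point ∞ of the chart: for k = 0 it is the second intersection of the two boundary circles.
-- The vertex x₁ has coordinate 1/y₁ on the first axis.
def Z : LieVec := (V.l₁ ^ 2)⁻¹ • pt V.x₁ - V.y₁ B • V.T₁ B - V.y₁ B ^ 2 • pt V.x

theorem x₁_eq : pt V.x₁ = V.l₁ ^ 2 • (V.Z B + V.y₁ B • V.T₁ B + V.y₁ B ^ 2 • pt V.x) := by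
  have := V.l₁_pos
  have h : V.Z B + V.y₁ B • V.T₁ B + V.y₁ B ^ 2 • pt V.x = (V.l₁ ^ 2)⁻¹ • pt V.x₁ := by
    rw [Z]; abel
  rw [h, smul_smul, mul_inv_cancel₀ (by positivity), one_smul]

variable {B} in
theorem x₂_eq (hk : V.k B = 0) :
    pt V.x₂ = V.l₂ ^ 2 • (V.Z B - V.y₂ B • V.T₂ B + V.y₂ B ^ 2 • pt V.x) := by
  have h2 := V.l₂_pos
  have hy : inner ℝ (B.1 2) V.y = 0 := by simpa [k] using hk
  have e1 := pt_eq_invVec V.ne₁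
  have e2 := pt_eq_invVec V.ne₂
  rw [← l₁] at e1
  rw [← l₂] at e2
  have e3 : V.Z B - V.y₂ B • V.T₂ B + V.y₂ B ^ 2 • pt V.x = (V.l₂ ^ 2)⁻¹ • pt V.x₂ := by
    have s1 := B.sum_inner_mul_inner (invVec V.x V.x₁) (invVec V.x V.x₁)
    have s2 := B.sum_inner_mul_inner (invVec V.x V.x₂) (invVec V.x V.x₂)
    have s3 := B.sum_inner_smul V.y
    rw [hy, zero_smul, add_zero, y, ← y] at s3
    rw [real_inner_self_eq_norm_sq] at s1 s2
    -- Since k = 0, y has no n-component, so the inverted points differ by y₁t₁ + y₂t₂. This is what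
    -- places x₂ in the same chart as x₁.
    have s4 : tangentVec V.x (invVec V.x V.x₁) = tangentVec V.x (invVec V.x V.x₂) +
        (V.y₁ B • tangentVec V.x (B.1 0) + V.y₂ B • tangentVec V.x (B.1 1)) := by
      rw [← tangentVec_smul, ← tangentVec_smul, ← tangentVec_add, ← tangentVec_add, y₁, y₂, s3,
        y]
      congr 1; abel
    rw [Z, e1, e2, ← s1, ← s2, s4, T₁, T₂]
    have n0 : inner ℝ (B.1 2) (invVec V.x V.x₁) = inner ℝ (B.1 2) (invVec V.x V.x₂) := by
      rw [y, inner_sub_right] at hy; linarith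
    have n1 : inner ℝ (B.1 0) (invVec V.x V.x₁) =
        inner ℝ (B.1 0) (invVec V.x V.x₂) + V.y₁ B := by
      rw [y₁, y, inner_sub_right]; ring
    have n2 : inner ℝ (B.1 1) (invVec V.x V.x₂) =
        inner ℝ (B.1 1) (invVec V.x V.x₁) - V.y₂ B := by
      rw [y₂, y, inner_sub_right]; ring
    rw [n0, n1, n2]
    module
  rw [e3, smul_smul, mul_inv_cancel₀ (by positivity), one_smul]

theorem mid₁_eq : V.mid₁ B = V.l₁ • (V.T₁ B + (2 * V.y₁ B) • pt V.x) := by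
  rw [mid₁, arcMid, ← l₁, T₁, y₁, y, inner_sub_right]; module

theorem mid₂_eq : V.mid₂ B = V.l₂ • (V.T₂ B - (2 * V.y₂ B) • pt V.x) := by
  rw [mid₂, arcMid, ← l₂, T₂, y₂, y, inner_sub_right]; module

theorem isMoebiusChart : IsMoebiusChart (V.b B) (pt V.x) (V.T₁ B) (V.T₂ B) (V.Z B) := by
  have h1 := V.l₁_pos
  have XX : lieForm (pt V.x) (pt V.x) = 0 := lieForm_pt_self _
  have XT₁ : lieForm (pt V.x) (V.T₁ B) = 0 := by simp [T₁, lieForm_pt_tangentVec]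
  have XT₂ : lieForm (pt V.x) (V.T₂ B) = 0 := by simp [T₂, lieForm_pt_tangentVec]
  have TT₁ : lieForm (V.T₁ B) (V.T₁ B) = 1 := by
    simp [T₁, lieForm_pt_tangentVec, lieForm_tangentVec_pt, lieForm_tangentVec_tangentVec,
      B.norm_eq]
  have TT₂ : lieForm (V.T₂ B) (V.T₂ B) = 1 := by
    simp [T₂, lieForm_pt_tangentVec, lieForm_tangentVec_pt, lieForm_tangentVec_tangentVec,
      B.norm_eq]
  have TT : lieForm (V.T₁ B) (V.T₂ B) = 0 := by
    simp [T₁, T₂, lieForm_pt_tangentVec, lieForm_tangentVec_pt, lieForm_tangentVec_tangentVec,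
      B.inner_eq]
  have x₁T₁ : lieForm (pt V.x₁) (V.T₁ B) = V.l₁ ^ 2 * V.y₁ B := by
    have := inner_invVec V.ne₁ (B.1 0)
    rw [← l₁] at this
    simp only [T₁, map_add, map_smul, lieForm_pt_tangentVec, smul_eq_mul,
      lieForm_comm (pt V.x₁) (pt V.x), V.lieForm₁, y₁, y, inner_sub_right (B.1 0) (invVec _ _)]
    linear_combination -this
  have x₁T₂ : lieForm (pt V.x₁) (V.T₂ B) = 0 := by
    have := inner_invVec V.ne₁ (B.1 1)
    rw [← l₁] at this
    simp only [T₂, map_add, map_smul, lieForm_pt_tangentVec, smul_eq_mul,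
      lieForm_comm (pt V.x₁) (pt V.x), V.lieForm₁]
    linear_combination -this
  have bT₁ : lieForm (V.b B) (V.T₁ B) = 0 := by
    simp [b, T₁, lieForm_tangentPlane_tangentVec, lieForm_tangentPlane_pt, lieForm_pt_tangentVec,
      B.inner_eq]
  have bT₂ : lieForm (V.b B) (V.T₂ B) = 0 := by
    simp [b, T₂, lieForm_tangentPlane_tangentVec, lieForm_tangentPlane_pt, lieForm_pt_tangentVec,
      B.inner_eq]
  have r₁ : rCoord (V.T₁ B) = 0 := by simp [T₁]
  have r₂ : rCoord (V.T₂ B) = 0 := by simp [T₂]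
  have l0 := V.l₁_pos.ne'
  refine ⟨⟨?_, V.lieForm_b_b B⟩, by simp, ?_, XX, ?_, ?_, TT₁, TT₂, TT, XT₁, XT₂, ?_, ?_⟩
  · intro h
    have := V.rCoord_b B
    rw [h] at this; simp at this
  · simp only [Set.mem_insert_iff, Set.mem_singleton_iff, forall_eq_or_imp, forall_eq]
    refine ⟨⟨by simp, V.lieForm_b_x B⟩, ⟨r₁, bT₁⟩, ⟨r₂, bT₂⟩, ?_, ?_⟩
    · simp [Z, r₁]
    · simp [Z, bT₁, lieForm_b_x, lieForm_b_x₁]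
  all_goals
    simp only [Z, map_sub, map_smul, LinearMap.sub_apply, LinearMap.smul_apply, smul_eq_mul, XX,
      XT₁, XT₂, TT₁, TT, x₁T₁, x₁T₂, lieForm_pt_self, lieForm_comm (V.T₁ B) (pt V.x),
      lieForm_comm (V.T₁ B) (pt V.x₁), lieForm_comm (pt V.x₁) (pt V.x), V.lieForm₁]
    try field_simp
    try ring

/-- Homogeneous Cartesian coordinates along the boundary arcs. -/
def g₁ (t : ℝ) : ℝ := (1 - t) + V.y₁ B * V.l₁ * t
def g₂ (t : ℝ) : ℝ := (1 - t) - V.y₂ B * V.l₂ * t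

/-- The discriminant deciding between Cartesian and polar coordinates. -/
def disc : ℝ := V.y₁ B ^ 2 - V.e₁ / V.l₁ ^ 2

/-- In the chart the first arc runs along the first axis with coordinate l₁t / g₁. For k = 0 the
second arc similarly runs along the second axis. -/
theorem E₁_eq (t : ℝ) : V.E₁ B t = comb (pt V.x) (V.T₁ B) (V.T₂ B) (V.Z B) (V.g₁ B t ^ 2)
    (V.g₁ B t * (V.l₁ * t)) 0 ((V.l₁ * t) ^ 2) := by
  rw [E₁, V.mid₁_eq, V.x₁_eq B, g₁]; simp only [quad, comb]; module

variable {B} in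
theorem E₂_eq (hk : V.k B = 0) (t : ℝ) :
    V.E₂ B t = comb (pt V.x) (V.T₁ B) (V.T₂ B) (V.Z B) (V.g₂ B t ^ 2) 0
      (V.g₂ B t * (V.l₂ * t)) ((V.l₂ * t) ^ 2) := by
  rw [E₂, V.mid₂_eq, V.x₂_eq hk, g₂]; simp only [quad, comb]; module

theorem Q₁_eq (t : ℝ) : V.Q₁ B t = V.g₁ B t ^ 2 - V.disc B * (V.l₁ * t) ^ 2 := by
  have := V.l₁_pos
  have e : V.e₁ = V.l₁ ^ 2 * (V.y₁ B ^ 2 - V.disc B) := by rw [disc]; field_simp; ring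
  rw [Q₁, quad_real, g₁, m₁, e, ← y₁]; ring

variable {B} in
-- At k = 0 the discriminants of the two weights, divided by l₁² and l₂², add up to zero by
-- `disc_add_disc`. The same `disc` therefore enters with the opposite sign from `Q₁_eq`.
theorem Q₂_eq (hk : V.k B = 0) (t : ℝ) :
    V.Q₂ B t = V.g₂ B t ^ 2 + V.disc B * (V.l₂ * t) ^ 2 := by
  have h1 := V.l₁_pos
  have h2 := V.l₂_pos
  have h := V.disc_add_disc B
  rw [hk, m₁, m₂, ← y₁, ← y₂] at h
  have e : V.e₂ = V.l₂ ^ 2 * (V.y₂ B ^ 2 + V.disc B) := by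
    rw [disc]; field_simp at h ⊢; linear_combination (-1 / 4) * h
  rw [Q₂, quad_real, g₂, m₂, e, ← y₂]; ring

variable {B} in
theorem P_eq (hk : V.k B = 0) (t₁ t₂ : ℝ) :
    V.P B t₁ t₂ = comb (pt V.x) (V.T₁ B) (V.T₂ B) (V.Z B)
      (V.g₁ B t₁ ^ 2 * V.g₂ B t₂ ^ 2 + V.disc B ^ 2 * ((V.l₁ * t₁) ^ 2 * (V.l₂ * t₂) ^ 2))
      (V.g₁ B t₁ * (V.l₁ * t₁) * (V.g₂ B t₂ ^ 2 + V.disc B * (V.l₂ * t₂) ^ 2))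
      (V.g₂ B t₂ * (V.l₂ * t₂) * (V.g₁ B t₁ ^ 2 - V.disc B * (V.l₁ * t₁) ^ 2))
      (V.g₂ B t₂ ^ 2 * (V.l₁ * t₁) ^ 2 + V.g₁ B t₁ ^ 2 * (V.l₂ * t₂) ^ 2) := by
  rw [P, V.Q₁_eq, V.Q₂_eq hk, V.E₁_eq, V.E₂_eq hk]; simp only [comb]; module

end CircularQuad

/-- The Möbius chart with its base points `0`, `∞` on the first axis of a given chart. -/
theorem IsMoebiusChart.polar₁ {s q₀ q₁ q₂ qinf : LieVec} (h : IsMoebiusChart s q₀ q₁ q₂ qinf)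
    {c : ℝ} (hc : c ≠ 0) : IsMoebiusChart s
      (comb q₀ q₁ q₂ qinf (c / 2) (1 / 2) 0 (1 / (2 * c))) (comb q₀ q₁ q₂ qinf c 0 0 (-1 / c))
      (comb q₀ q₁ q₂ qinf 0 0 1 0) (comb q₀ q₁ q₂ qinf (c / 2) (-1 / 2) 0 (1 / (2 * c))) := by
  refine ⟨h.1, h.2.1, ?_, ?_⟩
  · simp only [Set.mem_insert_iff, Set.mem_singleton_iff, forall_eq_or_imp, forall_eq,
      h.rCoord_comb, h.lieForm_s_comb, and_self]
  · simp only [h.lieForm_comb]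
    refine ⟨?_, ?_, ?_, ?_, ?_, ?_, ?_, ?_, ?_, ?_⟩ <;> field_simp <;> ring

/-- The Möbius chart with its base points `0`, `∞` on the second axis of a given chart. -/
theorem IsMoebiusChart.polar₂ {s q₀ q₁ q₂ qinf : LieVec} (h : IsMoebiusChart s q₀ q₁ q₂ qinf)
    {c : ℝ} (hc : c ≠ 0) : IsMoebiusChart s
      (comb q₀ q₁ q₂ qinf (c / 2) 0 (1 / 2) (1 / (2 * c))) (comb q₀ q₁ q₂ qinf c 0 0 (-1 / c))
      (comb q₀ q₁ q₂ qinf 0 1 0 0) (comb q₀ q₁ q₂ qinf (c / 2) 0 (-1 / 2) (1 / (2 * c))) := by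
  refine ⟨h.1, h.2.1, ?_, ?_⟩
  · simp only [Set.mem_insert_iff, Set.mem_singleton_iff, forall_eq_or_imp, forall_eq,
      h.rCoord_comb, h.lieForm_s_comb, and_self]
  · simp only [h.lieForm_comb]
    refine ⟨?_, ?_, ?_, ?_, ?_, ?_, ?_, ?_, ?_, ?_⟩ <;> field_simp <;> ring

/-- The new base points have coordinates ±1/c on the first axis. With disc = c² the right side is 2c
times the expression in `P_eq`; `comb_polar₂` is the analogue for disc = −c². -/
theorem comb_polar₁ (q₀ q₁ q₂ qinf : LieVec) {c : ℝ} (hc : c ≠ 0) (g h g' h' : ℝ) :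
    polarPoint (comb q₀ q₁ q₂ qinf (c / 2) (1 / 2) 0 (1 / (2 * c)))
      (comb q₀ q₁ q₂ qinf c 0 0 (-1 / c)) (comb q₀ q₁ q₂ qinf 0 0 1 0)
      (comb q₀ q₁ q₂ qinf (c / 2) (-1 / 2) 0 (1 / (2 * c))) (g + c * h, g - c * h) (g', c * h') =
    (2 * c) • comb q₀ q₁ q₂ qinf (g ^ 2 * g' ^ 2 + c ^ 4 * (h ^ 2 * h' ^ 2))
      (g * h * (g' ^ 2 + c ^ 2 * h' ^ 2)) (g' * h' * (g ^ 2 - c ^ 2 * h ^ 2))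
      (g' ^ 2 * h ^ 2 + g ^ 2 * h' ^ 2) := by
  simp only [polarPoint, comb]
  match_scalars <;> field_simp <;> ring

theorem comb_polar₂ (q₀ q₁ q₂ qinf : LieVec) {c : ℝ} (hc : c ≠ 0) (g h g' h' : ℝ) :
    polarPoint (comb q₀ q₁ q₂ qinf (c / 2) 0 (1 / 2) (1 / (2 * c)))
      (comb q₀ q₁ q₂ qinf c 0 0 (-1 / c)) (comb q₀ q₁ q₂ qinf 0 1 0 0)
      (comb q₀ q₁ q₂ qinf (c / 2) 0 (-1 / 2) (1 / (2 * c))) (g' + c * h', g' - c * h') (g, c * h) =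
    (2 * c) • comb q₀ q₁ q₂ qinf (g ^ 2 * g' ^ 2 + c ^ 4 * (h ^ 2 * h' ^ 2))
      (g * h * (g' ^ 2 - c ^ 2 * h' ^ 2)) (g' * h' * (g ^ 2 + c ^ 2 * h ^ 2))
      (g' ^ 2 * h ^ 2 + g ^ 2 * h' ^ 2) := by
  simp only [polarPoint, comb]
  match_scalars <;> field_simp <;> ring

/-! ### Frames with k = 0 give spherical patches -/

namespace CircularQuad
variable (V : CircularQuad) {B : OrthonormalFrame}

theorem E₁_ne_zero (B : OrthonormalFrame) (t : I) : V.E₁ B t ≠ 0 := by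
  have hx := V.neg₁.ne
  intro h
  have h1 := congrArg (lieForm (pt V.x)) h
  have h2 := congrArg (lieForm (pt V.x₁)) h
  simp only [E₁, quad, map_add, map_smul, smul_eq_mul, lieForm_pt_self, map_zero,
    lieForm_comm (pt V.x) (V.mid₁ B), lieForm_comm (pt V.x₁) (V.mid₁ B), lieForm_mid₁_x,
    lieForm_mid₁_x₁, lieForm_comm (pt V.x₁) (pt V.x), mul_zero, add_zero, zero_add,
    mul_eq_zero, hx, or_false, ne_eq, OfNat.ofNat_ne_zero, not_false_eq_true,
    pow_eq_zero_iff] at h1 h2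
  rw [h1] at h2; norm_num at h2

/-- Frames whose normal is orthogonal to the circle of the vertices give spherical patches. -/
theorem isSphericalPatch_patch (hk : V.k B = 0) :
    IsSphericalPatch fun t₁ t₂ => V.patch B t₁ t₂ := by
  have hl₁ := V.l₁_pos
  have hl₂ := V.l₂_pos
  have hc := V.isMoebiusChart B
  have hb1 : V.b B = rCoord (V.b B) • V.b B := by simp
  have hb0 : rCoord (V.b B) ≠ 0 := by simp
  rcases lt_trichotomy (V.disc B) 0 with hd | hd | hd
  -- Here Q₂ = g₂² − c²(l₂t)² vanishes at the coordinates ±1/c of the second axis. These become the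
  -- base points, so the second parameter is the radius and the first is the angle.
  · set c := √(-V.disc B) with hcd
    have hc0 : c ≠ 0 := (Real.sqrt_pos.2 (neg_pos.2 hd)).ne'
    have hc2 : V.disc B = -c ^ 2 := by rw [Real.sq_sqrt (neg_pos.2 hd).le]; ring
    -- The end points of the interval are the values at t = 0 and t = 1 of the affine curve (g₁, c
    -- l₁ t).
    have li₁ : LinearIndependent ℝ ![((1 : ℝ), (0 : ℝ)), (V.y₁ B * V.l₁, c * V.l₁)] := by
      rw [LinearIndependent.pair_iff]
      intro s t h
      simp only [Prod.smul_mk, Prod.mk_add_mk, Prod.mk_eq_zero, smul_eq_mul] at h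
      have ht : t = 0 := by simpa [hc0, hl₁.ne'] using h.2
      rw [ht] at h
      exact ⟨by simpa using h.1, ht⟩
    have li₂ : LinearIndependent ℝ ![((1 : ℝ), (1 : ℝ)),
        (-V.y₂ B * V.l₂ + c * V.l₂, -V.y₂ B * V.l₂ - c * V.l₂)] := by
      rw [LinearIndependent.pair_iff]
      intro s t h
      simp only [Prod.smul_mk, Prod.mk_add_mk, Prod.mk_eq_zero, smul_eq_mul] at h
      have ht : t * (c * V.l₂) = 0 := by linear_combination (1 / 2) * (h.1 - h.2)
      have ht : t = 0 := by simpa [hc0, hl₂.ne'] using ht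
      rw [ht] at h
      exact ⟨by simpa using h.1, ht⟩
    refine ⟨_, _, _, _, _, _, _, _, _, hc.polar₂ hc0, li₁, li₂, Or.inr (Or.inr fun t₁ t₂ => ?_)⟩
    refine (V.span_eq_patch hk hb0 hb1 (κ := 2 * c) (by positivity) ?_
      ((hc.polar₂ hc0).polarPoint_ne_zero (lineParam_ne_zero li₂ _)
        (lineParam_ne_zero li₁ _))).symm
    have e₁ : lineParam ((1 : ℝ), (0 : ℝ)) (V.y₁ B * V.l₁, c * V.l₁) t₁ =
        (V.g₁ B t₁, c * (V.l₁ * t₁)) := by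
      simp only [lineParam, g₁, Prod.smul_mk, Prod.mk_add_mk, smul_eq_mul, Prod.mk.injEq]
      constructor <;> ring
    have e₂ : lineParam ((1 : ℝ), (1 : ℝ))
        (-V.y₂ B * V.l₂ + c * V.l₂, -V.y₂ B * V.l₂ - c * V.l₂) t₂ =
        (V.g₂ B t₂ + c * (V.l₂ * t₂), V.g₂ B t₂ - c * (V.l₂ * t₂)) := by
      simp only [lineParam, g₂, Prod.smul_mk, Prod.mk_add_mk, smul_eq_mul, Prod.mk.injEq]
      constructor <;> ring
    rw [e₁, e₂, comb_polar₂ _ _ _ _ hc0, V.P_eq hk, hc2]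
    congr 2 <;> ring
  · have li₁ : LinearIndependent ℝ ![((1 : ℝ), (0 : ℝ)), (V.y₁ B * V.l₁, V.l₁)] := by
      rw [LinearIndependent.pair_iff]
      intro s t h
      simp only [Prod.smul_mk, Prod.mk_add_mk, Prod.mk_eq_zero, smul_eq_mul] at h
      have ht : t = 0 := by simpa [hl₁.ne'] using h.2
      rw [ht] at h
      exact ⟨by simpa using h.1, ht⟩
    have li₂ : LinearIndependent ℝ ![((1 : ℝ), (0 : ℝ)), (-V.y₂ B * V.l₂, V.l₂)] := by
      rw [LinearIndependent.pair_iff]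
      intro s t h
      simp only [Prod.smul_mk, Prod.mk_add_mk, Prod.mk_eq_zero, smul_eq_mul] at h
      have ht : t = 0 := by simpa [hl₂.ne'] using h.2
      rw [ht] at h
      exact ⟨by simpa using h.1, ht⟩
    refine ⟨_, _, _, _, _, _, _, _, _, hc, li₁, li₂, Or.inl fun t₁ t₂ => ?_⟩
    have e₁ : lineParam ((1 : ℝ), (0 : ℝ)) (V.y₁ B * V.l₁, V.l₁) t₁ =
        (V.g₁ B t₁, V.l₁ * t₁) := by
      simp only [lineParam, g₁, Prod.smul_mk, Prod.mk_add_mk, smul_eq_mul, Prod.mk.injEq]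
      constructor <;> ring
    have e₂ : lineParam ((1 : ℝ), (0 : ℝ)) (-V.y₂ B * V.l₂, V.l₂) t₂ =
        (V.g₂ B t₂, V.l₂ * t₂) := by
      simp only [lineParam, g₂, Prod.smul_mk, Prod.mk_add_mk, smul_eq_mul, Prod.mk.injEq]
      constructor <;> ring
    have n₁ := lineParam_ne_zero li₁ t₁
    have n₂ := lineParam_ne_zero li₂ t₂
    have hP : V.P B t₁ t₂ = cartesianHom (pt V.x) (V.T₁ B) (V.T₂ B) (V.Z B)
        (V.g₁ B t₁, V.l₁ * t₁) (V.g₂ B t₂, V.l₂ * t₂) := by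
      rw [V.P_eq hk, hd, cartesianHom]; congr 1 <;> ring
    rw [e₁] at n₁
    rw [e₂] at n₂
    rw [e₁, e₂]
    have n₁' : V.g₁ B t₁ = 0 → V.l₁ * t₁ ≠ 0 := fun h1 h2 => n₁ (Prod.ext h1 h2)
    have n₂' : V.g₂ B t₂ = 0 → V.l₂ * t₂ ≠ 0 := fun h1 h2 => n₂ (Prod.ext h1 h2)
    by_cases h₁ : V.g₁ B t₁ = 0
    · rw [cartesianPoint, if_pos (by simp [h₁])]
      -- With both coordinates infinite P vanishes, and the substitute E₁ in `patch` is a multiple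
      -- of Z, as `cartesianPoint` requires.
      by_cases h₂ : V.g₂ B t₂ = 0
      · have hP0 : V.P B t₁ t₂ = 0 := by rw [hP]; simp [cartesianHom, comb, h₁, h₂]
        have hE : V.E₁ B t₁ = (V.l₁ * t₁) ^ 2 • V.Z B := by
          rw [E₁_eq]; simp [comb, h₁]
        change V.patch B t₁ t₂ = _
        rw [patch, if_pos hk, if_pos hP0, hE]
        nth_rewrite 1 [hb1]
        rw [span_pair_smul hb0 (pow_ne_zero 2 (n₁' h₁))]
      · have hne := mul_ne_zero (pow_ne_zero 2 h₂) (pow_ne_zero 2 (n₁' h₁))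
        refine (V.span_eq_patch hk hb0 hb1 (inv_ne_zero hne) ?_ hc.qinf_ne_zero).symm
        rw [hP, cartesianHom, comb]
        simp only [h₁, ne_eq, OfNat.ofNat_ne_zero, not_false_eq_true, zero_pow, zero_mul,
          zero_smul, mul_zero, add_zero, zero_add]
        rw [smul_smul, inv_mul_cancel₀ hne, one_smul]
    · by_cases h₂ : V.g₂ B t₂ = 0
      · rw [cartesianPoint, if_pos (by simp [h₂])]
        have hne := mul_ne_zero (pow_ne_zero 2 h₁) (pow_ne_zero 2 (n₂' h₂))
        refine (V.span_eq_patch hk hb0 hb1 (inv_ne_zero hne) ?_ hc.qinf_ne_zero).symm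
        rw [hP, cartesianHom, comb]
        simp only [h₂, ne_eq, OfNat.ofNat_ne_zero, not_false_eq_true, zero_pow, zero_mul,
          zero_smul, mul_zero, add_zero, zero_add]
        rw [smul_smul, inv_mul_cancel₀ hne, one_smul]
      · have hne := mul_ne_zero (pow_ne_zero 2 h₁) (pow_ne_zero 2 h₂)
        have hc1 := cartesianHom_eq_smul (pt V.x) (V.T₁ B) (V.T₂ B) (V.Z B)
          (u := (V.g₁ B t₁, V.l₁ * t₁)) (v := (V.g₂ B t₂, V.l₂ * t₂)) h₁ h₂
        refine (V.span_eq_patch hk hb0 hb1 (inv_ne_zero hne) ?_ ?_).symm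
        · rw [hP, hc1, smul_smul, inv_mul_cancel₀ hne, one_smul]
        · intro h0
          rw [h0, smul_zero] at hc1
          exact hc.comb_ne_zero (by simp [h₁, h₂]) hc1
  · set c := √(V.disc B) with hcd
    have hc0 : c ≠ 0 := (Real.sqrt_pos.2 hd).ne'
    have hc2 : V.disc B = c ^ 2 := by rw [Real.sq_sqrt hd.le]
    have li₂ : LinearIndependent ℝ ![((1 : ℝ), (0 : ℝ)), (-V.y₂ B * V.l₂, c * V.l₂)] := by
      rw [LinearIndependent.pair_iff]
      intro s t h
      simp only [Prod.smul_mk, Prod.mk_add_mk, Prod.mk_eq_zero, smul_eq_mul] at h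
      have ht : t = 0 := by simpa [hc0, hl₂.ne'] using h.2
      rw [ht] at h
      exact ⟨by simpa using h.1, ht⟩
    have li₁ : LinearIndependent ℝ ![((1 : ℝ), (1 : ℝ)),
        (V.y₁ B * V.l₁ + c * V.l₁, V.y₁ B * V.l₁ - c * V.l₁)] := by
      rw [LinearIndependent.pair_iff]
      intro s t h
      simp only [Prod.smul_mk, Prod.mk_add_mk, Prod.mk_eq_zero, smul_eq_mul] at h
      have ht : t * (c * V.l₁) = 0 := by linear_combination (1 / 2) * (h.1 - h.2)
      have ht : t = 0 := by simpa [hc0, hl₁.ne'] using ht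
      rw [ht] at h
      exact ⟨by simpa using h.1, ht⟩
    refine ⟨_, _, _, _, _, _, _, _, _, hc.polar₁ hc0, li₁, li₂, Or.inr (Or.inl fun t₁ t₂ => ?_)⟩
    refine (V.span_eq_patch hk hb0 hb1 (κ := 2 * c) (by positivity) ?_
      ((hc.polar₁ hc0).polarPoint_ne_zero (lineParam_ne_zero li₁ _)
        (lineParam_ne_zero li₂ _))).symm
    have e₂ : lineParam ((1 : ℝ), (0 : ℝ)) (-V.y₂ B * V.l₂, c * V.l₂) t₂ =
        (V.g₂ B t₂, c * (V.l₂ * t₂)) := by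
      simp only [lineParam, g₂, Prod.smul_mk, Prod.mk_add_mk, smul_eq_mul, Prod.mk.injEq]
      constructor <;> ring
    have e₁ : lineParam ((1 : ℝ), (1 : ℝ))
        (V.y₁ B * V.l₁ + c * V.l₁, V.y₁ B * V.l₁ - c * V.l₁) t₁ =
        (V.g₁ B t₁ + c * (V.l₁ * t₁), V.g₁ B t₁ - c * (V.l₁ * t₁)) := by
      simp only [lineParam, g₁, Prod.smul_mk, Prod.mk_add_mk, smul_eq_mul, Prod.mk.injEq]
      constructor <;> ring
    rw [e₁, e₂, comb_polar₁ _ _ _ _ hc0, V.P_eq hk, hc2]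
    congr 2; ring

end CircularQuad

/-! ## Changes of parameters -/

theorem orderIso_zero (φ : I ≃o I) : φ 0 = 0 := by
  have h : φ 0 ≤ 0 := by rw [← φ.le_symm_apply]; exact (φ.symm 0).2.1
  exact le_antisymm h (φ 0).2.1

theorem orderIso_one (φ : I ≃o I) : φ 1 = 1 := by
  have h : 1 ≤ φ 1 := by rw [← φ.symm_apply_le]; exact (φ.symm 1).2.2
  exact le_antisymm (φ 1).2.2 h

theorem HasVertices.comp {L : I → I → Submodule ℝ LieVec} {x x₁ x₁₂ x₂ : E3}
    (h : HasVertices L x x₁ x₁₂ x₂) (φ ψ : I ≃o I) :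
    HasVertices (fun t₁ t₂ => L (φ t₁) (ψ t₂)) x x₁ x₁₂ x₂ := by
  simpa only [HasVertices, orderIso_zero, orderIso_one] using h

theorem HasInitialTangent.comp {c : I → Submodule ℝ LieVec} {x t : E3}
    (h : HasInitialTangent c x t) (φ : I ≃o I) : HasInitialTangent (fun u => c (φ u)) x t := by
  obtain ⟨p, hp, ht⟩ := h
  have hφ : Tendsto φ (𝓝[>] 0) (𝓝[>] 0) := by
    apply tendsto_nhdsWithin_of_tendsto_nhds_of_eventually_within
    · have := φ.continuous.tendsto 0
      rw [orderIso_zero] at this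
      exact this.mono_left nhdsWithin_le_nhds
    · filter_upwards [self_mem_nhdsWithin] with u hu
      have := φ.strictMono hu
      rwa [orderIso_zero] at this
  exact ⟨p ∘ φ, hφ.eventually hp, ht.comp hφ⟩

theorem HasVertexFrame.comp {L : I → I → Submodule ℝ LieVec} {x : E3} {B : OrthonormalFrame}
    (h : HasVertexFrame L x B) (φ ψ : I ≃o I) :
    HasVertexFrame (fun t₁ t₂ => L (φ t₁) (ψ t₂)) x B := by
  refine ⟨?_, ?_, ?_⟩
  · have := h.1.comp φ
    simpa only [orderIso_zero] using this
  · have := h.2.1.comp ψ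
    simpa only [orderIso_zero] using this
  · simpa only [orderIso_zero] using h.2.2

theorem HasVertexFrame.of_comp {L : I → I → Submodule ℝ LieVec} {x : E3} {B : OrthonormalFrame}
    (φ ψ : I ≃o I) (h : HasVertexFrame (fun t₁ t₂ => L (φ t₁) (ψ t₂)) x B) :
    HasVertexFrame L x B := by
  simpa using h.comp φ.symm ψ.symm

/-! ## Tangents of arcs -/

/-- The point of an arc as a vector of `ℝ³`. -/
def arcPoint (x z t : E3) (u : ℝ) : E3 := (arc x z t u).2.1⁻¹ • (arc x z t u).1

theorem continuous_arc (x z t : E3) : Continuous (arc x z t) := by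
  unfold arc quad; fun_prop

theorem lieForm_arc (x z t : E3) (h : x ≠ z) (ht : ‖t‖ = 1) (u : ℝ) :
    lieForm (arc x z t u) (arc x z t u) = 0 := by
  simp only [arc, quad, map_add, map_smul, LinearMap.add_apply, LinearMap.smul_apply, smul_eq_mul,
    lieForm_pt_self, lieForm_arcMid_self ht, lieForm_arcMid_left, lieForm_arcMid_right h,
    lieForm_pt_arcMid, lieForm_comm (pt z) (pt x)]
  ring

theorem eq_smul_pt {v : LieVec} (hr : rCoord v = 0) (hv : lieForm v v = 0) (h0 : v.2.1 ≠ 0) :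
    v = v.2.1 • pt (v.2.1⁻¹ • v.1) := by
  obtain ⟨u, α, β, ρ⟩ := v
  simp only [rCoord] at hr h0
  subst hr
  simp only [lieForm_apply, real_inner_self_eq_norm_sq] at hv
  simp only [pt, Prod.smul_mk, smul_smul, mul_inv_cancel₀ h0, one_smul, smul_eq_mul, mul_one,
    mul_zero, norm_smul, norm_inv, mul_pow, Real.norm_eq_abs, sq_abs, inv_pow, Prod.mk.injEq,
    true_and, and_true]
  field_simp
  linarith

theorem arc_eventually_pos (x z t : E3) : ∀ᶠ u : I in 𝓝[>] (0 : I), 0 < (arc x z t u).2.1 := by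
  have hc : Continuous fun u : I => (arc x z t u).2.1 :=
    (continuous_fst.comp continuous_snd).comp ((continuous_arc x z t).comp continuous_subtype_val)
  have h0 : 0 < (arc x z t (0 : I)).2.1 := by simp [arc, pt]
  exact nhdsWithin_le_nhds (hc.continuousAt.eventually (lt_mem_nhds h0))

theorem tendsto_arcPoint (x z t : E3) (h : x ≠ z) (ht : ‖t‖ = 1) :
    Tendsto (fun u : I => ‖arcPoint x z t u - x‖⁻¹ • (arcPoint x z t u - x)) (𝓝[>] (0 : I))
      (𝓝 t) := by
  have hn : ‖z - x‖ ≠ 0 := norm_ne_zero_iff.2 (sub_ne_zero.2 h.symm)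
  -- Up to a positive factor, w is the secant vector from x to the arc point: the factor u that
  -- vanishes at the start has been divided out.
  set w : I → E3 := fun u => ((1 - u : ℝ) * ‖z - x‖) • t + (u : ℝ) • (z - x) with hw
  have hwc : Continuous w := by fun_prop
  have hw0 : w 0 = ‖z - x‖ • t := by simp [hw]
  have hlim : Tendsto (fun u => ‖w u‖⁻¹ • w u) (𝓝[>] (0 : I)) (𝓝 t) := by
    have h1 : ContinuousAt (fun u => ‖w u‖⁻¹ • w u) 0 := by
      refine ContinuousAt.smul (f := fun u => ‖w u‖⁻¹) ?_ hwc.continuousAt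
      apply ContinuousAt.inv₀ hwc.norm.continuousAt
      rw [hw0]; simp [norm_smul, ht, sub_ne_zero.2 h.symm]
    have h2 : ‖w 0‖⁻¹ • w 0 = t := by
      rw [hw0, norm_smul, ht, norm_norm, mul_one, smul_smul, inv_mul_cancel₀ hn, one_smul]
    have := h1.tendsto
    simp only [h2] at this
    exact this.mono_left nhdsWithin_le_nhds
  refine hlim.congr' ?_
  filter_upwards [arc_eventually_pos x z t, self_mem_nhdsWithin] with u hu hu0
  have hu0' : (0 : ℝ) < u := hu0
  have e : arcPoint x z t u - x = ((arc x z t u).2.1⁻¹ * u) • w u := by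
    have h1 : (arc x z t u).1 = (u : ℝ) • w u + (arc x z t u).2.1 • x := by
      simp only [arc, quad, pt, arcMid, tangentVec, hw, Prod.fst_add, Prod.snd_add, Prod.smul_fst,
        Prod.smul_snd, smul_eq_mul]
      module
    rw [arcPoint, h1, smul_add, smul_smul, smul_smul, inv_mul_cancel₀ hu.ne', one_smul,
      add_sub_cancel_right]
  have hpos : 0 < (arc x z t u).2.1⁻¹ * u := mul_pos (inv_pos.2 hu) hu0'
  rw [e, norm_smul, Real.norm_eq_abs, abs_of_pos hpos, smul_smul, mul_inv, mul_right_comm,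
    inv_mul_cancel₀ hpos.ne', one_mul]

theorem hasInitialTangent_arc {c : I → Submodule ℝ LieVec} {x z t : E3} (h : x ≠ z)
    (ht : ‖t‖ = 1) (hc : ∀ u : I, arc x z t u ∈ c u) : HasInitialTangent c x t := by
  refine ⟨fun u => arcPoint x z t u, ?_, tendsto_arcPoint x z t h ht⟩
  filter_upwards [arc_eventually_pos x z t] with u hu
  have := eq_smul_pt (rCoord_arc x z t u) (lieForm_arc x z t h ht u) hu.ne'
  rw [IsPointOf, pointSphere_coe]
  have h2 : pt (arcPoint x z t u) = (arc x z t u).2.1⁻¹ • arc x z t u := by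
    rw [arcPoint, eq_inv_smul_iff₀ hu.ne']
    exact this.symm
  rw [h2]
  exact Submodule.smul_mem _ _ (hc u)

instance nhdsGT_zero_neBot : (𝓝[>] (0 : I)).NeBot := by
  apply nhdsGT_neBot_of_exists_gt ⟨1, by simp⟩

/-- Near the start the contact elements contain no finite point other than that of the arc, so every
admissible choice of points eventually agrees with `arcPoint`. -/
theorem HasInitialTangent.eq_of_arc {c : I → Submodule ℝ LieVec} {x z t t' : E3} (h : x ≠ z)
    (ht : ‖t‖ = 1) (hc : ∀ u : I, ∀ p : E3, pt p ∈ c u → ∃ r : ℝ, pt p = r • arc x z t u)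
    (h' : HasInitialTangent c x t') : t' = t := by
  obtain ⟨p, hp, hlim⟩ := h'
  refine tendsto_nhds_unique (hlim.congr' ?_) (tendsto_arcPoint x z t h ht)
  filter_upwards [hp, arc_eventually_pos x z t] with u hu hpos
  obtain ⟨r, hr⟩ := hc u (p u) hu
  have h1 : 1 = r * (arc x z t u).2.1 := congrArg (fun v : LieVec => v.2.1) hr
  have h2 : p u = r • (arc x z t u).1 := congrArg (fun v : LieVec => v.1) hr
  have h3 : r = (arc x z t u).2.1⁻¹ := eq_inv_of_mul_eq_one_left h1.symm
  have h4 : p u = arcPoint x z t u := by rw [h2, h3, arcPoint]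
  rw [h4]

/-- The plane is the only vector of the contact element with e₀-component 0 and e_r-component 1, so
the normal can be read off. -/
theorem contactElement_injective {x n n' : E3} (h : contactElement x n = contactElement x n') :
    n = n' := by
  have h1 : tangentPlane x n ∈ contactElement x n' := by
    rw [← h, contactElement_eq]; exact Submodule.subset_span (by simp)
  rw [contactElement_eq] at h1
  obtain ⟨a, b, hab⟩ := Submodule.mem_span_pair.1 h1
  have e1 := congrArg (fun v : LieVec => v.2.1) hab
  have e2 := congrArg rCoord hab
  have e3 := congrArg (fun v : LieVec => v.1) hab
  simp [pt, tangentPlane, orientedPlane] at e1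
  simp at e2
  simp [e1, e2, pt, tangentPlane, orientedPlane] at e3
  exact e3.symm

/-! ### The correspondence between patches and frames -/

namespace CircularQuad
variable (V : CircularQuad) (B : OrthonormalFrame)

theorem E₂_ne_zero (t : I) : V.E₂ B t ≠ 0 := by
  have hx := V.neg₂.ne
  intro h
  have h1 := congrArg (lieForm (pt V.x)) h
  have h2 := congrArg (lieForm (pt V.x₂)) h
  simp only [E₂, quad, map_add, map_smul, smul_eq_mul, lieForm_pt_self, map_zero,
    lieForm_comm (pt V.x) (V.mid₂ B), lieForm_comm (pt V.x₂) (V.mid₂ B), lieForm_mid₂_x,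
    lieForm_mid₂_x₂, lieForm_comm (pt V.x₂) (pt V.x), mul_zero, add_zero, zero_add,
    mul_eq_zero, hx, or_false, ne_eq, OfNat.ofNat_ne_zero, not_false_eq_true,
    pow_eq_zero_iff] at h1 h2
  rw [h1] at h2; norm_num at h2

/-- The points of the patch. -/
theorem P_mem_patch (t₁ t₂ : ℝ) : V.P B t₁ t₂ ∈ V.patch B t₁ t₂ := by
  rw [patch]
  split_ifs with hk hP
  · rw [hP]; exact Submodule.zero_mem _
  · exact Submodule.subset_span (by simp)
  · have : V.P B t₁ t₂ = (V.k B)⁻¹ • (V.Q₂ B t₂ • V.s₁ B t₁ - V.Q₁ B t₁ • V.s₂ B t₂) := by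
      rw [← k_smul_P, smul_smul, inv_mul_cancel₀ hk, one_smul]
    rw [this]
    exact Submodule.smul_mem _ _ (Submodule.sub_mem _
      (Submodule.smul_mem _ _ (Submodule.subset_span (by simp)))
      (Submodule.smul_mem _ _ (Submodule.subset_span (by simp))))

/-- A contact element of the patch has no other points. -/
theorem eq_smul_P {t₁ t₂ : ℝ} (hP : V.P B t₁ t₂ ≠ 0) {v : LieVec} (hr : rCoord v = 0)
    (hv : v ∈ V.patch B t₁ t₂) (hQ : V.Q₁ B t₁ ≠ 0 ∨ V.Q₂ B t₂ ≠ 0) :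
    ∃ r : ℝ, v = r • V.P B t₁ t₂ := by
  rw [patch] at hv
  split_ifs at hv with hk
  · obtain ⟨α, β, rfl⟩ := Submodule.mem_span_pair.1 hv
    have : α = 0 := by simpa using hr
    exact ⟨β, by simp [this]⟩
  · obtain ⟨α, β, rfl⟩ := Submodule.mem_span_pair.1 hv
    have h1 : α * V.Q₁ B t₁ + β * V.Q₂ B t₂ = 0 := by simpa using hr
    rcases hQ with hQ | hQ
    · refine ⟨-β / V.Q₁ B t₁ * V.k B, ?_⟩
      have : α = -β / V.Q₁ B t₁ * V.Q₂ B t₂ := by field_simp; linarith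
      rw [mul_smul, k_smul_P, this, smul_sub, smul_smul, smul_smul]
      have : -β / V.Q₁ B t₁ * V.Q₁ B t₁ = -β := by field_simp
      rw [this]; module
    · refine ⟨α / V.Q₂ B t₂ * V.k B, ?_⟩
      have : β = -(α / V.Q₂ B t₂ * V.Q₁ B t₁) := by field_simp; linarith
      rw [mul_smul, k_smul_P, this, smul_sub, smul_smul, smul_smul]
      have : α / V.Q₂ B t₂ * V.Q₂ B t₂ = α := by field_simp
      rw [this]; module

theorem patch_zero_zero : V.patch B 0 0 = contactElement V.x (B.1 2) := by
  rw [contactElement_eq]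
  have hX : pt V.x ∈ V.patch B 0 0 := by simpa using V.P_mem_patch B 0 0
  apply le_antisymm
  · have hX' : pt V.x ∈ Submodule.span ℝ {pt V.x, tangentPlane V.x (B.1 2)} :=
      Submodule.subset_span (by simp)
    have hN : tangentPlane V.x (B.1 2) ∈ Submodule.span ℝ {pt V.x, tangentPlane V.x (B.1 2)} :=
      Submodule.subset_span (by simp)
    have ha : V.a B ∈ Submodule.span ℝ {pt V.x, tangentPlane V.x (B.1 2)} :=
      Submodule.add_mem _ hN (Submodule.smul_mem _ _ hX')
    have hb : V.b B ∈ Submodule.span ℝ {pt V.x, tangentPlane V.x (B.1 2)} :=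
      Submodule.add_mem _ hN (Submodule.smul_mem _ _ hX')
    rw [patch]
    split_ifs with hk hP
    · exact absurd hP (by simp [pt_ne_zero])
    · rw [Submodule.span_le]
      rintro v (rfl | rfl)
      exacts [hb, by simpa using hX']
    · rw [Submodule.span_le]
      rintro v (rfl | rfl)
      · simpa [s₁] using Submodule.add_mem _ hb (Submodule.smul_mem _ _ hX')
      · simpa [s₂] using Submodule.sub_mem _ ha (Submodule.smul_mem _ _ hX')
  · have hb : V.b B ∈ V.patch B 0 0 := by
      rw [patch]
      by_cases hk : V.k B = 0
      · rw [if_pos hk]; exact Submodule.subset_span (by simp)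
      · have : V.s₂ B 0 = V.b B := by simp [s₂, a_eq]
        rw [if_neg hk, ← this]; exact Submodule.subset_span (by simp)
    rw [Submodule.span_le]
    rintro v (rfl | rfl)
    · exact hX
    · have : tangentPlane V.x (B.1 2) =
          V.b B - (2 * inner ℝ (B.1 2) (invVec V.x V.x₁)) • pt V.x := by rw [b]; abel
      rw [this]
      exact Submodule.sub_mem _ hb (Submodule.smul_mem _ _ hX)

theorem hasVertices_patch :
    HasVertices (fun t₁ t₂ : I => V.patch B t₁ t₂) V.x V.x₁ V.x₁₂ V.x₂ := by
  simp only [HasVertices, IsPointOf, pointSphere_coe, Set.Icc.coe_zero, Set.Icc.coe_one]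
  refine ⟨by simpa using V.P_mem_patch B 0 0, by simpa using V.P_mem_patch B 1 0, ?_,
    by simpa using V.P_mem_patch B 0 1⟩
  have h := V.P_mem_patch B 1 1
  rw [P_one_one] at h
  exact (Submodule.smul_mem_iff _ V.c_ne).1 h

theorem hasVertexFrame_patch : HasVertexFrame (fun t₁ t₂ : I => V.patch B t₁ t₂) V.x B := by
  refine ⟨hasInitialTangent_arc V.ne₁ (B.norm_eq 0) fun u => ?_,
    hasInitialTangent_arc V.ne₂ (B.norm_eq 1) fun u => ?_, by simpa using V.patch_zero_zero B⟩
  · have := V.P_mem_patch B u 0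
    rwa [P_left] at this
  · have := V.P_mem_patch B 0 u
    rwa [P_bot] at this

variable {B} in
-- Along each of the two boundary arcs at x one weight equals 1, so `eq_smul_P` applies and the
-- points are exactly those of the arc.
theorem eq_of_hasVertexFrame_patch {B' : OrthonormalFrame}
    (h : HasVertexFrame (fun t₁ t₂ : I => V.patch B t₁ t₂) V.x B') : B' = B := by
  obtain ⟨h1, h2, h3⟩ := h
  have e1 : B'.1 0 = B.1 0 := by
    refine HasInitialTangent.eq_of_arc V.ne₁ (B.norm_eq 0) (fun u p hp => ?_) h1
    have := V.eq_smul_P B (t₁ := u) (t₂ := 0) (by simpa using V.E₁_ne_zero B u) (rCoord_pt p)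
      (by simpa using hp) (by simp)
    rwa [P_left] at this
  have e2 : B'.1 1 = B.1 1 := by
    refine HasInitialTangent.eq_of_arc V.ne₂ (B.norm_eq 1) (fun u p hp => ?_) h2
    have := V.eq_smul_P B (t₁ := 0) (t₂ := u) (by simpa using V.E₂_ne_zero B u) (rCoord_pt p)
      (by simpa using hp) (by simp)
    rwa [P_bot] at this
  have e3 : B'.1 2 = B.1 2 := by
    simp only [Set.Icc.coe_zero, patch_zero_zero] at h3
    exact (contactElement_injective h3).symm
  apply Subtype.ext
  funext i
  fin_cases i <;> assumption

theorem exists_patch {L : I → I → Submodule ℝ LieVec} (hL : IsCyclidicPatch L)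
    (hV : HasVertices L V.x V.x₁ V.x₁₂ V.x₂) :
    ∃ (B : OrthonormalFrame) (φ ψ : I ≃o I), ∀ t₁ t₂ : I, L t₁ t₂ = V.patch B (φ t₁) (ψ t₂) := by
  rcases hL with hL | hL
  · obtain ⟨B, l, m, hl, hm, h⟩ := V.exists_patch_of_isProperPatch hL hV
    exact ⟨B, repIso l hl, repIso m hm, h⟩
  · obtain ⟨B, l, m, hl, hm, -, h⟩ := V.exists_patch_of_isSphericalPatch hL hV
    exact ⟨B, repIso l hl, repIso m hm, h⟩

theorem isCyclidicPatch_patch : IsCyclidicPatch fun t₁ t₂ : I => V.patch B t₁ t₂ := by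
  by_cases hk : V.k B = 0
  · exact Or.inr (V.isSphericalPatch_patch hk)
  · left
    have := V.isProperPatch_rep B hk one_pos one_pos
    simpa [rep, repDen] using this

/-- The parametrized patch of a frame. -/
def paramPatch : ParamPatch V.x V.x₁ V.x₁₂ V.x₂ :=
  ⟨fun t₁ t₂ => V.patch B t₁ t₂, V.isCyclidicPatch_patch B, V.hasVertices_patch B⟩

theorem exists_frame_of_paramPatch (L : ParamPatch V.x V.x₁ V.x₁₂ V.x₂) :
    ∃ B : OrthonormalFrame, patchSetoid _ _ _ _ (V.paramPatch B) L ∧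
      ∀ B', HasVertexFrame L.1 V.x B' ↔ B' = B := by
  obtain ⟨B, φ, ψ, h⟩ := V.exists_patch L.2.1 L.2.2
  refine ⟨B, ⟨φ, ψ, h⟩, fun B' => ?_⟩
  have e : L.1 = fun t₁ t₂ => (fun t₁ t₂ : I => V.patch B t₁ t₂) (φ t₁) (ψ t₂) := by
    funext t₁ t₂; exact h t₁ t₂
  rw [e]
  constructor
  · intro h'
    exact V.eq_of_hasVertexFrame_patch (h'.of_comp φ ψ)
  · rintro rfl
    exact (V.hasVertexFrame_patch B').comp φ ψ

/-- Frames are invariant under increasing reparametrization, so the frame descends to the quotient.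
It is injective because each patch is equivalent to the patch built from its frame, and surjective
because that construction realizes every frame. -/
theorem exists_equiv : ∃ Φ : CyclidicPatch V.x V.x₁ V.x₁₂ V.x₂ ≃ OrthonormalFrame,
    ∀ (L : ParamPatch V.x V.x₁ V.x₁₂ V.x₂) (B : OrthonormalFrame),
      Φ (Quotient.mk (patchSetoid V.x V.x₁ V.x₁₂ V.x₂) L) = B ↔ HasVertexFrame L.1 V.x B := by
  choose f hf hf' using V.exists_frame_of_paramPatch
  have hwd : ∀ L L', patchSetoid V.x V.x₁ V.x₁₂ V.x₂ L L' → f L = f L' := by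
    rintro L L' ⟨φ, ψ, h⟩
    have e : L'.1 = fun t₁ t₂ => L.1 (φ t₁) (ψ t₂) := by funext t₁ t₂; exact h t₁ t₂
    rw [← hf' L', e]
    exact ((hf' L _).2 rfl).comp φ ψ
  let F : CyclidicPatch V.x V.x₁ V.x₁₂ V.x₂ → OrthonormalFrame := Quotient.lift f hwd
  have hF : Function.Bijective F := by
    constructor
    · intro q q'
      induction q using Quotient.inductionOn
      induction q' using Quotient.inductionOn
      rename_i L L'
      intro h
      have h : f L = f L' := h
      apply Quotient.sound
      have h1 := hf L
      rw [h] at h1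
      exact Setoid.trans (Setoid.symm h1) (hf L')
    · intro B
      refine ⟨Quotient.mk _ (V.paramPatch B), ?_⟩
      exact ((hf' _ B).1 (V.hasVertexFrame_patch B)).symm
  refine ⟨Equiv.ofBijective F hF, fun L B => ?_⟩
  rw [hf' L]
  exact eq_comm

end CircularQuad

/-! ## The space of orthonormal frames -/

section Cayley
open Matrix
variable {m : Type*} [Fintype m] [DecidableEq m]

/-- The Cayley transform. -/
def cayley (A : Matrix m m ℝ) : Matrix m m ℝ := (1 - A) * (1 + A)⁻¹

variable {A : Matrix m m ℝ}

theorem one_add_cayley (h : IsUnit (1 + A).det) : 1 + cayley A = (2 : ℝ) • (1 + A)⁻¹ := by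
  nth_rewrite 1 [← mul_nonsing_inv (1 + A) h]
  rw [cayley, ← add_mul, add_add_sub_cancel, ← two_smul ℝ (1 : Matrix m m ℝ), smul_mul, one_mul]

theorem one_sub_cayley (h : IsUnit (1 + A).det) :
    1 - cayley A = (2 : ℝ) • (A * (1 + A)⁻¹) := by
  nth_rewrite 1 [← mul_nonsing_inv (1 + A) h]
  rw [cayley, ← sub_mul, add_sub_sub_cancel, ← two_smul ℝ A, smul_mul]

theorem isUnit_det_one_add_cayley (h : IsUnit (1 + A).det) : IsUnit (1 + cayley A).det := by
  rw [one_add_cayley h, det_smul]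
  exact ((isUnit_iff_ne_zero.2 two_ne_zero).pow _).mul ((isUnit_nonsing_inv_det _ h))

/-- From 1 − cayley A = A (1 + cayley A). The involution exchanges orthogonal matrices without
eigenvalue −1 and skew-symmetric matrices, which turns a neighbourhood of a frame into a vector
space. -/
theorem cayley_cayley (h : IsUnit (1 + A).det) : cayley (cayley A) = A := by
  have h' := isUnit_det_one_add_cayley h
  have e : 1 - cayley A = A * (1 + cayley A) := by
    rw [one_sub_cayley h, one_add_cayley h, Matrix.mul_smul]
  rw [cayley, e, mul_nonsing_inv_cancel_right _ _ h']

theorem transpose_cayley (hA : Aᵀ * A = 1) (h : IsUnit (1 + A).det) :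
    (cayley A)ᵀ = -cayley A := by
  have hT : IsUnit (1 + Aᵀ).det := by rwa [← transpose_one, ← transpose_add, det_transpose]
  have hA' : A * Aᵀ = 1 := mul_eq_one_comm.1 hA
  have e : (1 + Aᵀ) * (A - 1) = (1 - Aᵀ) * (1 + A) := by
    simp only [mul_sub, add_mul, sub_mul, mul_add, hA, mul_one, one_mul]; abel
  have e' : 1 - Aᵀ = (1 + Aᵀ) * -cayley A := by
    rw [cayley, ← neg_mul, neg_sub, ← mul_assoc, e, mul_nonsing_inv_cancel_right _ _ h]
  nth_rewrite 1 [cayley]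
  rw [transpose_mul, transpose_nonsing_inv, transpose_add, transpose_sub, transpose_one, e',
    nonsing_inv_mul_cancel_left _ _ hT]

theorem transpose_mul_cayley (hA : Aᵀ = -A) (h : IsUnit (1 + A).det) :
    (cayley A)ᵀ * cayley A = 1 := by
  have hT : IsUnit (1 - A).det := by
    rwa [sub_eq_add_neg, ← hA, ← transpose_one, ← transpose_add, det_transpose]
  have e : (1 + A) * (1 - A) = (1 - A) * (1 + A) := by
    simp only [mul_sub, add_mul, sub_mul, mul_add, mul_one, one_mul]; abel
  rw [cayley, transpose_mul, transpose_nonsing_inv, transpose_add, transpose_sub, transpose_one,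
    hA, sub_neg_eq_add, ← sub_eq_add_neg, mul_assoc, ← mul_assoc (1 + A), e,
    mul_nonsing_inv_cancel_right _ _ h, nonsing_inv_mul _ hT]

theorem continuousOn_cayley :
    ContinuousOn (cayley : Matrix m m ℝ → Matrix m m ℝ) {A | IsUnit (1 + A).det} := by
  intro A hA
  have hA : (1 + A).det ≠ 0 := isUnit_iff_ne_zero.1 hA
  have h1 : Continuous fun A : Matrix m m ℝ => (1 + A).det := by fun_prop
  have h2 : Continuous fun A : Matrix m m ℝ => (1 - A) * (1 + A).adjugate := by
    fun_prop
  have h3 : ContinuousAt (fun A : Matrix m m ℝ => (1 + A).det⁻¹ • ((1 - A) * (1 + A).adjugate)) A :=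
    (h1.continuousAt.inv₀ hA).smul h2.continuousAt
  have h4 : (cayley : Matrix m m ℝ → Matrix m m ℝ) =
      fun A => (1 + A).det⁻¹ • ((1 - A) * (1 + A).adjugate) := by
    funext A
    rw [cayley, inv_def, Ring.inverse_eq_inv', Matrix.mul_smul]
  rw [h4]
  exact h3.continuousWithinAt

end Cayley

/-- Skew-symmetric matrices. -/
def skew (v : E3) : Matrix (Fin 3) (Fin 3) ℝ :=
  !![0, v 0, v 1; -v 0, 0, v 2; -v 1, -v 2, 0]

theorem transpose_skew (v : E3) : (skew v).transpose = -skew v := by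
  ext i j; fin_cases i <;> fin_cases j <;> simp [skew]

/-- The determinant is 1 + ‖v‖², so the inverse chart is defined on all of ℝ³. -/
theorem isUnit_det_one_add_skew (v : E3) : IsUnit (1 + skew v).det := by
  rw [isUnit_iff_ne_zero, Matrix.det_fin_three]
  simp [skew]
  nlinarith [sq_nonneg (v 0), sq_nonneg (v 1), sq_nonneg (v 2)]

/-- The entries of a skew-symmetric matrix. -/
def unskew (S : Matrix (Fin 3) (Fin 3) ℝ) : E3 := !₂[S 0 1, S 0 2, S 1 2]

theorem unskew_skew (v : E3) : unskew (skew v) = v := by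
  ext i; fin_cases i <;> simp [skew, unskew]

theorem skew_unskew {S : Matrix (Fin 3) (Fin 3) ℝ} (hS : S.transpose = -S) :
    skew (unskew S) = S := by
  have h (i j) : S j i = -S i j := congrFun (congrFun hS i) j
  have h0 (i) : S i i = 0 := by linarith [h i i]
  ext i j; fin_cases i <;> fin_cases j <;> simp [skew, unskew, h0, h 0 1, h 0 2, h 1 2]

namespace OrthonormalFrame
open Matrix

/-- Coordinates of a frame with respect to a given one. -/
def toMatrix (B₀ B : OrthonormalFrame) : Matrix (Fin 3) (Fin 3) ℝ :=
  Matrix.of fun i j => inner ℝ (B₀.1 i) (B.1 j)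

theorem transpose_mul_toMatrix (B₀ B : OrthonormalFrame) :
    (B₀.toMatrix B)ᵀ * B₀.toMatrix B = 1 := by
  ext i j
  rw [mul_apply, Fin.sum_univ_three]
  simp only [toMatrix, transpose_apply, of_apply, B₀.sum_inner_mul_inner]
  rw [one_apply, orthonormal_iff_ite.1 B.2]

theorem continuous_toMatrix (B₀ : OrthonormalFrame) : Continuous B₀.toMatrix := by
  refine continuous_matrix fun i j => ?_
  simp only [toMatrix, of_apply]
  exact continuous_const.inner ((continuous_apply j).comp continuous_subtype_val)

/-- Change of frame by an orthogonal matrix. -/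
def ofMatrix (B₀ : OrthonormalFrame) {M : Matrix (Fin 3) (Fin 3) ℝ} (hM : Mᵀ * M = 1) :
    OrthonormalFrame :=
  ⟨fun j => ∑ i, M i j • B₀.1 i, by
    rw [orthonormal_iff_ite]
    intro j k
    have := congrFun (congrFun hM j) k
    rw [mul_apply, one_apply] at this
    rw [B₀.2.inner_sum, ← this]
    simp⟩

theorem toMatrix_ofMatrix (B₀ : OrthonormalFrame) {M : Matrix (Fin 3) (Fin 3) ℝ}
    (hM : Mᵀ * M = 1) : B₀.toMatrix (B₀.ofMatrix hM) = M := by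
  ext i j
  simp only [toMatrix, ofMatrix, of_apply]
  exact B₀.2.inner_right_fintype _ _

theorem toMatrix_injective (B₀ : OrthonormalFrame) : Function.Injective B₀.toMatrix := by
  intro B B' h
  apply Subtype.ext
  funext j
  have h' (i) : inner ℝ (B₀.1 i) (B.1 j) = inner ℝ (B₀.1 i) (B'.1 j) := congrFun (congrFun h i) j
  rw [← B₀.sum_inner_smul (B.1 j), ← B₀.sum_inner_smul (B'.1 j), h' 0, h' 1, h' 2]

theorem toMatrix_self (B : OrthonormalFrame) : B.toMatrix B = 1 := by
  ext i j
  rw [toMatrix, of_apply, one_apply, orthonormal_iff_ite.1 B.2]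

/-- The Cayley chart of the space of frames centred at a given frame. -/
def chart (B₀ : OrthonormalFrame) : OpenPartialHomeomorph OrthonormalFrame E3 where
  toFun B := unskew (cayley (B₀.toMatrix B))
  invFun v := B₀.ofMatrix (transpose_mul_cayley (transpose_skew v) (isUnit_det_one_add_skew v))
  source := {B | IsUnit (1 + B₀.toMatrix B).det}
  target := Set.univ
  map_source' _ _ := Set.mem_univ _
  map_target' v _ := by
    rw [Set.mem_ofPred_eq, toMatrix_ofMatrix]
    exact isUnit_det_one_add_cayley (isUnit_det_one_add_skew v)
  left_inv' B hB := by
    apply B₀.toMatrix_injective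
    rw [toMatrix_ofMatrix, skew_unskew (transpose_cayley (B₀.transpose_mul_toMatrix B) hB),
      cayley_cayley hB]
  right_inv' v _ := by
    rw [toMatrix_ofMatrix, cayley_cayley (isUnit_det_one_add_skew v), unskew_skew]
  open_source := by
    simp only [isUnit_iff_ne_zero]
    have := B₀.continuous_toMatrix
    exact isOpen_ne_fun (by fun_prop) continuous_const
  open_target := isOpen_univ
  continuousOn_toFun := by
    have h1 : Continuous unskew := by
      refine (PiLp.continuous_toLp 2 _).comp (continuous_pi fun i => ?_)
      fin_cases i <;> simp <;> fun_prop
    exact h1.comp_continuousOn (continuousOn_cayley.comp B₀.continuous_toMatrix.continuousOn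
      fun _ h => h)
  continuousOn_invFun := by
    have h1 : Continuous skew := by
      refine continuous_matrix fun i j => ?_
      fin_cases i <;> fin_cases j <;> simp [skew] <;> fun_prop
    have h2 : Continuous fun v => cayley (skew v) :=
      continuousOn_cayley.comp_continuous h1 isUnit_det_one_add_skew
    refine Continuous.continuousOn (Continuous.subtype_mk (continuous_pi fun j => ?_) _)
    have h3 (i) : Continuous fun v => cayley (skew v) i j := h2.matrix_elem i j
    fun_prop

theorem mem_chart_source (B : OrthonormalFrame) : B ∈ B.chart.source := by
  change IsUnit (1 + B.toMatrix B).det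
  rw [toMatrix_self, ← two_smul ℝ (1 : Matrix (Fin 3) (Fin 3) ℝ), det_smul, det_one, mul_one]
  exact (isUnit_iff_ne_zero.2 two_ne_zero).pow _

end OrthonormalFrame

/-! ## Convergence of points -/

open Classical in
/-- The point with given homogeneous coordinates. -/
def toPoint (v : LieVec) : OnePoint E3 :=
  if v.2.1 = 0 then OnePoint.infty else ((v.2.1⁻¹ • v.1 : E3) : OnePoint E3)

theorem toPoint_smul {c : ℝ} (hc : c ≠ 0) (v : LieVec) : toPoint (c • v) = toPoint v := by
  by_cases h : v.2.1 = 0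
  · simp [toPoint, h]
  · have h' : (c • v).2.1 ≠ 0 := mul_ne_zero hc h
    rw [toPoint, toPoint, if_neg h, if_neg h']
    congr 1
    simp only [Prod.smul_fst, Prod.smul_snd, smul_eq_mul, smul_smul]
    congr 1
    field_simp

theorem eq_of_snd_fst_eq_zero {v : LieVec} (hr : rCoord v = 0) (hv : lieForm v v = 0)
    (h : v.2.1 = 0) : v = v.2.2.1 • (0, 0, 1, 0) := by
  obtain ⟨c, α, β, ρ⟩ := v
  simp only [rCoord] at hr h
  subst hr h
  simp [lieForm_apply] at hv
  simp [hv]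

theorem isPointOf_toPoint {v : LieVec} (hr : rCoord v = 0) (hv : lieForm v v = 0) (h0 : v ≠ 0)
    {L : Submodule ℝ LieVec} (hL : v ∈ L) : IsPointOf (toPoint v) L := by
  by_cases h : v.2.1 = 0
  · rw [toPoint, if_pos h]
    have h1 := eq_of_snd_fst_eq_zero hr hv h
    have h2 : v.2.2.1 ≠ 0 := fun h2 => h0 (by rw [h1, h2, zero_smul])
    rw [h1] at hL
    exact (Submodule.smul_mem_iff _ h2).1 hL
  · rw [toPoint, if_neg h]
    rw [eq_smul_pt hr hv h] at hL
    exact (Submodule.smul_mem_iff _ h).1 hL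

theorem tendsto_toPoint {ι : Type*} {l : Filter ι} {f : ι → LieVec} {v : LieVec}
    (hf : Tendsto f l (𝓝 v)) (h0 : v ≠ 0) (hr : rCoord v = 0) (hv : lieForm v v = 0)
    (hfr : ∀ i, rCoord (f i) = 0) (hfv : ∀ i, lieForm (f i) (f i) = 0) :
    Tendsto (fun i => toPoint (f i)) l (𝓝 (toPoint v)) := by
  have hα : Tendsto (fun i => (f i).2.1) l (𝓝 v.2.1) :=
    ((continuous_fst.comp continuous_snd).tendsto v).comp hf
  have hc : Tendsto (fun i => (f i).1) l (𝓝 v.1) := (continuous_fst.tendsto v).comp hf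
  have hβ : Tendsto (fun i => (f i).2.2.1) l (𝓝 v.2.2.1) :=
    ((continuous_fst.comp (continuous_snd.comp continuous_snd)).tendsto v).comp hf
  by_cases h : v.2.1 = 0
  · have hβ0 : v.2.2.1 ≠ 0 := fun h2 =>
      h0 (by rw [eq_of_snd_fst_eq_zero hr hv h, h2, zero_smul])
    have e : toPoint v = OnePoint.infty := if_pos h
    rw [e, Tendsto, OnePoint.le_nhds_infty]
    intro s _ hs
    obtain ⟨R, hR⟩ := hs.isBounded.exists_norm_le
    -- For finite points the e_∞-component is the e₀-component times the squared norm. The former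
    -- has a nonzero limit and the latter tends to 0, so the points leave every ball of radius R.
    have h1 : Tendsto (fun i => R ^ 2 * |(f i).2.1|) l (𝓝 0) := by
      simpa [h] using hα.abs.const_mul (R ^ 2)
    rw [Filter.mem_map]
    filter_upwards [h1.eventually_lt hβ.abs (abs_pos.2 hβ0)] with i hi
    by_cases hi0 : (f i).2.1 = 0
    · right; simp [toPoint, hi0]
    · left
      refine ⟨(f i).2.1⁻¹ • (f i).1, fun hmem => ?_, (if_neg hi0).symm⟩
      have h2 := hR _ hmem
      have h3 : (f i).2.2.1 = (f i).2.1 * ‖(f i).2.1⁻¹ • (f i).1‖ ^ 2 :=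
        congrArg (fun v : LieVec => v.2.2.1) (eq_smul_pt (hfr i) (hfv i) hi0)
      rw [h3, abs_mul, abs_pow, abs_norm, mul_comm (R ^ 2)] at hi
      have h4 : ‖(f i).2.1⁻¹ • (f i).1‖ ^ 2 ≤ R ^ 2 := pow_le_pow_left₀ (norm_nonneg _) h2 2
      exact absurd hi (not_lt.2 (by gcongr))
  · have e : toPoint v = ((v.2.1⁻¹ • v.1 : E3) : OnePoint E3) := if_neg h
    rw [e]
    have h1 : Tendsto (fun i => (f i).2.1⁻¹ • (f i).1) l (𝓝 (v.2.1⁻¹ • v.1)) := (hα.inv₀ h).smul hc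
    refine ((OnePoint.continuous_coe.tendsto _).comp h1).congr' ?_
    filter_upwards [hα.eventually_ne h] with i hi
    simp [toPoint, hi]

namespace CircularQuad
variable (V : CircularQuad) (B : OrthonormalFrame)

theorem lieForm_E₁_E₁ (t : ℝ) : lieForm (V.E₁ B t) (V.E₁ B t) = 0 :=
  lieForm_arc _ _ _ V.ne₁ (B.norm_eq 0) t

theorem lieForm_E₂_E₂ (t : ℝ) : lieForm (V.E₂ B t) (V.E₂ B t) = 0 :=
  lieForm_arc _ _ _ V.ne₂ (B.norm_eq 1) t

theorem lieForm_E₁_x (t : ℝ) : lieForm (V.E₁ B t) (pt V.x) = t ^ 2 * lieForm (pt V.x) (pt V.x₁) := by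
  simp [E₁, quad, lieForm_mid₁_x, lieForm_comm (pt V.x₁)]

theorem lieForm_E₂_x (t : ℝ) : lieForm (V.E₂ B t) (pt V.x) = t ^ 2 * lieForm (pt V.x) (pt V.x₂) := by
  simp [E₂, quad, lieForm_mid₂_x, lieForm_comm (pt V.x₂)]

/-- Combines `lieForm_rel` with the definition of the weights. It is the identity that makes P
isotropic for every frame, including k = 0. -/
theorem lieForm_E₁_E₂ (t₁ t₂ : ℝ) : lieForm (V.E₁ B t₁) (V.E₂ B t₂) =
    V.Q₁ B t₁ * lieForm (V.E₂ B t₂) (pt V.x) + V.Q₂ B t₂ * lieForm (V.E₁ B t₁) (pt V.x) := by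
  rw [lieForm_E₁_x, lieForm_E₂_x]
  simp only [E₁, E₂, Q₁, Q₂, quad, map_add, map_smul, LinearMap.add_apply, LinearMap.smul_apply,
    smul_eq_mul, lieForm_pt_self, lieForm_mid₁_x, lieForm_mid₁_x₂, lieForm_mid₁_mid₂,
    lieForm_comm (pt _) (V.mid₂ B), lieForm_mid₂_x, lieForm_mid₂_x₁, lieForm_comm (pt V.x₁) (pt V.x),
    V.lieForm_rel]
  ring

theorem lieForm_P_P (t₁ t₂ : ℝ) : lieForm (V.P B t₁ t₂) (V.P B t₁ t₂) = 0 := by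
  simp only [P, map_add, map_sub, map_smul, LinearMap.add_apply, LinearMap.sub_apply,
    LinearMap.smul_apply, smul_eq_mul, lieForm_pt_self, lieForm_E₁_E₁, lieForm_E₂_E₂,
    lieForm_comm (V.E₂ B t₂) (V.E₁ B t₁), lieForm_comm (pt V.x) (V.E₁ B t₁),
    lieForm_comm (pt V.x) (V.E₂ B t₂), lieForm_E₁_E₂]
  ring

variable {B} in
-- Pairing P with E₁ and E₂ gives Q₁²⟨E₂, x⟩ and Q₂²⟨E₁, x⟩. If neither weight vanished, both
-- parameters would be 0, where P = x ≠ 0.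
theorem Q_eq_zero_of_P_eq_zero {t₁ t₂ : I} (h : V.P B t₁ t₂ = 0) :
    V.Q₁ B t₁ = 0 ∧ V.Q₂ B t₂ = 0 := by
  by_cases h₁ : V.Q₁ B t₁ = 0
  · refine ⟨h₁, ?_⟩
    simpa [P, h₁, E₁_ne_zero] using h
  · by_cases h₂ : V.Q₂ B t₂ = 0
    · simp [P, h₁, h₂, E₂_ne_zero] at h
    · exfalso
      have e1 := congrArg (lieForm (V.E₁ B t₁)) h
      have e2 := congrArg (lieForm (V.E₂ B t₂)) h
      simp only [P, map_add, map_sub, map_smul, smul_eq_mul, lieForm_E₁_E₁, lieForm_E₂_E₂,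
        lieForm_comm (V.E₂ B t₂) (V.E₁ B t₁), map_zero, lieForm_E₁_E₂] at e1 e2
      have z2 : lieForm (V.E₂ B t₂) (pt V.x) = 0 := by
        apply mul_left_cancel₀ (mul_ne_zero h₁ h₁)
        linear_combination e1
      have z1 : lieForm (V.E₁ B t₁) (pt V.x) = 0 := by
        apply mul_left_cancel₀ (mul_ne_zero h₂ h₂)
        linear_combination e2
      rw [lieForm_E₁_x] at z1
      rw [lieForm_E₂_x] at z2
      have t1 : (t₁ : ℝ) = 0 := by simpa [V.neg₁.ne] using z1
      have t2 : (t₂ : ℝ) = 0 := by simpa [V.neg₂.ne] using z2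
      rw [t1, t2] at h
      simp [pt_ne_zero] at h

open Classical in
/-- Homogeneous coordinates of the points of the patch. -/
def pointVec (t₁ t₂ : ℝ) : LieVec := if V.P B t₁ t₂ = 0 then V.E₁ B t₁ else V.P B t₁ t₂

theorem isPointOf_pointVec (t₁ t₂ : I) :
    IsPointOf (toPoint (V.pointVec B t₁ t₂)) (V.patch B t₁ t₂) := by
  by_cases h : V.P B t₁ t₂ = 0
  · rw [pointVec, if_pos h]
    refine isPointOf_toPoint (by simp) (V.lieForm_E₁_E₁ B t₁) (V.E₁_ne_zero B t₁) ?_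
    by_cases hk : V.k B = 0
    · rw [patch, if_pos hk, if_pos h]; exact Submodule.subset_span (by simp)
    · rw [patch, if_neg hk, ← Submodule.smul_mem_iff _ hk]
      have : V.k B • V.E₁ B t₁ = V.s₁ B t₁ := by
        simp [s₁, (V.Q_eq_zero_of_P_eq_zero h).1]
      rw [this]; exact Submodule.subset_span (by simp)
  · rw [pointVec, if_neg h]
    exact isPointOf_toPoint (by simp) (V.lieForm_P_P B _ _) h (V.P_mem_patch B _ _)

end CircularQuad

/-! ### Proper frames close to a spherical frame -/

namespace OrthonormalFrame

/-- Rotation of a frame about its first vector. -/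
def rotate₁ (B : OrthonormalFrame) (θ : ℝ) : OrthonormalFrame :=
  ⟨![B.1 0, Real.cos θ • B.1 1 + Real.sin θ • B.1 2, Real.cos θ • B.1 2 - Real.sin θ • B.1 1], by
    have h := Real.sin_sq_add_cos_sq θ
    rw [orthonormal_iff_ite]
    intro i j
    fin_cases i <;> fin_cases j <;>
    simp only [Fin.zero_eta, Fin.mk_one, Fin.reduceFinMk, Matrix.cons_val_zero,
      Matrix.cons_val_one, Matrix.cons_val, inner_add_left, inner_add_right, inner_sub_left,
      inner_sub_right, real_inner_smul_left, real_inner_smul_right, B.inner_self, B.inner_eq,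
      ne_eq, Fin.reduceEq, not_false_eq_true, if_true, if_false] <;> nlinarith⟩

/-- Rotation of a frame about its second vector. -/
def rotate₂ (B : OrthonormalFrame) (θ : ℝ) : OrthonormalFrame :=
  ⟨![Real.cos θ • B.1 0 + Real.sin θ • B.1 2, B.1 1, Real.cos θ • B.1 2 - Real.sin θ • B.1 0], by
    have h := Real.sin_sq_add_cos_sq θ
    rw [orthonormal_iff_ite]
    intro i j
    fin_cases i <;> fin_cases j <;>
    simp only [Fin.zero_eta, Fin.mk_one, Fin.reduceFinMk, Matrix.cons_val_zero,
      Matrix.cons_val_one, Matrix.cons_val, inner_add_left, inner_add_right, inner_sub_left,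
      inner_sub_right, real_inner_smul_left, real_inner_smul_right, B.inner_self, B.inner_eq,
      ne_eq, Fin.reduceEq, not_false_eq_true, if_true, if_false] <;> nlinarith⟩

theorem rotate₁_zero (B : OrthonormalFrame) : B.rotate₁ 0 = B := by
  apply Subtype.ext; funext i; fin_cases i <;> simp [rotate₁]

theorem rotate₂_zero (B : OrthonormalFrame) : B.rotate₂ 0 = B := by
  apply Subtype.ext; funext i; fin_cases i <;> simp [rotate₂]

theorem continuous_rotate₁ (B : OrthonormalFrame) : Continuous B.rotate₁ := by
  refine Continuous.subtype_mk (continuous_pi fun i => ?_) _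
  fin_cases i <;> simp <;> fun_prop

theorem continuous_rotate₂ (B : OrthonormalFrame) : Continuous B.rotate₂ := by
  refine Continuous.subtype_mk (continuous_pi fun i => ?_) _
  fin_cases i <;> simp <;> fun_prop

end OrthonormalFrame

namespace CircularQuad
variable (V : CircularQuad) {B : OrthonormalFrame}

/-- Approximation of a frame of a spherical patch by frames of proper patches. -/
theorem exists_tendsto_frame (hk : V.k B = 0) : ∃ C : ℕ → OrthonormalFrame,
    Tendsto C atTop (𝓝 B) ∧ (∀ j, V.k (C j) ≠ 0) ∧
      ∀ j, V.m₁ (C j) = V.m₁ B ∨ V.m₂ (C j) = V.m₂ B := by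
  have hy : inner ℝ (B.1 2) V.y = 0 := by simpa [k] using hk
  have hθ : Tendsto (fun j : ℕ => 1 / ((j : ℝ) + 1)) atTop (𝓝 0) :=
    tendsto_one_div_add_atTop_nhds_zero_nat
  have hs (j : ℕ) : Real.sin (1 / ((j : ℝ) + 1)) ≠ 0 := by
    apply (Real.sin_pos_of_pos_of_lt_pi (by positivity) _).ne'
    have : 1 / ((j : ℝ) + 1) ≤ 1 := by
      rw [div_le_one (by positivity)]; linarith [Nat.cast_nonneg (α := ℝ) j]
    linarith [Real.pi_gt_three]
  -- Since y ≠ 0 is orthogonal to n, it has a component along t₁ or t₂. Rotating that vector towards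
  -- n makes k nonzero, and the axis of rotation keeps its weight.
  by_cases h : inner ℝ (B.1 1) V.y = 0
  · have h0 : inner ℝ (B.1 0) V.y ≠ 0 := by
      intro h0
      have := B.sum_inner_smul V.y
      rw [hy, h, h0] at this
      exact V.y_ne (by simpa using this.symm)
    refine ⟨fun j => B.rotate₂ (1 / ((j : ℝ) + 1)), ?_, fun j => ?_, fun j => Or.inr ?_⟩
    · have := (B.continuous_rotate₂.tendsto 0).comp hθ
      rwa [B.rotate₂_zero] at this
    · simpa [k, OrthonormalFrame.rotate₂, inner_sub_left, real_inner_smul_left, hy, h0]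
        using hs j
    · simp [m₂, OrthonormalFrame.rotate₂]
  · refine ⟨fun j => B.rotate₁ (1 / ((j : ℝ) + 1)), ?_, fun j => ?_, fun j => Or.inl ?_⟩
    · have := (B.continuous_rotate₁.tendsto 0).comp hθ
      rwa [B.rotate₁_zero] at this
    · simpa [k, OrthonormalFrame.rotate₁, inner_sub_left, real_inner_smul_left, hy, h]
        using hs j
    · simp [m₁, OrthonormalFrame.rotate₁]

/-! ## Continuity of patches in the frame and the parameters -/

theorem continuous_k : Continuous V.k := by
  unfold k
  have h (i) : Continuous fun B : OrthonormalFrame => B.1 i :=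
    (continuous_apply i).comp continuous_subtype_val
  exact continuous_const.mul ((h 2).inner continuous_const)

theorem continuous_m₁ : Continuous V.m₁ := by
  unfold m₁
  have h (i) : Continuous fun B : OrthonormalFrame => B.1 i :=
    (continuous_apply i).comp continuous_subtype_val
  exact continuous_const.mul ((h 0).inner continuous_const)

theorem continuous_m₂ : Continuous V.m₂ := by
  unfold m₂
  have h (i) : Continuous fun B : OrthonormalFrame => B.1 i :=
    (continuous_apply i).comp continuous_subtype_val
  exact continuous_const.mul ((h 1).inner continuous_const)

theorem continuous_b : Continuous V.b := by
  have h (i) : Continuous fun B : OrthonormalFrame => B.1 i :=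
    (continuous_apply i).comp continuous_subtype_val
  have h2 (w : E3) : Continuous fun B : OrthonormalFrame => inner ℝ (B.1 2) w :=
    (h 2).inner continuous_const
  have h3 (w : E3) : Continuous fun B : OrthonormalFrame => inner ℝ w (B.1 2) :=
    continuous_const.inner (h 2)
  exact ((h 2).prodMk (continuous_const.prodMk ((continuous_const.mul (h3 _)).prodMk
    continuous_const))).add ((continuous_const.mul (h2 _)).smul continuous_const)

theorem continuous_a : Continuous V.a := by
  have h1 := V.continuous_k
  have h2 := V.continuous_b
  have : V.a = fun B => V.b B + V.k B • pt V.x := funext V.a_eq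
  rw [this]; fun_prop

theorem continuous_arcMid (x z : E3) : Continuous (arcMid x z) := by
  unfold arcMid tangentVec
  have h2 (w : E3) : Continuous fun t : E3 => inner ℝ t w := continuous_id.inner continuous_const
  have h3 (w : E3) : Continuous fun t : E3 => inner ℝ w t := continuous_const.inner continuous_id
  fun_prop

theorem continuous_mid₁ : Continuous V.mid₁ :=
  (continuous_arcMid _ _).comp ((continuous_apply 0).comp continuous_subtype_val)

theorem continuous_mid₂ : Continuous V.mid₂ :=
  (continuous_arcMid _ _).comp ((continuous_apply 1).comp continuous_subtype_val)

section
variable {ι : Type*} {l : Filter ι} {C : ι → OrthonormalFrame} {t : ι → ℝ} {s : ℝ}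

theorem tendsto_quad {W : Type*} [AddCommGroup W] [Module ℝ W] [TopologicalSpace W]
    [ContinuousAdd W] [ContinuousSMul ℝ W] {f g h : ι → W} {f₀ g₀ h₀ : W}
    (ht : Tendsto t l (𝓝 s)) (hf : Tendsto f l (𝓝 f₀)) (hg : Tendsto g l (𝓝 g₀))
    (hh : Tendsto h l (𝓝 h₀)) :
    Tendsto (fun i => quad (f i) (g i) (h i) (t i)) l (𝓝 (quad f₀ g₀ h₀ s)) := by
  have h1 : Tendsto (fun i => 1 - t i) l (𝓝 (1 - s)) := ht.const_sub 1
  exact (((h1.pow 2).smul hf).add ((ht.mul h1).smul hg)).add ((ht.pow 2).smul hh)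

theorem tendsto_E₁ (hC : Tendsto C l (𝓝 B)) (ht : Tendsto t l (𝓝 s)) :
    Tendsto (fun i => V.E₁ (C i) (t i)) l (𝓝 (V.E₁ B s)) :=
  tendsto_quad ht tendsto_const_nhds ((V.continuous_mid₁.tendsto B).comp hC) tendsto_const_nhds

theorem tendsto_E₂ (hC : Tendsto C l (𝓝 B)) (ht : Tendsto t l (𝓝 s)) :
    Tendsto (fun i => V.E₂ (C i) (t i)) l (𝓝 (V.E₂ B s)) :=
  tendsto_quad ht tendsto_const_nhds ((V.continuous_mid₂.tendsto B).comp hC) tendsto_const_nhds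

theorem tendsto_Q₁ (hC : Tendsto C l (𝓝 B)) (ht : Tendsto t l (𝓝 s)) :
    Tendsto (fun i => V.Q₁ (C i) (t i)) l (𝓝 (V.Q₁ B s)) :=
  tendsto_quad ht tendsto_const_nhds ((V.continuous_m₁.tendsto B).comp hC) tendsto_const_nhds

theorem tendsto_Q₂ (hC : Tendsto C l (𝓝 B)) (ht : Tendsto t l (𝓝 s)) :
    Tendsto (fun i => V.Q₂ (C i) (t i)) l (𝓝 (V.Q₂ B s)) :=
  tendsto_quad ht tendsto_const_nhds ((V.continuous_m₂.tendsto B).comp hC) tendsto_const_nhds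

theorem tendsto_s₁ (hC : Tendsto C l (𝓝 B)) (ht : Tendsto t l (𝓝 s)) :
    Tendsto (fun i => V.s₁ (C i) (t i)) l (𝓝 (V.s₁ B s)) :=
  ((V.tendsto_Q₁ hC ht).smul ((V.continuous_b.tendsto B).comp hC)).add
    (((V.continuous_k.tendsto B).comp hC).smul (V.tendsto_E₁ hC ht))

theorem tendsto_s₂ (hC : Tendsto C l (𝓝 B)) (ht : Tendsto t l (𝓝 s)) :
    Tendsto (fun i => V.s₂ (C i) (t i)) l (𝓝 (V.s₂ B s)) :=
  ((V.tendsto_Q₂ hC ht).smul ((V.continuous_a.tendsto B).comp hC)).sub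
    (((V.continuous_k.tendsto B).comp hC).smul (V.tendsto_E₂ hC ht))

variable {t' : ι → ℝ} {s' : ℝ}

theorem tendsto_P (hC : Tendsto C l (𝓝 B)) (ht : Tendsto t l (𝓝 s)) (ht' : Tendsto t' l (𝓝 s')) :
    Tendsto (fun i => V.P (C i) (t i) (t' i)) l (𝓝 (V.P B s s')) :=
  (((V.tendsto_Q₂ hC ht').smul (V.tendsto_E₁ hC ht)).add
    ((V.tendsto_Q₁ hC ht).smul (V.tendsto_E₂ hC ht'))).sub
    (((V.tendsto_Q₁ hC ht).mul (V.tendsto_Q₂ hC ht')).smul tendsto_const_nhds)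

end

/-- The exceptional parameters of a spherical patch. -/
theorem eq_zero_of_P_eq_zero (hk : V.k B = 0) {t₁ t₂ : I} (h : V.P B t₁ t₂ = 0) :
    V.disc B = 0 ∧ (V.g₁ B t₁ = 0 ∧ (t₁ : ℝ) ≠ 0) ∧ V.g₂ B t₂ = 0 ∧ (t₂ : ℝ) ≠ 0 := by
  have hl₁ := V.l₁_pos.ne'
  have hl₂ := V.l₂_pos.ne'
  obtain ⟨h1, h2⟩ := V.Q_eq_zero_of_P_eq_zero h
  rw [Q₁_eq] at h1
  rw [V.Q₂_eq hk] at h2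
  have t1 : (t₁ : ℝ) ≠ 0 := by
    intro h0; simp [h0, g₁] at h1
  have t2 : (t₂ : ℝ) ≠ 0 := by
    intro h0; simp [h0, g₂] at h2
  have p1 : 0 < (V.l₁ * t₁) ^ 2 := by positivity
  have p2 : 0 < (V.l₂ * t₂) ^ 2 := by positivity
  have hd : V.disc B = 0 := by
    apply le_antisymm
    · by_contra! hd
      nlinarith [sq_nonneg (V.g₂ B t₂), mul_pos hd p2]
    · by_contra! hd
      nlinarith [sq_nonneg (V.g₁ B t₁), mul_pos (neg_pos.2 hd) p1]
  rw [hd] at h1 h2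
  exact ⟨hd, ⟨by simpa using h1, t1⟩, by simpa using h2, t2⟩

/-- Each of g₁, g₂ is affine with value 1 at 0, so it has at most one zero. -/
theorem P_eq_zero_unique (hk : V.k B = 0) {t₁ t₂ u₁ u₂ : I} (h : V.P B t₁ t₂ = 0)
    (h' : V.P B u₁ u₂ = 0) : t₁ = u₁ ∧ t₂ = u₂ := by
  obtain ⟨-, ⟨h1, -⟩, h2, -⟩ := V.eq_zero_of_P_eq_zero hk h
  obtain ⟨-, ⟨h1', -⟩, h2', -⟩ := V.eq_zero_of_P_eq_zero hk h'
  rw [g₁] at h1 h1'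
  rw [g₂] at h2 h2'
  constructor <;> apply Subtype.ext
  · linear_combination (t₁ : ℝ) * h1' - (u₁ : ℝ) * h1
  · linear_combination (t₂ : ℝ) * h2' - (u₂ : ℝ) * h2

end CircularQuad

/-! ### Convergence at and away from the exceptional pair -/

namespace CircularQuad
variable (V : CircularQuad) {B : OrthonormalFrame}

/-- When k and disc vanish at B, both of its weights have discriminant zero. The frame C keeps one
of them, and `disc_add_disc` pushes the other below zero because k ≠ 0 at C. -/
theorem discriminants (hk : V.k B = 0) (hd : V.disc B = 0) {C : OrthonormalFrame}
    (hC : V.k C ≠ 0) (hm : V.m₁ C = V.m₁ B ∨ V.m₂ C = V.m₂ B) :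
    (V.m₁ C ^ 2 = 4 * V.e₁ ∧ V.m₂ C ^ 2 < 4 * V.e₂) ∨
      (V.m₁ C ^ 2 < 4 * V.e₁ ∧ V.m₂ C ^ 2 = 4 * V.e₂) := by
  have h1 := V.l₁_pos
  have h2 := V.l₂_pos
  have hB := V.disc_add_disc B
  have hC' := V.disc_add_disc C
  have hk2 : 0 < V.k C ^ 2 := by positivity
  have d1 : V.m₁ B ^ 2 = 4 * V.e₁ := by
    rw [disc] at hd
    rw [m₁, ← y₁]
    field_simp at hd
    linear_combination 4 * hd
  have d2 : V.m₂ B ^ 2 = 4 * V.e₂ := by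
    rw [hk, d1, sub_self, zero_div, zero_add, div_eq_iff (by positivity)] at hB
    linear_combination hB
  rcases hm with hm | hm
  · left
    rw [hm, d1] at hC' ⊢
    refine ⟨rfl, ?_⟩
    by_contra! h
    have : 0 ≤ (V.m₂ C ^ 2 - 4 * V.e₂) / V.l₂ ^ 2 :=
      div_nonneg (by linarith) (by positivity)
    simp only [sub_self, zero_div, zero_add] at hC'
    linarith
  · right
    rw [hm, d2] at hC' ⊢
    refine ⟨?_, rfl⟩
    by_contra! h
    have : 0 ≤ (V.m₁ C ^ 2 - 4 * V.e₁) / V.l₁ ^ 2 :=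
      div_nonneg (by linarith) (by positivity)
    simp only [sub_self, zero_div, add_zero] at hC'
    linarith

theorem quad_nonneg {m e : ℝ} (h : m ^ 2 ≤ 4 * e) (t : ℝ) : 0 ≤ quad 1 m e t := by
  rw [quad_real]
  nlinarith [sq_nonneg ((1 - t) + m / 2 * t), mul_nonneg (sub_nonneg.2 h) (sq_nonneg t)]

theorem quad_pos {m e : ℝ} (h : m ^ 2 < 4 * e) {t : ℝ} (ht : t ≠ 0) : 0 < quad 1 m e t := by
  rw [quad_real]
  have : 0 < t ^ 2 := by positivity
  nlinarith [sq_nonneg ((1 - t) + m / 2 * t), mul_pos (sub_pos.2 h) this]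

/-- Near an exceptional parameter pair the points are, up to small terms, convex combinations. -/
theorem inv_smul_P (C : OrthonormalFrame) {t₁ t₂ σ₁ σ₂ : ℝ} (hσ₁ : σ₁ ≠ 0) (hσ₂ : σ₂ ≠ 0)
    (h : V.Q₂ C t₂ * σ₁ + V.Q₁ C t₁ * σ₂ ≠ 0) :
    (V.Q₂ C t₂ * σ₁ + V.Q₁ C t₁ * σ₂)⁻¹ • V.P C t₁ t₂ = σ₁⁻¹ • V.E₁ C t₁ +
      (V.Q₁ C t₁ * σ₂ / (V.Q₂ C t₂ * σ₁ + V.Q₁ C t₁ * σ₂)) •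
        (σ₂⁻¹ • V.E₂ C t₂ - σ₁⁻¹ • V.E₁ C t₁ - (V.Q₂ C t₂ / σ₂) • pt V.x) := by
  rw [P]
  match_scalars <;> field_simp
  ring

section
variable {ι : Type*} {l : Filter ι} {C : ι → OrthonormalFrame} {u v : ι → I} {p q : I}

/-- P tends to 0 here, so it has to be rescaled by D. The quotients of E₁ and E₂ by σ₁ = (l₁u)² and
σ₂ = (l₂v)² both tend to Z, and nonnegative weights keep the combination in `inv_smul_P` under
control. -/
theorem tendsto_toPoint_of_P_eq_zero (hk : V.k B = 0) (hC : Tendsto C l (𝓝 B))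
    (hkC : ∀ i, V.k (C i) ≠ 0) (hm : ∀ i, V.m₁ (C i) = V.m₁ B ∨ V.m₂ (C i) = V.m₂ B)
    (hu : Tendsto u l (𝓝 p)) (hv : Tendsto v l (𝓝 q)) (hP : V.P B p q = 0) :
    Tendsto (fun i => toPoint (V.pointVec (C i) (u i) (v i))) l
      (𝓝 (toPoint (V.pointVec B p q))) := by
  obtain ⟨hd, ⟨g1, hp⟩, g2, hq⟩ := V.eq_zero_of_P_eq_zero hk hP
  have hl₁ := V.l₁_pos
  have hl₂ := V.l₂_pos
  have hu' : Tendsto (fun i => (u i : ℝ)) l (𝓝 p) := (continuous_subtype_val.tendsto p).comp hu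
  have hv' : Tendsto (fun i => (v i : ℝ)) l (𝓝 q) := (continuous_subtype_val.tendsto q).comp hv
  have hσ₁ : Tendsto (fun i => (V.l₁ * u i) ^ 2) l (𝓝 ((V.l₁ * p) ^ 2)) :=
    (hu'.const_mul V.l₁).pow 2
  have hσ₂ : Tendsto (fun i => (V.l₂ * v i) ^ 2) l (𝓝 ((V.l₂ * q) ^ 2)) :=
    (hv'.const_mul V.l₂).pow 2
  have hp2 : (V.l₁ * p) ^ 2 ≠ 0 := by positivity
  have hq2 : (V.l₂ * q) ^ 2 ≠ 0 := by positivity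
  have hE₁ : V.E₁ B p = (V.l₁ * p) ^ 2 • V.Z B := by rw [E₁_eq]; simp [comb, g1]
  have hE₂ : V.E₂ B q = (V.l₂ * q) ^ 2 • V.Z B := by rw [V.E₂_eq hk]; simp [comb, g2]
  have hQ₂ : V.Q₂ B q = 0 := (V.Q_eq_zero_of_P_eq_zero hP).2
  have lim1 : Tendsto (fun i => ((V.l₁ * u i) ^ 2)⁻¹ • V.E₁ (C i) (u i)) l (𝓝 (V.Z B)) := by
    have := (hσ₁.inv₀ hp2).smul (V.tendsto_E₁ hC hu')
    rwa [hE₁, smul_smul, inv_mul_cancel₀ hp2, one_smul] at this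
  have lim2 : Tendsto (fun i => ((V.l₂ * v i) ^ 2)⁻¹ • V.E₂ (C i) (v i)) l (𝓝 (V.Z B)) := by
    have := (hσ₂.inv₀ hq2).smul (V.tendsto_E₂ hC hv')
    rwa [hE₂, smul_smul, inv_mul_cancel₀ hq2, one_smul] at this
  have lim3 : Tendsto (fun i => (V.Q₂ (C i) (v i) / (V.l₂ * v i) ^ 2) • pt V.x) l (𝓝 0) := by
    have := ((V.tendsto_Q₂ hC hv').div hσ₂ hq2).smul (tendsto_const_nhds (x := pt V.x))
    rwa [hQ₂, zero_div, zero_smul] at this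
  have lim4 := (lim2.sub lim1).sub lim3
  rw [sub_self, sub_zero] at lim4
  have hne : ∀ᶠ i in l, (u i : ℝ) ≠ 0 ∧ (v i : ℝ) ≠ 0 :=
    (hu'.eventually_ne hp).and (hv'.eventually_ne hq)
  set D : ι → ℝ := fun i =>
    V.Q₂ (C i) (v i) * (V.l₁ * u i) ^ 2 + V.Q₁ (C i) (u i) * (V.l₂ * v i) ^ 2 with hD
  have hQ : ∀ i, 0 ≤ V.Q₁ (C i) (u i) ∧ 0 ≤ V.Q₂ (C i) (v i) := fun i => by
    rcases V.discriminants hk hd (hkC i) (hm i) with h | h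
    · exact ⟨quad_nonneg h.1.le _, quad_nonneg h.2.le _⟩
    · exact ⟨quad_nonneg h.1.le _, quad_nonneg h.2.le _⟩
  have hDpos : ∀ i, (u i : ℝ) ≠ 0 ∧ (v i : ℝ) ≠ 0 → 0 < D i := fun i hi => by
    have h1 : 0 < (V.l₁ * u i) ^ 2 := by have := hi.1; positivity
    have h2 : 0 < (V.l₂ * v i) ^ 2 := by have := hi.2; positivity
    rcases V.discriminants hk hd (hkC i) (hm i) with h | h
    · exact add_pos_of_pos_of_nonneg (mul_pos (quad_pos h.2 hi.2) h1) (mul_nonneg (hQ i).1 h2.le)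
    · exact add_pos_of_nonneg_of_pos (mul_nonneg (hQ i).2 h1.le) (mul_pos (quad_pos h.1 hi.1) h2)
  -- Both summands of D are nonnegative, so this ratio lies in [0, 1] and the correction term tends
  -- to zero.
  have hbd : IsBoundedUnder (· ≤ ·) l
      (norm ∘ fun i => V.Q₁ (C i) (u i) * (V.l₂ * v i) ^ 2 / D i) := by
    refine isBoundedUnder_of_eventually_le (a := 1) ?_
    filter_upwards [hne] with i hi
    have h1 := mul_nonneg (hQ i).1 (sq_nonneg (V.l₂ * v i))
    have h2 := mul_nonneg (hQ i).2 (sq_nonneg (V.l₁ * u i))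
    rw [Function.comp_apply, Real.norm_eq_abs, abs_of_nonneg (div_nonneg h1 (hDpos i hi).le),
      div_le_one (hDpos i hi)]
    simp only [hD]; linarith
  have lim5 := lim1.add (hbd.smul_tendsto_zero lim4)
  rw [add_zero] at lim5
  have lim6 : Tendsto (fun i => (D i)⁻¹ • V.P (C i) (u i) (v i)) l (𝓝 (V.Z B)) := by
    refine lim5.congr' ?_
    filter_upwards [hne] with i hi
    have h1 : (V.l₁ * u i) ^ 2 ≠ 0 := by have := hi.1; positivity
    have h2 : (V.l₂ * v i) ^ 2 ≠ 0 := by have := hi.2; positivity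
    exact (V.inv_smul_P (C i) h1 h2 (hDpos i hi).ne').symm
  have hc := V.isMoebiusChart B
  have hZ : V.Z B ≠ 0 := fun h => V.E₁_ne_zero B p (by rw [hE₁, h, smul_zero])
  have hZ0 : lieForm (V.Z B) (V.Z B) = 0 := hc.2.2.2.2.1
  have hZr : rCoord (V.Z B) = 0 := (hc.2.2.1 _ (by simp)).1
  have lim7 := tendsto_toPoint lim6 hZ hZr hZ0 (fun i => by simp) (fun i => by simp [lieForm_P_P])
  have e : toPoint (V.pointVec B p q) = toPoint (V.Z B) := by
    rw [pointVec, if_pos hP, hE₁, toPoint_smul hp2]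
  rw [e]
  refine lim7.congr' ?_
  filter_upwards [hne] with i hi
  have hDi := hDpos i hi
  rw [toPoint_smul (inv_ne_zero hDi.ne'), pointVec, if_neg]
  intro h0
  obtain ⟨h1, h2⟩ := V.Q_eq_zero_of_P_eq_zero h0
  simp only [hD, h1, h2, zero_mul, add_zero, lt_irrefl] at hDi

theorem tendsto_toPoint_pointVec (hk : V.k B = 0) (hC : Tendsto C l (𝓝 B))
    (hkC : ∀ i, V.k (C i) ≠ 0) (hm : ∀ i, V.m₁ (C i) = V.m₁ B ∨ V.m₂ (C i) = V.m₂ B)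
    (hu : Tendsto u l (𝓝 p)) (hv : Tendsto v l (𝓝 q)) :
    Tendsto (fun i => toPoint (V.pointVec (C i) (u i) (v i))) l
      (𝓝 (toPoint (V.pointVec B p q))) := by
  by_cases hP : V.P B p q = 0
  · exact V.tendsto_toPoint_of_P_eq_zero hk hC hkC hm hu hv hP
  have hu' : Tendsto (fun i => (u i : ℝ)) l (𝓝 p) := (continuous_subtype_val.tendsto p).comp hu
  have hv' : Tendsto (fun i => (v i : ℝ)) l (𝓝 q) := (continuous_subtype_val.tendsto q).comp hv
  have h := V.tendsto_P hC hu' hv'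
  rw [pointVec, if_neg hP]
  refine (tendsto_toPoint h hP (by simp) (V.lieForm_P_P B _ _) (fun i => by simp)
    (fun i => V.lieForm_P_P _ _ _)).congr' ?_
  filter_upwards [h.eventually_ne hP] with i hi
  rw [pointVec, if_neg hi]

theorem exists_tendsto_of_mem_patch (hk : V.k B = 0) (hC : Tendsto C l (𝓝 B))
    (hkC : ∀ i, V.k (C i) ≠ 0) (hu : Tendsto u l (𝓝 p)) (hv : Tendsto v l (𝓝 q))
    (hP : V.P B p q ≠ 0) {w : LieVec} (hw : w ∈ V.patch B p q) :
    ∃ W : ι → LieVec, (∀ i, W i ∈ V.patch (C i) (u i) (v i)) ∧ Tendsto W l (𝓝 w) := by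
  have hu' : Tendsto (fun i => (u i : ℝ)) l (𝓝 p) := (continuous_subtype_val.tendsto p).comp hu
  have hv' : Tendsto (fun i => (v i : ℝ)) l (𝓝 q) := (continuous_subtype_val.tendsto q).comp hv
  rw [patch, if_pos hk, if_neg hP] at hw
  obtain ⟨α, β, rfl⟩ := Submodule.mem_span_pair.1 hw
  -- The sphere b is approached by s₁ / Q₁ or s₂ / Q₂, since k → 0. One of the two is available
  -- because P ≠ 0 excludes a common zero of the weights.
  by_cases h₁ : V.Q₁ B p = 0
  · have h₂ : V.Q₂ B q ≠ 0 := fun h₂ => hP (by simp [P, h₁, h₂])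
    refine ⟨fun i => (α / V.Q₂ B q) • V.s₂ (C i) (v i) + β • V.P (C i) (u i) (v i), fun i => ?_,
      ?_⟩
    · refine Submodule.add_mem _ (Submodule.smul_mem _ _ ?_)
        (Submodule.smul_mem _ _ (V.P_mem_patch _ _ _))
      rw [patch, if_neg (hkC i)]; exact Submodule.subset_span (by simp)
    · have := ((V.tendsto_s₂ hC hv').const_smul (α / V.Q₂ B q)).add
        ((V.tendsto_P hC hu' hv').const_smul β)
      rwa [s₂, a_eq, hk, zero_smul, zero_smul, add_zero, sub_zero, smul_smul,
        div_mul_cancel₀ _ h₂] at this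
  · refine ⟨fun i => (α / V.Q₁ B p) • V.s₁ (C i) (u i) + β • V.P (C i) (u i) (v i), fun i => ?_,
      ?_⟩
    · refine Submodule.add_mem _ (Submodule.smul_mem _ _ ?_)
        (Submodule.smul_mem _ _ (V.P_mem_patch _ _ _))
      rw [patch, if_neg (hkC i)]; exact Submodule.subset_span (by simp)
    · have := ((V.tendsto_s₁ hC hu').const_smul (α / V.Q₁ B p)).add
        ((V.tendsto_P hC hu' hv').const_smul β)
      rwa [s₁, hk, zero_smul, add_zero, smul_smul, div_mul_cancel₀ _ h₁] at this

end

/-- Spherical patches are limits of proper patches with the same vertices. -/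
theorem exists_patchesTendsTo (L : ParamPatch V.x V.x₁ V.x₁₂ V.x₂) (hL : IsSphericalPatch L.1) :
    ∃ Lk : ℕ → ParamPatch V.x V.x₁ V.x₁₂ V.x₂,
      (∀ k, IsProperPatch (Lk k).1) ∧ PatchesTendsTo (fun k => (Lk k).1) L.1 := by
  obtain ⟨B, l, m, hl, hm, hk, hLB⟩ := V.exists_patch_of_isSphericalPatch hL L.2.2
  obtain ⟨C, hC, hkC, hmC⟩ := V.exists_tendsto_frame hk
  set φ := repIso l hl
  set ψ := repIso m hm
  -- The approximating patches use the same parameter changes as the limit, so points are compared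
  -- at equal parameters.
  have hprop (j : ℕ) : IsProperPatch fun t₁ t₂ => V.patch (C j) (φ t₁) (ψ t₂) :=
    V.isProperPatch_rep (C j) (hkC j) hl hm
  refine ⟨fun j => ⟨fun t₁ t₂ => V.patch (C j) (φ t₁) (ψ t₂), Or.inl (hprop j),
    (V.hasVertices_patch (C j)).comp φ ψ⟩, hprop, ?_⟩
  have hC' (p : I × I) : Tendsto (fun q : ℕ × (I × I) => C q.1) (atTop ×ˢ 𝓝 p) (𝓝 B) :=
    hC.comp tendsto_fst
  have hu (p : I × I) : Tendsto (fun q : ℕ × (I × I) => φ q.2.1) (atTop ×ˢ 𝓝 p) (𝓝 (φ p.1)) :=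
    ((φ.continuous.comp continuous_fst).tendsto p).comp tendsto_snd
  have hv (p : I × I) : Tendsto (fun q : ℕ × (I × I) => ψ q.2.2) (atTop ×ˢ 𝓝 p) (𝓝 (ψ p.2)) :=
    ((ψ.continuous.comp continuous_snd).tendsto p).comp tendsto_snd
  constructor
  · refine ⟨fun j t₁ t₂ => toPoint (V.pointVec (C j) (φ t₁) (ψ t₂)),
      fun t₁ t₂ => toPoint (V.pointVec B (φ t₁) (ψ t₂)),
      fun j t₁ t₂ => V.isPointOf_pointVec _ _ _, fun t₁ t₂ => ?_, fun p => ?_⟩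
    · rw [hLB]; exact V.isPointOf_pointVec _ _ _
    · exact V.tendsto_toPoint_pointVec hk (hC' p) (fun q => hkC q.1) (fun q => hmC q.1) (hu p)
        (hv p)
  · have hex : ∃ p₀ : I × I, ∀ p : I × I, p ≠ p₀ → V.P B (φ p.1) (ψ p.2) ≠ 0 := by
      by_cases h : ∃ p₀ : I × I, V.P B (φ p₀.1) (ψ p₀.2) = 0
      · obtain ⟨p₀, h₀⟩ := h
        refine ⟨p₀, fun p hp h0 => hp ?_⟩
        obtain ⟨h1, h2⟩ := V.P_eq_zero_unique hk h0 h₀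
        exact Prod.ext (φ.injective h1) (ψ.injective h2)
      · exact ⟨0, fun p _ h0 => h ⟨p, h0⟩⟩
    obtain ⟨p₀, h₀⟩ := hex
    refine ⟨p₀, fun p hp w hw => ?_⟩
    rw [hLB] at hw
    exact V.exists_tendsto_of_mem_patch hk (hC' p) (fun q => hkC q.1) (hu p) (hv p) (h₀ p hp) hw

end CircularQuad

end LieGeometry

end

theorem mainTheorem1 (x x₁ x₁₂ x₂ : E3) (hdist : [x, x₁, x₁₂, x₂].Nodup)
    (hcirc : Concircular x x₁ x₁₂ x₂) :
    -- cyclidic patches with these vertices correspond to orthonormal 3-frames at `x`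
    (∃ Φ : CyclidicPatch x x₁ x₁₂ x₂ ≃ OrthonormalFrame,
      ∀ (L : ParamPatch x x₁ x₁₂ x₂) (B : OrthonormalFrame),
        Φ (Quotient.mk (patchSetoid x x₁ x₁₂ x₂) L) = B ↔ HasVertexFrame L.1 x B) ∧
    -- the frames form a three-dimensional (topological) manifold
    (∀ B : OrthonormalFrame,
      ∃ e : OpenPartialHomeomorph OrthonormalFrame (EuclideanSpace ℝ (Fin 3)), B ∈ e.source) ∧
    -- the spherical patches are limits of proper cyclidic patches with the same vertices
    (∀ L : ParamPatch x x₁ x₁₂ x₂, IsSphericalPatch L.1 →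
      ∃ Lk : ℕ → ParamPatch x x₁ x₁₂ x₂,
        (∀ k, IsProperPatch (Lk k).1) ∧ PatchesTendsTo (fun k => (Lk k).1) L.1) := by
  obtain ⟨V, rfl, rfl, rfl, rfl⟩ := exists_circularQuad_of_concircular hdist hcirc
  exact ⟨V.exists_equiv, fun B => ⟨B.chart, B.mem_chart_source⟩, V.exists_patchesTendsTo⟩
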